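/- Let $D\ge 3$ and $N\ge 1$, and consider complex tensors $\mathbb T=(\mathbb T_{a_1\dots a_D})$, $1\le a_i\le N$. For $C\subset\{1,\dots,D\}$ let $\mathcal B_{4,C}$ be the $D$-edge-colored graph with two white and two black vertices, divided into two white-black pairs, in which the edges of color $c\notin C$ join the two vertices of each pair and the edges of color $c\in C$ join the two pairs to each other; let $\mathcal B_2$ be the graph with one white and one black vertex. To such a graph $\mathcal B$ one associates the trace invariant $\mathrm{Tr}_{\mathcal B}(\mathbb T,\overline{\mathbb T})$ ($\mathbb T$ on white vertices, $\overline{\mathbb T}$ on black vertices, an index contraction in position $c$ for each edge of color $c$). The quartic model has the action $$S=\mathrm{Tr}_{\mathcal B_2}-\frac z2\sum_{c=1}^D \mathrm{Tr}_{\mathcal B_{4,\{c\}}},\qquad \langle f\rangle=\frac{\int f\,e^{-N^{D-1}S}}{\int e^{-N^{D-1}S}},$$ where $\langle f\rangle$ is understood perturbatively, as the formal power series in $z$ obtained by expanding $e^{N^{D-1}\frac z2\sum_c \mathrm{Tr}_{\mathcal B_{4,\{c\}}}}$ and integrating term by term against the Gaussian weight $e^{-N^{D-1}\mathrm{Tr}_{\mathcal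 B_2}}$. All identities and limits below are coefficientwise in $z$. Put $$\sqrt{1-4Dz}=\sum_{n\ge0}\binom{1/2}{n}(-4Dz)^n,\qquad T(z)=\frac{1-\sqrt{1-4Dz}}{2Dz}.$$ **Two-point function.** Let $K_2(D,N;z)=\frac1N\langle \mathrm{Tr}_{\mathcal B_2}\rangle$. Then $\lim_{N\to\infty}K_2(D,N;z)=T(z)$. For every $n$ there are finitely many polynomials $A_{n,l,m}\in\mathbb C[D]$ ($l,m\ge0$) such that $$[z^n]K_2(D,N;z)=\sum_{l,m}A_{n,l,m}(D)\,N^{-(lD-m)}\qquad\text{for all } D\ge3,\ N\ge1,$$ and they are uniquely determined. Let $K_2^{\rm NNLO}(z)=\sum_n A_{n,1,0}(D)z^n$ be the contribution at order $1/N^D$, i.e. the part which scales like $N^{-D}$ uniformly in $D$. Then for every $D\ge 3$ $$K_2^{\rm NNLO}(z)=\frac{D(D-1)\,z^2\,T(z)^3}{(1-4Dz)\,(1-z\,T(z)^2)} .$$ For $D\ge5$, for every $n$, $[z^n]K_2(D,N;z)$ is a Laurent polynomial in $N$, and its coefficient of $N^{-D}$ is the coefficient of $z^n$ in this series. (For $D=4$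 and $D=3$, the plain coefficient of $N^{-D}$ also receives the contributions of order $N^{-2(D-2)}$, respectively $N^{-3(D-2)}$, which are not part of $K_2^{\rm NNLO}$.) **Four-point function.** Let $W^{(2)}_{\vec a,\vec b}=\langle \mathbb T_{\vec a}\overline{\mathbb T}_{\vec b}\rangle$ and let $$W^{(4)}_{\vec a^1\vec a^2,\vec b^1\vec b^2}=\langle \mathbb T_{\vec a^1}\mathbb T_{\vec a^2}\overline{\mathbb T}_{\vec b^1}\overline{\mathbb T}_{\vec b^2}\rangle-W^{(2)}_{\vec a^1,\vec b^1}W^{(2)}_{\vec a^2,\vec b^2}-W^{(2)}_{\vec a^1,\vec b^2}W^{(2)}_{\vec a^2,\vec b^1}$$ be the four-point cumulant. It has an expansion $W^{(4)}=\sum_{|C|\le D/2}\bar\delta^{\mathcal B_{4,C}}\,W(\mathcal B_{4,C};N,z)$ onto the symmetrized trace-invariant operators $$\bar\delta^{\mathcal B_{4,C}}_{\vec a^1\vec a^2,\vec b^1\vec b^2}=\prod_{c\notin C}\delta_{a^1_cb^1_c}\delta_{a^2_cb^2_c}\prod_{c\in C}\delta_{a^1_cb^2_c}\delta_{a^2_cb^1_c}+\prod_{c\notin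 C}\delta_{a^2_cb^1_c}\delta_{a^1_cb^2_c}\prod_{c\in C}\delta_{a^2_cb^2_c}\delta_{a^1_cb^1_c},$$ in which $W(\mathcal B_{4,\emptyset};N,z)$ is uniquely determined for $N\ge2$. Let $K(\mathcal B_{4,\emptyset};N,z)=N^{3D-2}\,W(\mathcal B_{4,\emptyset};N,z)$. Then $K^{\rm LO}_{4,\emptyset}(z)=\lim_{N\to\infty}K(\mathcal B_{4,\emptyset};N,z)$ exists, and $$K^{\rm LO}_{4,\emptyset}(z)=\frac{D(D-1)\,z^2\,T(z)^5}{\sqrt{1-4Dz}\,(1-z\,T(z)^2)} .$$ Moreover $K^{\rm LO}_{4,\emptyset}$ is the generating function of strictly multicolored chains of quartic bubbles: $$K^{\rm LO}_{4,\emptyset}(z)=\sum_{k\ge1}\ \sum_{\substack{(c_1,\dots,c_k)\in\{1,\dots,D\}^k\\ \text{not all equal}}} z^k\,T(z)^{2(k+1)},$$ where a chain of $k$ bubbles transmitting the colors $c_1,\dots,c_k$ carries a factor $z$ for each bubble, $T(z)^2$ for each of the $k-1$ places between successive bubbles, and $T(z)^2$ for each of its two ends. -/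

import Mathlib

namespace QuarticTensor

noncomputable section

/-! ### Tensors, bubbles and trace invariants -/

/-- The `D`-uples of indices `(a_1, …, a_D)`, each in a set with `N` elements. -/
abbrev Index (D N : ℕ) : Type := Fin D → Fin N

/-- Complex tensors of rank `D` and size `N`. -/
abbrev Tensor (D N : ℕ) : Type := Index D N → ℂ

/-- A (not necessarily connected) bipartite `D`-regular graph with properly edge-coloured edges,
on `p` labelled white and `p` labelled black vertices: the edge of colour `c` at the white vertex
`v` ends at the black vertex `B c v`. -/
abbrev Bubble (D p : ℕ) : Type := Fin D → Equiv.Perm (Fin p)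

/-- The trace-invariant operator of a bubble: a product of Kronecker deltas, one per edge. -/
def delta {D N p : ℕ} (B : Bubble D p) (a b : Fin p → Index D N) : ℂ :=
  ∏ c : Fin D, ∏ v : Fin p, if a v c = b (B c v) c then 1 else 0

/-- The invariant polynomial `Tr_B(T, T̄)`. -/
def traceInvariant {D N p : ℕ} (B : Bubble D p) (T : Tensor D N) : ℂ :=
  ∑ a : Fin p → Index D N, ∑ b : Fin p → Index D N,
    delta B a b * ((∏ v, T (a v)) * ∏ v, starRingEnd ℂ (T (b v)))

/-- The bubble with two vertices. -/
def bubbleTwo (D : ℕ) : Bubble D 1 := fun _ => 1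

/-- The four-vertex graph `B_{4,C}`: the edges with colours outside `C` join the two vertices of
each of the pairs `(0, 0)`, `(1, 1)`, those with colours in `C` join the two pairs. For `C = ∅` it
is two copies of the bubble with two vertices; for `C = {c}` it is the quartic melonic bubble. -/
def bubbleFour {D : ℕ} (C : Finset (Fin D)) : Bubble D 2 :=
  fun c => if c ∈ C then Equiv.swap 0 1 else 1

theorem traceInvariant_bubbleTwo {D N : ℕ} (T : Tensor D N) :
    traceInvariant (bubbleTwo D) T = ((∑ a, ‖T a‖ ^ 2 : ℝ) : ℂ) := by
  classical
  have hd : ∀ a b : Fin 1 → Index D N, delta (bubbleTwo D) a b = if a = b then 1 else 0 := by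
    intro a b
    simp only [delta, bubbleTwo, Equiv.Perm.coe_one, id_eq, Finset.univ_unique,
      Finset.prod_singleton, Fin.default_eq_zero]
    by_cases h : a = b
    · simp [h]
    · rw [if_neg h]
      have : ∃ c, a 0 c ≠ b 0 c := by
        by_contra hc
        push Not at hc
        exact h (funext fun i => by rw [Subsingleton.elim i 0]; exact funext hc)
      obtain ⟨c, hc⟩ := this
      exact Finset.prod_eq_zero (Finset.mem_univ c) (if_neg hc)
  simp only [traceInvariant, hd, ite_mul, one_mul, zero_mul, Finset.sum_ite_eq, Finset.mem_univ,
    if_true, Finset.univ_unique, Finset.prod_singleton, Fin.default_eq_zero]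
  rw [Complex.ofReal_sum, ← (Equiv.funUnique (Fin 1) (Index D N)).sum_comp]
  refine Finset.sum_congr rfl fun a _ => ?_
  simp [Complex.mul_conj, Complex.normSq_eq_norm_sq]

/-! ### The quartic model, in perturbation theory -/

/-- The weight `exp (- N^{D-1} Tr_{B_2}(T, T̄))` of the quadratic part of the action. -/
def gaussianWeight {D N : ℕ} (T : Tensor D N) : ℝ :=
  Real.exp (-((N : ℝ) ^ (D - 1) * ∑ a, ‖T a‖ ^ 2))

/-- The normalized Gaussian expectation of an observable. -/
def gaussianExpectation {D N : ℕ} (f : Tensor D N → ℂ) : ℂ :=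
  (∫ T : Tensor D N, (gaussianWeight T : ℂ) * f T) / ∫ T : Tensor D N, (gaussianWeight T : ℂ)

/-- The quartic term of `- N^{D-1} S`, without its coupling `z`:
`N^{D-1} ∑_c (1/2) Tr_{B_{4,{c}}}`. -/
def interaction {D N : ℕ} (T : Tensor D N) : ℂ :=
  (N : ℂ) ^ (D - 1) * ∑ c : Fin D, (1 / 2 : ℂ) * traceInvariant (bubbleFour {c}) T

/-- The perturbative expansion of `∫ f e^{-N^{D-1} S}`, normalized by the Gaussian integral: the
formal power series in `z` obtained by expanding `exp (z * interaction)` and integrating term by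
term. -/
def perturbative {D N : ℕ} (f : Tensor D N → ℂ) : PowerSeries ℂ :=
  PowerSeries.mk fun n =>
    gaussianExpectation (fun T : Tensor D N => f T * interaction T ^ n) / (n.factorial : ℂ)

/-- The expectation `⟨f⟩` in the quartic model, as a formal power series in `z`. -/
def expectation {D N : ℕ} (f : Tensor D N → ℂ) : PowerSeries ℂ :=
  perturbative f * (perturbative (fun _ : Tensor D N => (1 : ℂ)))⁻¹

/-- The two-point function `K(B_2; N, z) = (1/N) ⟨Tr_{B_2}⟩`. -/
def twoPoint (D N : ℕ) : PowerSeries ℂ :=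
  PowerSeries.C ((N : ℂ)⁻¹) *
    expectation (fun T : Tensor D N => traceInvariant (bubbleTwo D) T)

/-- The cumulant `W^{(2)}_{a, b}`. -/
def cumulantTwo {D N : ℕ} (a b : Index D N) : PowerSeries ℂ :=
  expectation fun T : Tensor D N => T a * starRingEnd ℂ (T b)

/-- The cumulant (connected moment) `W^{(4)}_{a^1 a^2, b^1 b^2}`. -/
def cumulantFour {D N : ℕ} (a b : Fin 2 → Index D N) : PowerSeries ℂ :=
  expectation (fun T : Tensor D N =>
      T (a 0) * T (a 1) * (starRingEnd ℂ (T (b 0)) * starRingEnd ℂ (T (b 1))))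
    - cumulantTwo (a 0) (b 0) * cumulantTwo (a 1) (b 1)
    - cumulantTwo (a 0) (b 1) * cumulantTwo (a 1) (b 0)

/-- The trace-invariant operator of `B_{4,C}`, symmetrized over its indices. -/
def symDelta {D N : ℕ} (C : Finset (Fin D)) (a b : Fin 2 → Index D N) : ℂ :=
  delta (bubbleFour C) a b + delta (bubbleFour C) (fun v => a (Equiv.swap 0 1 v)) b

/-- `W` is a family of coefficients `W(B_{4,C}; N, z)` of the expansion of the four-point cumulant
onto trace-invariant operators,
`W^{(4)} = ∑_{|C| ≤ D/2} symDelta C * W(B_{4,C}; N, z)`.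
(For `N ≥ 2` and `D ≥ 1` the coefficient of `C = ∅` is determined by this equation.) -/
def IsInvariantExpansion (D N : ℕ) (W : Finset (Fin D) → PowerSeries ℂ) : Prop :=
  ∀ a b : Fin 2 → Index D N,
    cumulantFour a b =
      ∑ C ∈ Finset.univ.filter (fun C : Finset (Fin D) => 2 * C.card ≤ D),
        PowerSeries.C (symDelta C a b) * W C

/-- The exponent `D - 2 (D-1) p - ρ` by which a coefficient `W(B; N, z)` is rescaled, for a graph
`B` with `p` black vertices and `ρ` connected components. -/
def scaling (D p ρ : ℕ) : ℤ := (D : ℤ) - 2 * ((D : ℤ) - 1) * p - ρ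

/-- `K(B_{4,∅}; N, z)`, the rescaled coefficient of `B_{4,∅}` (which has two black vertices and two
connected components). -/
def rescaledFourEmpty (D N : ℕ) (W : Finset (Fin D) → PowerSeries ℂ) : PowerSeries ℂ :=
  PowerSeries.C ((N : ℂ) ^ (-scaling D 2 2)) * W ∅

/-! ### The order `1/N^D` of the two-point function -/

/-- `e` is the `1/N` expansion of the coefficient of `z^n` in the two-point function at fixed `D`:
`e k` is the coefficient of `N^{-k}`. -/
def IsLargeNExpansion (D n : ℕ) (e : ℤ →₀ ℂ) : Prop :=
  ∀ N : ℕ, 1 ≤ N → PowerSeries.coeff n (twoPoint D N) = e.sum fun k x => x * (N : ℂ) ^ (-k)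

/-- `A` is the `1/N` expansion of the two-point function simultaneously for all `D ≥ 3`, in which
contributions are sorted by the way in which their scaling with `N` depends on `D`: at order `z^n`
the contributions which scale like `N^{-(l D - m)}` have a total coefficient `A n (l, m)`, a
polynomial in `D`. (For large `D` the exponents `l D - m` which occur at order `z^n` are distinct,
hence such an `A` is unique. At small `D` it separates contributions whose orders coincide, such as
`N^{-D}` and `N^{-2(D-2)}` at `D = 4`, or `N^{-D}` and `N^{-3(D-2)}` at `D = 3`.) -/
def IsUniformExpansion (A : ℕ → (ℕ × ℕ →₀ Polynomial ℂ)) : Prop :=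
  ∀ D N n : ℕ, 3 ≤ D → 1 ≤ N →
    PowerSeries.coeff n (twoPoint D N) =
      (A n).sum fun lm P => P.eval (D : ℂ) * (N : ℂ) ^ (-((lm.1 : ℤ) * D - lm.2))

/-- The restriction of the two-point function to the order `1/N^D`, as a formal power series in
`z`: the contributions which scale like `N^{-D}` uniformly in `D`. -/
def orderD (A : ℕ → (ℕ × ℕ →₀ Polynomial ℂ)) (D : ℕ) : PowerSeries ℂ :=
  PowerSeries.mk fun n => (A n (1, 0)).eval (D : ℂ)

/-! ### The explicit generating functions -/

/-- `√(1 - 4 D z)` as a formal power series in `z`. -/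
def sqrtSeries (D : ℕ) : PowerSeries ℂ :=
  PowerSeries.rescale (-(4 * D : ℂ)) (PowerSeries.binomialSeries ℂ (1 / 2 : ℂ))

/-- `T(z) = (1 - √(1 - 4 D z)) / (2 D z)` as a formal power series in `z`, for `D ≥ 1`. -/
def treeSeries (D : ℕ) : PowerSeries ℂ :=
  PowerSeries.mk fun n => PowerSeries.coeff (n + 1) (1 - sqrtSeries D) / (2 * D : ℂ)

theorem sqrtSeries_sq (D : ℕ) :
    sqrtSeries D ^ 2 = 1 - PowerSeries.C (4 * D : ℂ) * PowerSeries.X := by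
  have h : (PowerSeries.binomialSeries ℂ (1 / 2 : ℂ)) ^ 2 = 1 + PowerSeries.X := by
    rw [sq, ← PowerSeries.binomialSeries_add]
    have := PowerSeries.binomialSeries_nat (A := ℂ) (R := ℂ) 1
    norm_num at this ⊢
    exact this
  rw [sqrtSeries, ← map_pow, h, map_add, map_one, PowerSeries.rescale_X, map_neg, neg_mul,
    sub_eq_add_neg]

theorem two_mul_treeSeries (D : ℕ) (hD : 1 ≤ D) :
    PowerSeries.C (2 * D : ℂ) * PowerSeries.X * treeSeries D = 1 - sqrtSeries D := by
  have hD' : (D : ℂ) ≠ 0 := by exact_mod_cast (by omega : D ≠ 0)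
  ext n
  rw [mul_assoc, PowerSeries.coeff_C_mul]
  cases n with
  | zero =>
    have h : PowerSeries.coeff 0 (PowerSeries.X * treeSeries D) = 0 :=
      PowerSeries.coeff_zero_X_mul _
    rw [h, map_sub, sqrtSeries, PowerSeries.coeff_rescale, PowerSeries.binomialSeries_coeff]
    simp
  | succ n =>
    rw [PowerSeries.coeff_succ_X_mul, treeSeries, PowerSeries.coeff_mk]
    field_simp

/-- The chains of `k` quartic bubbles in which the transmitted colour changes at least once,
recorded by the colours of the successive bubbles. -/
def multicoloredChains (D k : ℕ) : Finset (Fin k → Fin D) :=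
  Finset.univ.filter fun w => ∃ i j, w i ≠ w j

/-- The generating function of strictly multicolored chains. Each of the `k` bubbles of a chain has
weight `z`; each of the `k - 1` places between successive bubbles carries two factors `T(z)`, and
each of the two ends of the chain carries two factors `T(z)`. A chain of `k` bubbles contributes
only to orders `z^n` with `n ≥ k`. -/
def multicoloredChainSeries (D : ℕ) : PowerSeries ℂ :=
  PowerSeries.mk fun n => ∑ k ∈ Finset.range (n + 1), ∑ _w ∈ multicoloredChains D k,
    PowerSeries.coeff n (PowerSeries.X ^ k * treeSeries D ^ (2 * (k + 1)))

/-- `D (D-1) z² T³ / ((1 - 4 D z) (1 - z T²))`. -/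
def twoPointFormula (D : ℕ) : PowerSeries ℂ :=
  PowerSeries.C ((D : ℂ) * ((D : ℂ) - 1)) * PowerSeries.X ^ 2 * treeSeries D ^ 3 *
    ((1 - PowerSeries.C (4 * D : ℂ) * PowerSeries.X) *
      (1 - PowerSeries.X * treeSeries D ^ 2))⁻¹

/-- `D (D-1) z² T⁵ / (√(1 - 4 D z) (1 - z T²))`. -/
def fourPointFormula (D : ℕ) : PowerSeries ℂ :=
  PowerSeries.C ((D : ℂ) * ((D : ℂ) - 1)) * PowerSeries.X ^ 2 * treeSeries D ^ 5 *
    (sqrtSeries D * (1 - PowerSeries.X * treeSeries D ^ 2))⁻¹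

end

end QuarticTensor

namespace QuarticTensor

open Equiv Equiv.Perm

/-! ### Cycles of permutations -/

/-! Expanding the exponential and applying Wick's theorem turns every moment into a sum over
combinatorial maps. A quartic bubble becomes an edge with a colour, its two white vertices become
the two darts of that edge, and the external tensors become marked corners. The Wick pairing is a
permutation `σ` of the darts whose cycles are the vertices of the map. For each colour `k`, the
index contractions follow the cycles of `σ * flip c k`, the faces of colour `k`; a face without
marks leaves one index free and gives a factor `N` (`coeff_perturbative_monomial`,
`exists_labelCount_eq`).

Power counting rests on one fact: closing an edge of colour `i` multiplies the face permutation of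
colour `i` by a transposition, which splits a face or merges two, and leaves the other colours
alone. So the number of faces is `D V - E + 2 e`, where the excess `e` counts the splittings
(`excess_spec`), and a connected map with `l = E + 1 - V` independent cycles contributes `N ^ (-(l D
- 2 e))`, with `e ≤ l` (`excess_add_cyc_le`). Trees dominate, and the order `N ^ (-D)` uniform in
`D` consists of the maps with `l = 1`, `e = 0`. When `D ≥ 5` no other map has this order, since `l
(D - 2) > D` for `l ≥ 2`.

All that is needed is therefore the generating function of maps without excess, to first order in
the variable `x` of `l`. Setting the weight `w` of the excess to zero makes a Schwinger–Dyson
recursion available: remove a marked corner and cut open the edge which follows it, on condition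
that the two ends do not share a face of the colour of the edge (`mapSeries_option`). Splitting off
the component of a mark (`mapSeries_eq_sum_component`) gives equations for connected maps with one
and two marks; the term with three marks comes with a factor `x`. Hence at `x = 0` the system closes
for any weight `G` of the set of colours of the faces shared by two marks, and the linear term in
`x` of the one-mark function needs only `G = avoids i` at `x = 0`. What remains is algebra with `T =
1 + D z T ^ 2` and `√(1 - 4 D z) = 1 - 2 D z T`.

For the four-point function, the cumulant is evaluated on two index tuples which differ in every
colour. This isolates the operator of `B_{4,∅}` and selects the connected maps whose two marks share
no face (`rescaledFourEmpty_eq`); at leading order these are trees. The chains are counted by the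
difference of two geometric series (`multicoloredChainSeries_eq`).

Uniformity in `D` holds because the excess ignores absent colours: grouping colourings by the number
`j` of colours used produces binomial coefficients `D.choose j`, polynomial in `D`. Any uniform
expansion agrees with this one at all large `D`, where different exponents cannot collide with `D`,
hence as a polynomial also at `D = 3` and `D = 4` (`orderD_eq`). -/

/-- The equivalence relation obtained from `s` by identifying the classes of `a` and `b`. -/
def gluePair {α : Type*} (s : Setoid α) (a b : α) : Setoid α where
  r x y := s x y ∨ (s x a ∧ s b y) ∨ (s x b ∧ s a y)
  iseqv := by
    refine ⟨fun x => Or.inl (s.refl x), ?_, ?_⟩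
    · rintro x y (h | ⟨h, h'⟩ | ⟨h, h'⟩)
      · exact Or.inl (s.symm h)
      · exact Or.inr (Or.inr ⟨s.symm h', s.symm h⟩)
      · exact Or.inr (Or.inl ⟨s.symm h', s.symm h⟩)
    · rintro x y z (h | ⟨h, h'⟩ | ⟨h, h'⟩) (k | ⟨k, k'⟩ | ⟨k, k'⟩)
      · exact Or.inl (s.trans h k)
      · exact Or.inr (Or.inl ⟨s.trans h k, k'⟩)
      · exact Or.inr (Or.inr ⟨s.trans h k, k'⟩)
      · exact Or.inr (Or.inl ⟨h, s.trans h' k⟩)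
      · exact Or.inr (Or.inl ⟨h, k'⟩)
      · exact Or.inl (s.trans h k')
      · exact Or.inr (Or.inr ⟨h, s.trans h' k⟩)
      · exact Or.inl (s.trans h k')
      · exact Or.inr (Or.inr ⟨h, k'⟩)

theorem gluePair_iff {α : Type*} {s : Setoid α} {a b x y : α} :
    gluePair s a b x y ↔ s x y ∨ (s x a ∧ s b y) ∨ (s x b ∧ s a y) := Iff.rfl

theorem gluePair_eq_self {α : Type*} {s : Setoid α} {a b : α} (h : s a b) :
    gluePair s a b = s := by
  ext x y
  rw [gluePair_iff]
  constructor
  · rintro (h' | ⟨h1, h2⟩ | ⟨h1, h2⟩)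
    · exact h'
    · exact s.trans (s.trans h1 h) h2
    · exact s.trans (s.trans h1 (s.symm h)) h2
  · exact Or.inl

/-- The classes other than that of `b` biject with the glued classes; the merged class is
represented by that of `a`. -/
theorem card_quotient_gluePair {α : Type*} [Finite α] {s : Setoid α} {a b : α} (h : ¬ s a b) :
    Nat.card (Quotient s) = Nat.card (Quotient (gluePair s a b)) + 1 := by
  classical
  have := Fintype.ofFinite (Quotient s)
  have hb : ∀ q : Quotient s, q ≠ ⟦b⟧ ∨ q = ⟦b⟧ := fun q => (em _).symm
  let f : {q : Quotient s // q ≠ ⟦b⟧} → Quotient (gluePair s a b) := fun q =>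
    Quotient.map' id (fun x y h => Or.inl h) q.1
  have hf : Function.Bijective f := by
    constructor
    · rintro ⟨p, hp⟩ ⟨q, hq⟩ hpq
      induction p using Quotient.inductionOn with | _ x
      induction q using Quotient.inductionOn with | _ y
      have hx : ¬ s x b := fun h => hp (Quotient.sound h)
      have hy : ¬ s y b := fun h => hq (Quotient.sound h)
      have : gluePair s a b x y := Quotient.exact hpq
      refine Subtype.ext (Quotient.sound ?_)
      rcases this with h' | ⟨_, h2⟩ | ⟨h1, _⟩
      · exact h'
      · exact absurd (s.symm h2) hy
      · exact absurd h1 hx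
    · intro q
      induction q using Quotient.inductionOn with | _ x
      by_cases hx : s x b
      · refine ⟨⟨⟦a⟧, fun h' => h (Quotient.exact h')⟩, Quotient.sound ?_⟩
        exact Or.inr (Or.inl ⟨s.refl a, s.symm hx⟩)
      · exact ⟨⟨⟦x⟧, fun h' => hx (Quotient.exact h')⟩, rfl⟩
  rw [← Nat.card_congr (Equiv.ofBijective f hf), Nat.card_eq_fintype_card,
    Nat.card_eq_fintype_card, Fintype.card_subtype_compl, Fintype.card_subtype_eq]
  have : 0 < Fintype.card (Quotient s) := Fintype.card_pos_iff.mpr ⟨⟦b⟧⟩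
  omega

/-- The number of cycles of a permutation, fixed points included. -/
noncomputable def cyc {α : Type*} (ρ : Perm α) : ℕ := Nat.card (Quotient (SameCycle.setoid ρ))

theorem sameCycle_le {α : Type*} {ρ : Perm α} {s : Setoid α} (h : ∀ x, s x (ρ x)) {x y : α}
    (hxy : SameCycle ρ x y) : s x y := by
  obtain ⟨k, rfl⟩ := hxy
  induction k using Int.induction_on with
  | zero => exact s.refl x
  | succ k ih =>
    rw [add_comm, zpow_add, zpow_one, Perm.mul_apply]
    exact s.trans ih (h _)
  | pred k ih =>
    refine s.trans ih (s.symm ?_)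
    have := h ((ρ ^ (-(k : ℤ) - 1)) x)
    rwa [← Perm.mul_apply, ← zpow_one_add, add_sub_cancel] at this

theorem sameCycle_apply {α : Type*} (ρ : Perm α) (x : α) : SameCycle ρ x (ρ x) :=
  sameCycle_apply_right.mpr (SameCycle.refl ρ x)

/-- On a finite type a cycle is exhausted by nonnegative powers, so forward stability suffices. -/
theorem mem_of_sameCycle {α : Type*} [Finite α] {ρ : Perm α} {A : Set α}
    (h : ∀ x ∈ A, ρ x ∈ A) {x y : α} (hxy : SameCycle ρ x y) (hx : x ∈ A) : y ∈ A := by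
  obtain ⟨k, rfl⟩ := hxy.exists_nat_pow_eq
  clear hxy
  induction k with
  | zero => exact hx
  | succ k ih => rw [pow_succ', Perm.mul_apply]; exact h _ ih

/-- A transposition of points of two different cycles concatenates these cycles. -/
theorem setoid_mul_swap_of_not_sameCycle {α : Type*} [Finite α] [DecidableEq α] {ρ : Perm α}
    {a b : α} (h : ¬ SameCycle ρ a b) :
    SameCycle.setoid (ρ * swap a b) = gluePair (SameCycle.setoid ρ) a b := by
  have hab : a ≠ b := fun e => h (e ▸ SameCycle.refl ρ a)
  have key : ∀ a b : α, ¬ SameCycle ρ a b → SameCycle (ρ * swap a b) a b := by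
    intro a b h
    have : ∀ k : ℕ, SameCycle (ρ * swap a b) a ((ρ ^ (k + 1)) b) := by
      intro k
      induction k with
      | zero =>
        have := sameCycle_apply (ρ * swap a b) a
        rwa [Perm.mul_apply, swap_apply_left] at this
      | succ k ih =>
        rw [pow_succ', Perm.mul_apply]
        have ha : (ρ ^ (k + 1)) b ≠ a := fun e =>
          h (e ▸ (sameCycle_pow_left.mpr (SameCycle.refl ρ b)))
        by_cases hb : (ρ ^ (k + 1)) b = b
        · rw [hb]
          have := sameCycle_apply (ρ * swap a b) a
          rwa [Perm.mul_apply, swap_apply_left] at this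
        · have := sameCycle_apply (ρ * swap a b) ((ρ ^ (k + 1)) b)
          rw [Perm.mul_apply, swap_apply_of_ne_of_ne ha hb] at this
          exact ih.trans this
    -- The orbit of `a` runs through `ρ b, ρ² b, …`, and the exponent `orderOf ρ` returns to `b`.
    have h1 := this (orderOf ρ - 1)
    rwa [Nat.sub_add_cancel (orderOf_pos ρ), pow_orderOf_eq_one] at h1
  have h1 : SameCycle (ρ * swap a b) a b := key a b h
  ext x y
  constructor
  · refine fun hxy => sameCycle_le (s := gluePair (SameCycle.setoid ρ) a b) (fun x => ?_) hxy
    rw [Perm.mul_apply]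
    by_cases hxa : x = a
    · subst hxa
      rw [swap_apply_left]
      exact Or.inr (Or.inl ⟨SameCycle.refl _ _, sameCycle_apply ρ b⟩)
    · by_cases hxb : x = b
      · subst hxb
        rw [swap_apply_right]
        exact Or.inr (Or.inr ⟨SameCycle.refl _ _, sameCycle_apply ρ a⟩)
      · rw [swap_apply_of_ne_of_ne hxa hxb]
        exact Or.inl (sameCycle_apply ρ x)
  · have h2 : ∀ {x y}, SameCycle ρ x y → SameCycle (ρ * swap a b) x y := by
      intro x y hxy
      refine sameCycle_le (s := SameCycle.setoid (ρ * swap a b)) (fun x => ?_) hxy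
      change SameCycle (ρ * swap a b) x (ρ x)
      by_cases hxa : x = a
      · subst hxa
        have := sameCycle_apply (ρ * swap x b) b
        rw [Perm.mul_apply, swap_apply_right] at this
        exact h1.trans this
      · by_cases hxb : x = b
        · subst hxb
          have := sameCycle_apply (ρ * swap a x) a
          rw [Perm.mul_apply, swap_apply_left] at this
          exact h1.symm.trans this
        · have := sameCycle_apply (ρ * swap a b) x
          rwa [Perm.mul_apply, swap_apply_of_ne_of_ne hxa hxb] at this
    rintro (h' | ⟨h', h''⟩ | ⟨h', h''⟩)
    · exact h2 h'
    · exact ((h2 h').trans h1).trans (h2 h'')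
    · exact ((h2 h').trans h1.symm).trans (h2 h'')

/-- A transposition of two points of one cycle cuts it into two arcs. -/
theorem not_sameCycle_mul_swap {α : Type*} [Finite α] [DecidableEq α] {ρ : Perm α}
    {a b : α} (hab : a ≠ b) (h : SameCycle ρ a b) : ¬ SameCycle (ρ * swap a b) a b := by
  have hex : ∃ k : ℕ, 0 < k ∧ (ρ ^ k) a = b := by
    obtain ⟨k, hk⟩ := h.exists_nat_pow_eq
    refine ⟨k, Nat.pos_of_ne_zero fun h0 => hab ?_, hk⟩
    rw [← hk, h0, pow_zero, Perm.one_apply]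
  classical
  obtain ⟨hk0, hk⟩ := Nat.find_spec hex
  have hmin := fun m => Nat.find_min hex (m := m)
  set k := Nat.find hex
  -- The arc from `ρ a` to the first visit of `b`. After the transposition `b` is sent to `ρ a`, so
  -- the arc closes up without meeting `a`.
  let A : Set α := {y | ∃ i, 0 < i ∧ i ≤ k ∧ (ρ ^ i) a = y}
  have haA : a ∉ A := by
    rintro ⟨i, hi0, hik, hi⟩
    rcases hik.lt_or_eq with hlt | rfl
    · refine hmin (k - i) (by omega) ⟨by omega, ?_⟩
      have h3 : (ρ ^ (k - i)) ((ρ ^ i) a) = b := by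
        rw [← Perm.mul_apply, ← pow_add, Nat.sub_add_cancel hik, hk]
      rwa [hi] at h3
    · exact hab (hi.symm.trans hk)
  have hclosed : ∀ y ∈ A, (ρ * swap a b) y ∈ A := by
    rintro y hy
    have hya : y ≠ a := fun e => haA (e ▸ hy)
    obtain ⟨i, hi0, hik, rfl⟩ := hy
    rw [Perm.mul_apply]
    by_cases hyb : (ρ ^ i) a = b
    · rw [hyb, swap_apply_right]
      exact ⟨1, one_pos, hk0, by rw [pow_one]⟩
    · rw [swap_apply_of_ne_of_ne hya hyb]
      refine ⟨i + 1, by omega, ?_, by rw [pow_succ', Perm.mul_apply]⟩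
      rcases hik.lt_or_eq with hlt | rfl
      · exact hlt
      · exact absurd hk hyb
  exact fun hs => haA (mem_of_sameCycle hclosed hs.symm ⟨k, hk0, le_rfl, hk⟩)

theorem cyc_mul_swap_of_not_sameCycle {α : Type*} [Finite α] [DecidableEq α] {ρ : Perm α}
    {a b : α} (h : ¬ SameCycle ρ a b) : cyc ρ = cyc (ρ * swap a b) + 1 := by
  rw [cyc, cyc, setoid_mul_swap_of_not_sameCycle h]
  exact card_quotient_gluePair h

theorem cyc_mul_swap_of_sameCycle {α : Type*} [Finite α] [DecidableEq α] {ρ : Perm α}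
    {a b : α} (hab : a ≠ b) (h : SameCycle ρ a b) : cyc (ρ * swap a b) = cyc ρ + 1 := by
  have := cyc_mul_swap_of_not_sameCycle (not_sameCycle_mul_swap hab h)
  rwa [mul_assoc, swap_mul_self, mul_one] at this

theorem sameCycle_permCongr {α β : Type*} (e : α ≃ β) (ρ : Perm α) (x y : β) :
    SameCycle (e.permCongr ρ) x y ↔ SameCycle ρ (e.symm x) (e.symm y) := by
  have : ∀ k : ℤ, (e.permCongr ρ) ^ k = e.permCongr (ρ ^ k) := fun k =>
    (map_zpow e.permCongrHom ρ k).symm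
  simp only [SameCycle, this, Equiv.permCongr_apply, Equiv.eq_symm_apply]

theorem cyc_permCongr {α β : Type*} (e : α ≃ β) (ρ : Perm α) : cyc (e.permCongr ρ) = cyc ρ := by
  refine (Nat.card_congr (Quotient.congr e fun x y => ?_)).symm
  change SameCycle ρ x y ↔ SameCycle (e.permCongr ρ) (e x) (e y)
  rw [sameCycle_permCongr, e.symm_apply_apply, e.symm_apply_apply]

theorem sameCycle_optionCongr_some {α : Type*} (ρ : Perm α) (x y : α) :
    SameCycle (optionCongr ρ) (some x) (some y) ↔ SameCycle ρ x y := by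
  have : ∀ k : ℤ, (optionCongr ρ) ^ k = optionCongr (ρ ^ k) := by
    let f : Perm α →* Perm (Option α) := ⟨⟨optionCongr, by ext x; cases x <;> simp⟩,
      fun a b => by ext x; cases x <;> simp⟩
    exact fun k => (map_zpow f ρ k).symm
  simp [SameCycle, this]

theorem not_sameCycle_optionCongr_none {α : Type*} (ρ : Perm α) (x : α) :
    ¬ SameCycle (optionCongr ρ) none (some x) := fun h => by
  have := h.eq_of_left (by simp [Function.IsFixedPt])
  simp at this

theorem cyc_optionCongr {α : Type*} [Finite α] (ρ : Perm α) : cyc (optionCongr ρ) = cyc ρ + 1 := by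
  classical
  have e : Quotient (SameCycle.setoid (optionCongr ρ)) ≃
      Option (Quotient (SameCycle.setoid ρ)) := by
    refine Equiv.ofBijective (Quotient.lift (fun x : Option α =>
      x.map (fun a => (⟦a⟧ : Quotient (SameCycle.setoid ρ)))) ?_) ⟨?_, ?_⟩
    · rintro (_ | x) (_ | y) h
      · rfl
      · exact absurd h (not_sameCycle_optionCongr_none ρ y)
      · exact absurd (SameCycle.symm h) (not_sameCycle_optionCongr_none ρ x)
      · exact congrArg some (Quotient.sound ((sameCycle_optionCongr_some ρ x y).mp h))
    · intro p q
      induction p using Quotient.inductionOn with | _ x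
      induction q using Quotient.inductionOn with | _ y
      rcases x with _ | x <;> rcases y with _ | y <;> intro h
      · rfl
      · simp at h
      · simp at h
      · exact Quotient.sound ((sameCycle_optionCongr_some ρ x y).mpr
          (Quotient.exact (Option.some_injective _ h)))
    · rintro (_ | q)
      · exact ⟨⟦none⟧, rfl⟩
      · induction q using Quotient.inductionOn with | _ x
        exact ⟨⟦some x⟧, rfl⟩
  rw [cyc, Nat.card_congr e, Finite.card_option, cyc]

/-- The permutation obtained by inserting a new point just before `x` in its cycle. -/
def insertBefore {α : Type*} [DecidableEq α] (ρ : Perm α) (x : α) : Perm (Option α) :=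
  swap none (some x) * optionCongr ρ

theorem insertBefore_eq {α : Type*} [DecidableEq α] (ρ : Perm α) (x : α) :
    insertBefore ρ x = optionCongr ρ * swap none (some (ρ.symm x)) := by
  rw [insertBefore, Equiv.mul_swap_eq_swap_mul]
  simp

/-- The new fixed point adds a cycle, which the transposition then merges with the cycle of `x`. -/
theorem cyc_insertBefore {α : Type*} [Finite α] [DecidableEq α] (ρ : Perm α) (x : α) :
    cyc (insertBefore ρ x) = cyc ρ := by
  have := cyc_mul_swap_of_not_sameCycle (not_sameCycle_optionCongr_none ρ (ρ.symm x))
  rw [← insertBefore_eq, cyc_optionCongr] at this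
  omega

/-- The inserted point shares the cycle of `x`, so `x` can stand in for it. -/
theorem sameCycle_insertBefore {α : Type*} [Finite α] [DecidableEq α] (ρ : Perm α) (x : α)
    (y z : Option α) :
    SameCycle (insertBefore ρ x) y z ↔ SameCycle ρ (y.getD x) (z.getD x) := by
  have hs := setoid_mul_swap_of_not_sameCycle (not_sameCycle_optionCongr_none ρ (ρ.symm x))
  rw [← insertBefore_eq] at hs
  have h1 : ∀ y z, SameCycle (insertBefore ρ x) y z ↔
    gluePair (SameCycle.setoid (optionCongr ρ)) none (some (ρ.symm x)) y z := by
    intro y z; rw [← hs]; rfl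
  rw [h1, gluePair_iff]
  change SameCycle _ _ _ ∨ (SameCycle _ _ _ ∧ SameCycle _ _ _) ∨
    (SameCycle _ _ _ ∧ SameCycle _ _ _) ↔ _
  have h2 := not_sameCycle_optionCongr_none ρ
  have h3 : ∀ x, ¬ SameCycle (optionCongr ρ) (some x) none := fun x h => h2 x h.symm
  rcases y with _ | y <;> rcases z with _ | z <;>
    simp [h2, h3, sameCycle_optionCongr_some, SameCycle.refl]

theorem sameCycle_sumCongr_inl {α β : Type*} (ρ : Perm α) (μ : Perm β) (x y : α) :
    SameCycle (Perm.sumCongr ρ μ) (Sum.inl x) (Sum.inl y) ↔ SameCycle ρ x y := by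
  have : ∀ k : ℤ, (Perm.sumCongr ρ μ) ^ k = Perm.sumCongr (ρ ^ k) (μ ^ k) := fun k =>
    (map_zpow (Perm.sumCongrHom α β) (ρ, μ) k).symm
  simp [SameCycle, this]

theorem sameCycle_sumCongr_inr {α β : Type*} (ρ : Perm α) (μ : Perm β) (x y : β) :
    SameCycle (Perm.sumCongr ρ μ) (Sum.inr x) (Sum.inr y) ↔ SameCycle μ x y := by
  have : ∀ k : ℤ, (Perm.sumCongr ρ μ) ^ k = Perm.sumCongr (ρ ^ k) (μ ^ k) := fun k =>
    (map_zpow (Perm.sumCongrHom α β) (ρ, μ) k).symm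
  simp [SameCycle, this]

theorem not_sameCycle_sumCongr {α β : Type*} (ρ : Perm α) (μ : Perm β) (x : α) (y : β) :
    ¬ SameCycle (Perm.sumCongr ρ μ) (Sum.inl x) (Sum.inr y) := by
  have : ∀ k : ℤ, (Perm.sumCongr ρ μ) ^ k = Perm.sumCongr (ρ ^ k) (μ ^ k) := fun k =>
    (map_zpow (Perm.sumCongrHom α β) (ρ, μ) k).symm
  simp [SameCycle, this]

theorem cyc_sumCongr {α β : Type*} [Finite α] [Finite β] (ρ : Perm α) (μ : Perm β) :
    cyc (Perm.sumCongr ρ μ) = cyc ρ + cyc μ := by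
  have e : Quotient (SameCycle.setoid ρ) ⊕ Quotient (SameCycle.setoid μ) ≃
      Quotient (SameCycle.setoid (Perm.sumCongr ρ μ)) := by
    refine Equiv.ofBijective (Sum.elim
      (Quotient.map' Sum.inl fun x y h => (sameCycle_sumCongr_inl ρ μ x y).mpr h)
      (Quotient.map' Sum.inr fun x y h => (sameCycle_sumCongr_inr ρ μ x y).mpr h)) ⟨?_, ?_⟩
    · rintro (p | p) (q | q) <;> induction p using Quotient.inductionOn with | _ x <;>
        induction q using Quotient.inductionOn with | _ y <;> intro h
      · exact congrArg Sum.inl (Quotient.sound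
          ((sameCycle_sumCongr_inl ρ μ x y).mp (Quotient.exact h)))
      · exact absurd (Quotient.exact h) (not_sameCycle_sumCongr ρ μ x y)
      · exact absurd (SameCycle.symm (Quotient.exact h)) (not_sameCycle_sumCongr ρ μ y x)
      · exact congrArg Sum.inr (Quotient.sound
          ((sameCycle_sumCongr_inr ρ μ x y).mp (Quotient.exact h)))
    · intro q
      induction q using Quotient.inductionOn with | _ x
      rcases x with x | x
      · exact ⟨Sum.inl ⟦x⟧, rfl⟩
      · exact ⟨Sum.inr ⟦x⟧, rfl⟩
  rw [cyc, ← Nat.card_congr e, Nat.card_sum, cyc, cyc]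

theorem cyc_of_isEmpty {α : Type*} [IsEmpty α] (ρ : Perm α) : cyc ρ = 0 := by
  rw [cyc, Nat.card_eq_zero]
  exact Or.inl ⟨fun q => Quotient.inductionOn q fun x => isEmptyElim x⟩

end QuarticTensor

namespace QuarticTensor

open Equiv Equiv.Perm

/-! ### Edge-coloured combinatorial maps with marked corners -/

/-- The darts of a combinatorial map: one for each marked corner and two for each edge. -/
abbrev Darts (M E : Type) : Type := M ⊕ E × Bool

section Maps

variable {κ M M' E E' : Type}

/-- The involution which exchanges the two darts of each edge of colour `k`. -/
def flip [DecidableEq κ] (c : E → κ) (k : κ) : Perm (Darts M E) :=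
  Equiv.sumCongr (Equiv.refl M)
    (Equiv.prodShear (Equiv.refl E) fun e => if c e = k then Equiv.boolNot else Equiv.refl Bool)

@[simp] theorem flip_inl [DecidableEq κ] (c : E → κ) (k : κ) (m : M) :
    flip c k (Sum.inl m) = Sum.inl m := rfl

@[simp] theorem flip_inr [DecidableEq κ] (c : E → κ) (k : κ) (e : E) (b : Bool) :
    (flip c k (Sum.inr (e, b)) : Darts M E) = Sum.inr (e, if c e = k then !b else b) := by
  by_cases h : c e = k <;> simp [flip, h]

theorem flip_mul_self [DecidableEq κ] (c : E → κ) (k : κ) (x : Darts M E) :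
    flip c k (flip c k x) = x := by
  rcases x with m | ⟨e, b⟩
  · rfl
  · by_cases h : c e = k <;> simp [h]

/-- Two marked corners are related if they lie on the same face of colour `k`. -/
def faceRel [DecidableEq κ] (c : E → κ) (σ : Perm (Darts M E)) (k : κ) (a b : M) : Prop :=
  SameCycle (σ * flip c k) (Sum.inl a) (Sum.inl b)

/-- Half the exponent of `N` by which the weight of a map exceeds the weight of a map with the
same numbers of vertices and edges in which no edge splits a face. -/
noncomputable def excess [Fintype κ] [DecidableEq κ] [Fintype E] (c : E → κ)
    (σ : Perm (Darts M E)) : ℕ :=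
  (Fintype.card E + ∑ k, cyc (σ * flip c k) - Fintype.card κ * cyc σ) / 2

/-- Relabelling of marked corners and edges. -/
def dartsCongr (e : M ≃ M') (f : E ≃ E') : Darts M E ≃ Darts M' E' :=
  Equiv.sumCongr e (Equiv.prodCongr f (Equiv.refl Bool))

theorem permCongr_flip [DecidableEq κ] (e : M ≃ M') (f : E ≃ E') (c : E → κ) (k : κ) :
    (dartsCongr e f).permCongr (flip c k) = flip (c ∘ f.symm) k := by
  ext x
  rcases x with m | ⟨i, b⟩ <;> simp [dartsCongr, Equiv.permCongr_apply]

theorem permCongr_mul_perm {α β : Type*} (e : α ≃ β) (p q : Perm α) :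
    e.permCongr (p * q) = e.permCongr p * e.permCongr q :=
  map_mul e.permCongrHom p q

theorem permCongr_mul_flip [DecidableEq κ] (e : M ≃ M') (f : E ≃ E') (c : E → κ)
    (σ : Perm (Darts M E)) (k : κ) :
    (dartsCongr e f).permCongr σ * flip (c ∘ f.symm) k =
      (dartsCongr e f).permCongr (σ * flip c k) := by
  rw [permCongr_mul_perm, permCongr_flip]

theorem faceRel_relabel [DecidableEq κ] (e : M ≃ M') (f : E ≃ E') (c : E → κ)
    (σ : Perm (Darts M E)) (k : κ) (a b : M') :
    faceRel (c ∘ f.symm) ((dartsCongr e f).permCongr σ) k a b ↔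
      faceRel c σ k (e.symm a) (e.symm b) := by
  rw [faceRel, permCongr_mul_flip, sameCycle_permCongr]
  rfl

theorem excess_relabel [Fintype κ] [DecidableEq κ] [Fintype E] [Fintype E'] (e : M ≃ M')
    (f : E ≃ E') (c : E → κ) (σ : Perm (Darts M E)) :
    excess (c ∘ f.symm) ((dartsCongr e f).permCongr σ) = excess c σ := by
  simp only [excess, permCongr_mul_flip, cyc_permCongr, Fintype.card_congr f]

/-- Cutting the distinguished edge open turns its two darts into marked corners. -/
def openEdge (M E : Type) : Darts M (Option E) ≃ Darts (M ⊕ Bool) E where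
  toFun
    | Sum.inl m => Sum.inl (Sum.inl m)
    | Sum.inr (none, b) => Sum.inl (Sum.inr b)
    | Sum.inr (some e, b) => Sum.inr (e, b)
  invFun
    | Sum.inl (Sum.inl m) => Sum.inl m
    | Sum.inl (Sum.inr b) => Sum.inr (none, b)
    | Sum.inr (e, b) => Sum.inr (some e, b)
  left_inv := by rintro (m | ⟨_ | e, b⟩) <;> rfl
  right_inv := by rintro ((m | b) | ⟨e, b⟩) <;> rfl

theorem openEdge_flip_of_ne [DecidableEq κ] (c : Option E → κ) {k : κ} (h : c none ≠ k) :
    (openEdge M E).permCongr (flip c k) = flip (c ∘ some) k := by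
  ext x
  rcases x with (m | b) | ⟨i, b⟩ <;> simp [openEdge, Equiv.permCongr_apply, h]

theorem openEdge_flip_self [DecidableEq κ] [DecidableEq M] [DecidableEq E] (c : Option E → κ) :
    (openEdge M E).permCongr (flip c (c none)) = flip (c ∘ some) (c none) *
      swap (Sum.inl (Sum.inr false)) (Sum.inl (Sum.inr true)) := by
  ext x
  rcases x with (m | _ | _) | ⟨i, b⟩ <;>
    simp [openEdge, Equiv.permCongr_apply, swap_apply_of_ne_of_ne]

-- Only the colour of the cut edge sees a difference. There, closing the edge is a multiplication by
-- a transposition, which changes the number of faces by `1` or `-1`; the `+ 1` on the left turns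
-- this into `2` or `0`.
open scoped Classical in
theorem sum_cyc_openEdge [Fintype κ] [DecidableEq κ] [Finite M] [Finite E]
    (c : Option E → κ) (σ : Perm (Darts M (Option E))) :
    ∑ k, cyc (σ * flip c k) + 1 =
      ∑ k, cyc ((openEdge M E).permCongr σ * flip (c ∘ some) k) +
        if faceRel (c ∘ some) ((openEdge M E).permCongr σ) (c none) (Sum.inr false) (Sum.inr true)
          then 2 else 0 := by
  have h1 : ∀ k, k ≠ c none → cyc (σ * flip c k) =
      cyc ((openEdge M E).permCongr σ * flip (c ∘ some) k) := fun k hk => by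
    rw [← openEdge_flip_of_ne c (Ne.symm hk), ← permCongr_mul_perm, cyc_permCongr]
  have h2 : cyc (σ * flip c (c none)) =
      cyc ((openEdge M E).permCongr σ * flip (c ∘ some) (c none) *
        swap (Sum.inl (Sum.inr false)) (Sum.inl (Sum.inr true))) := by
    rw [mul_assoc, ← openEdge_flip_self c, ← permCongr_mul_perm, cyc_permCongr]
  rw [← Finset.add_sum_erase _ _ (Finset.mem_univ (c none)),
    ← Finset.add_sum_erase Finset.univ (fun k => cyc ((openEdge M E).permCongr σ *
      flip (c ∘ some) k)) (Finset.mem_univ (c none)),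
    Finset.sum_congr rfl fun k hk => h1 k (Finset.ne_of_mem_erase hk), h2]
  split_ifs with h
  · rw [cyc_mul_swap_of_sameCycle (by simp) h]
    ring
  · rw [cyc_mul_swap_of_not_sameCycle h]
    ring

/-! ### Connectedness and the bound on the excess -/

/-- Subsets of the darts which are unions of connected components. -/
structure IsStable (σ : Perm (Darts M E)) (A : Set (Darts M E)) : Prop where
  map_perm : ∀ x ∈ A, σ x ∈ A
  map_flip : ∀ e b, Sum.inr (e, b) ∈ A → Sum.inr (e, !b) ∈ A

/-- A map is connected if its only unions of connected components are the trivial ones. -/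
def IsConnected (σ : Perm (Darts M E)) : Prop :=
  ∀ A : Set (Darts M E), IsStable σ A → A.Nonempty → A = Set.univ

theorem IsStable.symm_mem [Finite M] [Finite E] {σ : Perm (Darts M E)} {A : Set (Darts M E)}
    (h : IsStable σ A) {x : Darts M E} (hx : σ x ∈ A) : x ∈ A :=
  mem_of_sameCycle h.map_perm (sameCycle_apply σ x).symm hx

theorem IsStable.compl [Finite M] [Finite E] {σ : Perm (Darts M E)} {A : Set (Darts M E)}
    (h : IsStable σ A) : IsStable σ Aᶜ where
  map_perm x hx hx' := hx (h.symm_mem hx')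
  map_flip e b hx hx' := hx (by simpa using h.map_flip e (!b) hx')

theorem isConnected_relabel (e : M ≃ M') (f : E ≃ E') (σ : Perm (Darts M E)) :
    IsConnected ((dartsCongr e f).permCongr σ) ↔ IsConnected σ := by
  have key : ∀ A : Set (Darts M' E'), IsStable ((dartsCongr e f).permCongr σ) A ↔
      IsStable σ (dartsCongr e f ⁻¹' A) := by
    intro A
    constructor
    · intro h
      refine ⟨fun x hx => ?_, fun i b hx => ?_⟩
      · have := h.map_perm _ hx
        rwa [Equiv.permCongr_apply, Equiv.symm_apply_apply] at this
      · exact h.map_flip (f i) b hx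
    · intro h
      refine ⟨fun x hx => ?_, fun i b hx => ?_⟩
      · rw [Equiv.permCongr_apply]
        exact h.map_perm _ (by simpa using hx)
      · have := h.map_flip (f.symm i) b (by simpa [dartsCongr] using hx)
        simpa [dartsCongr] using this
  constructor
  · intro h A hA hne
    have hA' : dartsCongr e f ⁻¹' (dartsCongr e f '' A) = A :=
      Set.preimage_image_eq A (dartsCongr e f).injective
    have := h (dartsCongr e f '' A) ((key _).mpr (by rwa [hA'])) (hne.image _)
    rw [← hA', this, Set.preimage_univ]
  · intro h A hA hne
    have := h _ ((key A).mp hA) (hne.preimage (dartsCongr e f).surjective)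
    rw [← Set.image_preimage_eq A (dartsCongr e f).surjective, this, Set.image_univ,
      (dartsCongr e f).surjective.range_eq]

/-- Induction on the edges, cutting one open at a time. The setoid `s` keeps track of components: an
edge which splits a face joins darts that are already related, and any other edge merges at most two
classes, so the bound on `j + cyc σ` survives in both cases. -/
theorem exists_excess [Fintype κ] [DecidableEq κ] [Fintype E] [Finite M] (c : E → κ)
    (σ : Perm (Darts M E)) :
    ∃ j : ℕ, Fintype.card E + ∑ k, cyc (σ * flip c k) = Fintype.card κ * cyc σ + 2 * j ∧
      ∃ s : Setoid (Darts M E), (∀ x, s x (σ x)) ∧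
        (∀ e b, s (Sum.inr (e, b)) (Sum.inr (e, !b))) ∧
        j + cyc σ ≤ Fintype.card E + Nat.card (Quotient s) := by
  classical
  let P : ∀ (E : Type) [Fintype E], Prop := fun E _ => ∀ (M : Type) [Finite M] (c : E → κ)
    (σ : Perm (Darts M E)),
    ∃ j : ℕ, Fintype.card E + ∑ k, cyc (σ * flip c k) = Fintype.card κ * cyc σ + 2 * j ∧
      ∃ s : Setoid (Darts M E), (∀ x, s x (σ x)) ∧
        (∀ e b, s (Sum.inr (e, b)) (Sum.inr (e, !b))) ∧
        j + cyc σ ≤ Fintype.card E + Nat.card (Quotient s)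
  suffices h : P E from h M c σ
  apply Fintype.induction_empty_option (P := P)
  · intro α β _ f ih M _ c σ
    let _ : Fintype α := Fintype.ofEquiv β f.symm
    let d : Darts M α ≃ Darts M β := dartsCongr (Equiv.refl M) f
    obtain ⟨j, h1, s, h2, h3, h4⟩ := ih M (c ∘ f) (d.symm.permCongr σ)
    have hσ : d.permCongr (d.symm.permCongr σ) = σ := by ext x; simp [Equiv.permCongr_apply]
    have hcy : cyc (d.symm.permCongr σ) = cyc σ := cyc_permCongr _ _
    have hcard : Fintype.card α = Fintype.card β := Fintype.card_congr f
    refine ⟨j, ?_, Setoid.comap d.symm s, fun x => ?_, fun e b => ?_, ?_⟩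
    · rw [hcy, hcard] at h1
      rw [← h1]
      refine congrArg _ (Finset.sum_congr rfl fun k _ => ?_)
      have := permCongr_mul_flip (Equiv.refl M) f (c ∘ f) (d.symm.permCongr σ) k
      change d.permCongr _ * _ = d.permCongr _ at this
      rw [hσ, Function.comp_assoc, f.self_comp_symm, Function.comp_id] at this
      rw [this, cyc_permCongr]
    · have := h2 (d.symm x)
      rwa [Equiv.permCongr_apply, Equiv.symm_symm, Equiv.apply_symm_apply] at this
    · exact h3 (f.symm e) b
    · have hq : Nat.card (Quotient (Setoid.comap d.symm s)) = Nat.card (Quotient s) :=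
        Nat.card_congr (Quotient.congr d.symm fun x y => Iff.rfl)
      rwa [hcy, hcard, ← hq] at h4
  · intro M _ c σ
    refine ⟨0, ?_, SameCycle.setoid σ, fun x => sameCycle_apply σ x, fun e => e.elim, ?_⟩
    · have : ∀ k, flip (M := M) c k = 1 := fun k => by
        ext x
        rcases x with m | ⟨e, b⟩
        · rfl
        · exact e.elim
      simp [this]
    · simp [cyc]
  · intro E _ ih M _ c σ
    obtain ⟨j, h1, s, h2, h3, h4⟩ := ih (M ⊕ Bool) (c ∘ some) ((openEdge M E).permCongr σ)
    have hsum := sum_cyc_openEdge c σ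
    rw [cyc_permCongr] at h1 h4
    let h : Darts (M ⊕ Bool) E := Sum.inl (Sum.inr false)
    let h' : Darts (M ⊕ Bool) E := Sum.inl (Sum.inr true)
    have hq : Nat.card (Quotient (Setoid.comap (openEdge M E) (gluePair s h h'))) =
        Nat.card (Quotient (gluePair s h h')) :=
      Nat.card_congr (Quotient.congr (openEdge M E) fun x y => Iff.rfl)
    -- A face is a walk along vertices and edges, so it stays in one class of `s`.
    have hface : faceRel (c ∘ some) ((openEdge M E).permCongr σ) (c none)
        (Sum.inr false) (Sum.inr true) → s h h' := by
      refine fun hr => sameCycle_le (fun x => ?_) hr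
      refine s.trans ?_ (h2 _)
      rcases x with m | ⟨e, b⟩
      · exact s.refl _
      · by_cases hk : (c ∘ some) e = c none
        · rw [flip_inr, if_pos hk]; exact h3 e b
        · rw [flip_inr, if_neg hk]
    refine ⟨j + if faceRel (c ∘ some) ((openEdge M E).permCongr σ) (c none)
        (Sum.inr false) (Sum.inr true) then 1 else 0, ?_,
      Setoid.comap (openEdge M E) (gluePair s h h'), fun x => ?_, fun e b => ?_, ?_⟩
    · rw [Fintype.card_option]
      split_ifs at hsum ⊢ <;> omega
    · have := h2 (openEdge M E x)
      rw [Equiv.permCongr_apply, Equiv.symm_apply_apply] at this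
      exact Or.inl this
    · rcases e with _ | e
      · rcases b with _ | _
        · exact Or.inr (Or.inl ⟨s.refl _, s.refl _⟩)
        · exact Or.inr (Or.inr ⟨s.refl _, s.refl _⟩)
      · exact Or.inl (h3 e b)
    · rw [hq, Fintype.card_option]
      by_cases hs : s h h'
      · rw [gluePair_eq_self hs]
        split_ifs <;> omega
      · rw [if_neg (mt hface hs)]
        have := card_quotient_gluePair hs
        omega

/-- The difference halved in `excess` is nonnegative and even, so neither the truncated subtraction
nor the division loses anything. -/
theorem excess_spec [Fintype κ] [DecidableEq κ] [Fintype E] [Finite M] (c : E → κ)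
    (σ : Perm (Darts M E)) :
    Fintype.card E + ∑ k, cyc (σ * flip c k) = Fintype.card κ * cyc σ + 2 * excess c σ := by
  obtain ⟨j, h, -⟩ := exists_excess c σ
  rw [excess]
  omega

/-- On a connected map, a relation which contains the vertices and the edges has at most one class.
-/
theorem excess_add_cyc_le [Fintype κ] [DecidableEq κ] [Fintype E] [Finite M] (c : E → κ)
    {σ : Perm (Darts M E)} (hσ : IsConnected σ) : excess c σ + cyc σ ≤ Fintype.card E + 1 := by
  obtain ⟨j, h, s, h2, h3, h4⟩ := exists_excess c σ
  have hj : excess c σ = j := by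
    have := excess_spec c σ
    omega
  have hs : Nat.card (Quotient s) ≤ 1 := by
    rw [Finite.card_le_one_iff_subsingleton]
    refine ⟨fun p q => ?_⟩
    induction p using Quotient.inductionOn with | _ x
    induction q using Quotient.inductionOn with | _ y
    refine Quotient.sound ?_
    have : {z | s x z} = Set.univ := hσ _
      ⟨fun z hz => s.trans hz (h2 z), fun e b hz => s.trans hz (h3 e b)⟩ ⟨x, s.refl x⟩
    exact Set.mem_ofPred.mp (this ▸ Set.mem_univ y)
  omega

open scoped Classical in
theorem excess_openEdge [Fintype κ] [DecidableEq κ] [Fintype E] [Finite M]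
    (c : Option E → κ) (σ : Perm (Darts M (Option E))) :
    excess c σ = excess (c ∘ some) ((openEdge M E).permCongr σ) +
      if faceRel (c ∘ some) ((openEdge M E).permCongr σ) (c none) (Sum.inr false) (Sum.inr true)
        then 1 else 0 := by
  have h1 := excess_spec c σ
  have h2 := excess_spec (c ∘ some) ((openEdge M E).permCongr σ)
  have h3 := sum_cyc_openEdge c σ
  rw [cyc_permCongr] at h2
  rw [Fintype.card_option] at h1
  split_ifs at h3 ⊢ <;> omega

end Maps

end QuarticTensor

namespace QuarticTensor

open Equiv Equiv.Perm

/-! ### Decomposition of a map along the connected component of a marked corner -/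

section LinkedCluster

variable {κ M M' E E' : Type}

/-- The darts of a disjoint union. -/
def combine (p : M → Prop) (q : E → Prop) [DecidablePred p] [DecidablePred q] :
    Darts {m // p m} {e // q e} ⊕ Darts {m // ¬ p m} {e // ¬ q e} ≃ Darts M E where
  toFun
    | Sum.inl (Sum.inl m) => Sum.inl m
    | Sum.inl (Sum.inr (e, b)) => Sum.inr (e, b)
    | Sum.inr (Sum.inl m) => Sum.inl m
    | Sum.inr (Sum.inr (e, b)) => Sum.inr (e, b)
  invFun
    | Sum.inl m => if h : p m then Sum.inl (Sum.inl ⟨m, h⟩) else Sum.inr (Sum.inl ⟨m, h⟩)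
    | Sum.inr (e, b) =>
      if h : q e then Sum.inl (Sum.inr (⟨e, h⟩, b)) else Sum.inr (Sum.inr (⟨e, h⟩, b))
  left_inv := by
    rintro ((m | ⟨e, b⟩) | (m | ⟨e, b⟩))
    · simp [m.2]
    · simp [e.2]
    · simp [m.2]
    · simp [e.2]
  right_inv := by
    rintro (m | ⟨e, b⟩)
    · by_cases h : p m <;> simp [h]
    · by_cases h : q e <;> simp [h]

variable (p : M → Prop) (q : E → Prop) [DecidablePred p] [DecidablePred q]

@[simp] theorem combine_inl_inl (m : {m // p m}) :
    combine p q (Sum.inl (Sum.inl m)) = Sum.inl m.1 := rfl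

@[simp] theorem combine_inl_inr (e : {e // q e}) (b : Bool) :
    combine p q (Sum.inl (Sum.inr (e, b))) = Sum.inr (e.1, b) := rfl

@[simp] theorem combine_inr_inl (m : {m // ¬ p m}) :
    combine p q (Sum.inr (Sum.inl m)) = Sum.inl m.1 := rfl

@[simp] theorem combine_inr_inr (e : {e // ¬ q e}) (b : Bool) :
    combine p q (Sum.inr (Sum.inr (e, b))) = Sum.inr (e.1, b) := rfl

/-- The disjoint union of two maps. -/
def disjUnion (σ : Perm (Darts {m // p m} {e // q e}))
    (μ : Perm (Darts {m // ¬ p m} {e // ¬ q e})) :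
    Perm (Darts M E) :=
  (combine p q).permCongr (Perm.sumCongr σ μ)

variable {p q}

theorem disjUnion_inl (σ : Perm (Darts {m // p m} {e // q e}))
    (μ : Perm (Darts {m // ¬ p m} {e // ¬ q e})) (x : Darts {m // p m} {e // q e}) :
    disjUnion p q σ μ (combine p q (Sum.inl x)) = combine p q (Sum.inl (σ x)) := by
  simp [disjUnion, Equiv.permCongr_apply]

theorem disjUnion_mul_flip [DecidableEq κ] (c : E → κ) (k : κ)
    (σ : Perm (Darts {m // p m} {e // q e})) (μ : Perm (Darts {m // ¬ p m} {e // ¬ q e})) :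
    disjUnion p q σ μ * flip c k =
      disjUnion p q (σ * flip (fun e => c e.1) k) (μ * flip (fun e => c e.1) k) := by
  have h : flip c k = disjUnion p q (flip (fun e => c e.1) k) (flip (fun e => c e.1) k) := by
    ext x
    obtain ⟨x, rfl⟩ := (combine p q).surjective x
    rw [disjUnion, Equiv.permCongr_apply, Equiv.symm_apply_apply]
    rcases x with (m | ⟨e, b⟩) | (m | ⟨e, b⟩) <;> simp
  rw [h, disjUnion, disjUnion, disjUnion, ← permCongr_mul_perm, Perm.sumCongr_mul]

theorem cyc_disjUnion [Finite M] [Finite E] (σ : Perm (Darts {m // p m} {e // q e}))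
    (μ : Perm (Darts {m // ¬ p m} {e // ¬ q e})) :
    cyc (disjUnion p q σ μ) = cyc σ + cyc μ := by
  rw [disjUnion, cyc_permCongr, cyc_sumCongr]

/-- The relation between marked corners in a disjoint union. -/
def joinRel (p : M → Prop) (r : κ → {m // p m} → {m // p m} → Prop)
    (s : κ → {m // ¬ p m} → {m // ¬ p m} → Prop) (k : κ) (a b : M) : Prop :=
  (∃ ha hb, r k ⟨a, ha⟩ ⟨b, hb⟩) ∨ ∃ ha hb, s k ⟨a, ha⟩ ⟨b, hb⟩

theorem faceRel_disjUnion [DecidableEq κ] (c : E → κ) (σ : Perm (Darts {m // p m} {e // q e}))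
    (μ : Perm (Darts {m // ¬ p m} {e // ¬ q e})) :
    faceRel c (disjUnion p q σ μ) =
      joinRel p (faceRel (fun e => c e.1) σ) (faceRel (fun e => c e.1) μ) := by
  funext k a b
  rw [faceRel, disjUnion_mul_flip, disjUnion, sameCycle_permCongr]
  refine propext ?_
  by_cases ha : p a <;> by_cases hb : p b <;> simp only [combine, Equiv.coe_fn_symm_mk, ha, hb,
    dif_pos, dif_neg, not_false_eq_true, joinRel, sameCycle_sumCongr_inl, sameCycle_sumCongr_inr,
    faceRel, exists_true_left, not_true_eq_false, IsEmpty.exists_iff, or_false, false_or]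
  · simp [not_sameCycle_sumCongr]
  · simp only [iff_false]
    exact fun h => not_sameCycle_sumCongr _ _ _ _ h.symm

theorem card_subtype_add_card_not [Fintype E] [Fintype {e // q e}] [Fintype {e // ¬ q e}] :
    Fintype.card {e // q e} + Fintype.card {e // ¬ q e} = Fintype.card E := by
  rw [← Fintype.card_sum]
  exact Fintype.card_congr (Equiv.sumCompl q)

theorem excess_disjUnion [Fintype κ] [DecidableEq κ] [Fintype E] [Finite M]
    [Fintype {e // q e}] [Fintype {e // ¬ q e}] (c : E → κ)
    (σ : Perm (Darts {m // p m} {e // q e})) (μ : Perm (Darts {m // ¬ p m} {e // ¬ q e})) :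
    excess c (disjUnion p q σ μ) =
      excess (fun e => c e.1) σ + excess (fun e => c e.1) μ := by
  have h1 := excess_spec c (disjUnion p q σ μ)
  have h2 := excess_spec (fun e : {e // q e} => c e.1) σ
  have h3 := excess_spec (fun e : {e // ¬ q e} => c e.1) μ
  simp only [disjUnion_mul_flip, cyc_disjUnion, Finset.sum_add_distrib, mul_add,
    ← card_subtype_add_card_not (q := q)] at h1
  omega

/-- If a nonempty stable set misses the root, its complement is stable and contains the root. -/
theorem isConnected_of_root [Finite M] [Finite E] {σ : Perm (Darts M E)} {r : Darts M E}
    (h : ∀ A : Set (Darts M E), IsStable σ A → r ∈ A → A = Set.univ) : IsConnected σ := by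
  intro A hA hne
  by_cases hr : r ∈ A
  · exact h A hA hr
  · obtain ⟨x, hx⟩ := hne
    have := h _ hA.compl hr
    exact absurd hx (this ▸ Set.mem_univ x : x ∈ Aᶜ)

/-- The connected component of a marked corner. -/
def component (r : M) (σ : Perm (Darts M E)) : Set (Darts M E) :=
  {x | ∀ A : Set (Darts M E), IsStable σ A → Sum.inl r ∈ A → x ∈ A}

theorem isStable_component (r : M) (σ : Perm (Darts M E)) : IsStable σ (component r σ) where
  map_perm x hx A hA hr := hA.map_perm x (hx A hA hr)
  map_flip e b hx A hA hr := hA.map_flip e b (hx A hA hr)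

theorem mem_component_self (r : M) (σ : Perm (Darts M E)) : Sum.inl r ∈ component r σ :=
  fun _ _ h => h

theorem component_subset {r : M} {σ : Perm (Darts M E)} {A : Set (Darts M E)} (hA : IsStable σ A)
    (hr : Sum.inl r ∈ A) : component r σ ⊆ A := fun _ hx => hx A hA hr

theorem isStable_range_inl (σ : Perm (Darts {m // p m} {e // q e}))
    (μ : Perm (Darts {m // ¬ p m} {e // ¬ q e})) (A : Set (Darts {m // p m} {e // q e}))
    (hA : IsStable σ A) :
    IsStable (disjUnion p q σ μ) ((fun x => combine p q (Sum.inl x)) '' A) := by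
  refine ⟨?_, ?_⟩
  · rintro _ ⟨x, hx, rfl⟩
    exact ⟨σ x, hA.map_perm x hx, (disjUnion_inl σ μ x).symm⟩
  · rintro e b ⟨x, hx, hxe⟩
    rcases x with m | ⟨e', b'⟩
    · simp at hxe
    · simp only [combine_inl_inr, Sum.inr.injEq, Prod.mk.injEq] at hxe
      obtain ⟨rfl, rfl⟩ := hxe
      exact ⟨_, hA.map_flip e' b' hx, rfl⟩

theorem component_disjUnion {r : M} (hr : p r) {σ : Perm (Darts {m // p m} {e // q e})}
    (hσ : IsConnected σ) (μ : Perm (Darts {m // ¬ p m} {e // ¬ q e})) :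
    component r (disjUnion p q σ μ) = Set.range fun x => combine p q (Sum.inl x) := by
  apply Set.Subset.antisymm
  · rw [← Set.image_univ]
    exact component_subset (isStable_range_inl σ μ Set.univ ⟨by simp, by simp⟩)
      ⟨Sum.inl ⟨r, hr⟩, trivial, rfl⟩
  · rintro _ ⟨x, rfl⟩
    have hc := isStable_component r (disjUnion p q σ μ)
    have : {x | combine p q (Sum.inl x) ∈ component r (disjUnion p q σ μ)} = Set.univ := by
      refine hσ _ ⟨fun x hx => ?_, fun e b hx => hc.map_flip e.1 b hx⟩
        ⟨Sum.inl ⟨r, hr⟩, mem_component_self r _⟩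
      have := hc.map_perm _ hx
      rwa [disjUnion_inl] at this
    exact (this ▸ Set.mem_univ x : x ∈ {x | _})

theorem exists_disjUnion [Finite M] [Finite E] {r : M} {σ : Perm (Darts M E)}
    (h : component r σ = Set.range fun x => combine p q (Sum.inl x)) :
    ∃ (σ₁ : Perm (Darts {m // p m} {e // q e})) (σ₂ : Perm (Darts {m // ¬ p m} {e // ¬ q e})),
      IsConnected σ₁ ∧ disjUnion p q σ₁ σ₂ = σ := by
  have hmaps : Set.MapsTo ((combine p q).symm.permCongr σ) (Set.range Sum.inl)
      (Set.range Sum.inl) := by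
    rintro _ ⟨x, rfl⟩
    have := (isStable_component r σ).map_perm (combine p q (Sum.inl x)) (h ▸ ⟨x, rfl⟩)
    rw [h] at this
    obtain ⟨y, hy⟩ := this
    refine ⟨y, ?_⟩
    rw [Equiv.permCongr_apply, Equiv.symm_symm, ← hy, Equiv.symm_apply_apply]
  -- By finiteness, a permutation which maps one summand into itself is a sum of two permutations.
  obtain ⟨⟨σ₁, σ₂⟩, hs⟩ := mem_sumCongrHom_range_of_perm_mapsTo_inl hmaps
  rw [Perm.sumCongrHom_apply] at hs
  have hσ : disjUnion p q σ₁ σ₂ = σ := by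
    rw [disjUnion, hs]
    ext x
    simp [Equiv.permCongr_apply]
  obtain ⟨x, hx⟩ : Sum.inl r ∈ Set.range fun x => combine p q (Sum.inl x) :=
    h ▸ mem_component_self r σ
  refine ⟨σ₁, σ₂, isConnected_of_root (r := x) fun A hA hxA => ?_, hσ⟩
  have hst := isStable_range_inl σ₁ σ₂ A hA
  rw [hσ] at hst
  have hsub := component_subset hst ⟨x, hxA, hx⟩
  rw [h] at hsub
  refine Set.eq_univ_of_forall fun y => ?_
  obtain ⟨z, hz, hzy⟩ := hsub ⟨y, rfl⟩
  have : z = y := by simpa using hzy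
  exact this ▸ hz

theorem disjUnion_injective {σ₁ μ₁ : Perm (Darts {m // p m} {e // q e})}
    {σ₂ μ₂ : Perm (Darts {m // ¬ p m} {e // ¬ q e})}
    (h : disjUnion p q σ₁ σ₂ = disjUnion p q μ₁ μ₂) : σ₁ = μ₁ ∧ σ₂ = μ₂ := by
  have := Perm.sumCongrHom_injective (a₁ := (σ₁, σ₂)) (a₂ := (μ₁, μ₂))
    ((combine p q).permCongr.injective h)
  simpa using this

-- Permutations are sorted by the marks `S` and the edges `F` in the component of `r`; over a given
-- pair they are the disjoint unions of a connected map with an arbitrary one.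
open scoped Classical in
theorem sum_perm_eq_sum_disjUnion [Fintype M] [DecidableEq M] [Fintype E] [DecidableEq E]
    {R : Type*} [AddCommMonoid R] (r : M) (f : Perm (Darts M E) → R) :
    ∑ σ, f σ = ∑ S : Finset M with r ∈ S, ∑ F : Finset E,
      ∑ σ₁ : Perm (Darts {m // m ∈ S} {e // e ∈ F}) with IsConnected σ₁,
        ∑ σ₂, f (disjUnion (· ∈ S) (· ∈ F) σ₁ σ₂) := by
  -- The dart `false` suffices to record an edge, since a component contains both darts of an edge
  -- or neither.
  let g : Perm (Darts M E) → Finset M × Finset E := fun σ =>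
    (Finset.univ.filter fun m => Sum.inl m ∈ component r σ,
      Finset.univ.filter fun e => Sum.inr (e, false) ∈ component r σ)
  have hg : ∀ σ ∈ (Finset.univ : Finset (Perm (Darts M E))),
      g σ ∈ (Finset.univ.filter fun S : Finset M => r ∈ S) ×ˢ
        (Finset.univ : Finset (Finset E)) := by
    intro σ _
    simp [g, mem_component_self]
  rw [← Finset.sum_fiberwise_of_maps_to hg, Finset.sum_product]
  refine Finset.sum_congr rfl fun S hS => Finset.sum_congr rfl fun F _ => ?_
  have hrS : r ∈ S := (Finset.mem_filter.mp hS).2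
  have hiff : ∀ σ, g σ = (S, F) ↔
      component r σ = Set.range fun x => combine (· ∈ S) (· ∈ F) (Sum.inl x) := by
    intro σ
    constructor
    · intro h
      simp only [g, Prod.mk.injEq] at h
      obtain ⟨rfl, rfl⟩ := h
      ext x
      constructor
      · intro hx
        rcases x with m | ⟨e, b⟩
        · exact ⟨Sum.inl ⟨m, by simpa using hx⟩, rfl⟩
        · refine ⟨Sum.inr (⟨e, ?_⟩, b), rfl⟩
          rcases b with _ | _
          · simpa using hx
          · simpa using (isStable_component r σ).map_flip e true hx
      · rintro ⟨m | ⟨e, b⟩, rfl⟩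
        · exact (Finset.mem_filter.mp m.2).2
        · have he : Sum.inr (e.1, false) ∈ component r σ := (Finset.mem_filter.mp e.2).2
          rcases b with _ | _
          · exact he
          · exact (isStable_component r σ).map_flip e false he
    · intro h
      simp only [g, h, Prod.mk.injEq]
      constructor
      · ext m
        simp only [Finset.mem_filter, Finset.mem_univ, true_and]
        constructor
        · rintro ⟨m' | ⟨e', b'⟩, hm⟩
          · obtain rfl : m'.1 = m := by simpa using hm
            exact m'.2
          · simp at hm
        · exact fun hm => ⟨Sum.inl ⟨m, hm⟩, rfl⟩
      · ext e
        simp only [Finset.mem_filter, Finset.mem_univ, true_and]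
        constructor
        · rintro ⟨m' | ⟨e', b'⟩, hm⟩
          · simp at hm
          · obtain rfl : e'.1 = e := by
              simp only [combine_inl_inr, Sum.inr.injEq, Prod.mk.injEq] at hm
              exact hm.1
            exact e'.2
        · exact fun he => ⟨Sum.inr (⟨e, he⟩, false), rfl⟩
  rw [← Finset.sum_product']
  symm
  refine Finset.sum_nbij (fun x => disjUnion (· ∈ S) (· ∈ F) x.1 x.2) ?_ ?_ ?_ fun _ _ => rfl
  · rintro ⟨σ₁, σ₂⟩ h
    simp only [Finset.mem_product, Finset.mem_filter, Finset.mem_univ, true_and, and_true] at h ⊢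
    rw [hiff]
    exact component_disjUnion hrS h σ₂
  · rintro ⟨σ₁, σ₂⟩ _ ⟨μ₁, μ₂⟩ _ h
    obtain ⟨h1, h2⟩ := disjUnion_injective h
    exact Prod.ext h1 h2
  · intro σ hσ
    simp only [Finset.coe_filter, Finset.mem_univ, true_and, Set.mem_ofPred_eq, hiff] at hσ
    obtain ⟨σ₁, σ₂, h1, h2⟩ := exists_disjUnion hσ
    exact ⟨(σ₁, σ₂), by simp [h1], h2⟩

end LinkedCluster

end QuarticTensor

namespace QuarticTensor

open Equiv Equiv.Perm

/-! ### Generating functions of maps -/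

section Series

set_option linter.unusedSectionVars false

variable {κ M M' E E' : Type} [Fintype κ] [DecidableEq κ] [Fintype M] [DecidableEq M]
  [Fintype M'] [DecidableEq M'] [Fintype E] [DecidableEq E] [Fintype E'] [DecidableEq E']

/-- The weight of a map: `x` for each edge, `y` for each vertex, `w` for each unit of excess. -/
noncomputable def mapWeight (x y w : ℂ) (c : E → κ) (σ : Perm (Darts M E)) : ℂ :=
  x ^ Fintype.card E * y ^ cyc σ * w ^ excess c σ

/-- The weighted sum over all maps with given marked corners and labelled edges. -/
noncomputable def mapSum (x y w : ℂ) (E : Type) [Fintype E] [DecidableEq E]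
    (g : (κ → M → M → Prop) → ℂ) : ℂ :=
  ∑ c : E → κ, ∑ σ : Perm (Darts M E), mapWeight x y w c σ * g (faceRel c σ)

open scoped Classical in
/-- The weighted sum over all connected maps with given marked corners and labelled edges. -/
noncomputable def connSum (x y w : ℂ) (E : Type) [Fintype E] [DecidableEq E]
    (g : (κ → M → M → Prop) → ℂ) : ℂ :=
  ∑ c : E → κ, ∑ σ : Perm (Darts M E) with IsConnected σ,
    mapWeight x y w c σ * g (faceRel c σ)

/-- The exponential generating function of all maps. -/
noncomputable def mapSeries (x y w : ℂ) (g : (κ → M → M → Prop) → ℂ) : PowerSeries ℂ :=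
  PowerSeries.mk fun n => mapSum x y w (Fin n) g / (2 ^ n * n.factorial)

/-- The exponential generating function of connected maps. -/
noncomputable def connSeries (x y w : ℂ) (g : (κ → M → M → Prop) → ℂ) : PowerSeries ℂ :=
  PowerSeries.mk fun n => connSum x y w (Fin n) g / (2 ^ n * n.factorial)

theorem mapWeight_relabel (x y w : ℂ) (e : M ≃ M') (f : E ≃ E') (c : E → κ)
    (σ : Perm (Darts M E)) :
    mapWeight x y w (c ∘ f.symm) ((dartsCongr e f).permCongr σ) = mapWeight x y w c σ := by
  rw [mapWeight, excess_relabel, cyc_permCongr, mapWeight, Fintype.card_congr f]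

theorem faceRel_relabel' (e : M ≃ M') (f : E ≃ E') (c : E → κ) (σ : Perm (Darts M E)) :
    faceRel (c ∘ f.symm) ((dartsCongr e f).permCongr σ) =
      fun k a b => faceRel c σ k (e.symm a) (e.symm b) := by
  funext k a b
  exact propext (faceRel_relabel e f c σ k a b)

theorem sum_relabel (x y w : ℂ) (e : M ≃ M') (f : E ≃ E')
    {g : (κ → M → M → Prop) → ℂ} {g' : (κ → M' → M' → Prop) → ℂ}
    (hg : ∀ r, g' (fun k a b => r k (e.symm a) (e.symm b)) = g r)
    (P : Perm (Darts M E) → Prop) (P' : Perm (Darts M' E') → Prop)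
    [DecidablePred P] [DecidablePred P']
    (hP : ∀ σ, P' ((dartsCongr e f).permCongr σ) ↔ P σ) :
    ∑ c : E → κ, ∑ σ : Perm (Darts M E) with P σ, mapWeight x y w c σ * g (faceRel c σ) =
    ∑ c : E' → κ, ∑ σ : Perm (Darts M' E') with P' σ,
      mapWeight x y w c σ * g' (faceRel c σ) := by
  refine Fintype.sum_equiv (f.arrowCongr (Equiv.refl κ)) _ _ fun c => ?_
  have hc : (f.arrowCongr (Equiv.refl κ)) c = c ∘ f.symm := rfl
  rw [hc]
  refine Finset.sum_equiv (dartsCongr e f).permCongr (fun σ => ?_) fun σ _ => ?_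
  · simp [hP]
  · rw [mapWeight_relabel, faceRel_relabel', hg]

theorem mapSum_relabel (x y w : ℂ) (e : M ≃ M') (f : E ≃ E')
    {g : (κ → M → M → Prop) → ℂ} {g' : (κ → M' → M' → Prop) → ℂ}
    (hg : ∀ r, g' (fun k a b => r k (e.symm a) (e.symm b)) = g r) :
    mapSum x y w E g = mapSum x y w E' g' := by
  have := sum_relabel x y w e f hg (fun _ => True) (fun _ => True) fun _ => Iff.rfl
  simpa only [mapSum, Finset.filter_true] using this

theorem connSum_relabel (x y w : ℂ) (e : M ≃ M') (f : E ≃ E')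
    {g : (κ → M → M → Prop) → ℂ} {g' : (κ → M' → M' → Prop) → ℂ}
    (hg : ∀ r, g' (fun k a b => r k (e.symm a) (e.symm b)) = g r) :
    connSum x y w E g = connSum x y w E' g' := by
  classical
  exact sum_relabel x y w e f hg _ _ fun σ => isConnected_relabel e f σ

theorem mapSeries_relabel (x y w : ℂ) (e : M ≃ M')
    {g : (κ → M → M → Prop) → ℂ} {g' : (κ → M' → M' → Prop) → ℂ}
    (hg : ∀ r, g' (fun k a b => r k (e.symm a) (e.symm b)) = g r) :
    mapSeries x y w g = mapSeries x y w g' := by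
  ext n
  rw [mapSeries, mapSeries, PowerSeries.coeff_mk, PowerSeries.coeff_mk,
    mapSum_relabel x y w e (Equiv.refl _) hg]

theorem connSeries_relabel (x y w : ℂ) (e : M ≃ M')
    {g : (κ → M → M → Prop) → ℂ} {g' : (κ → M' → M' → Prop) → ℂ}
    (hg : ∀ r, g' (fun k a b => r k (e.symm a) (e.symm b)) = g r) :
    connSeries x y w g = connSeries x y w g' := by
  ext n
  rw [connSeries, connSeries, PowerSeries.coeff_mk, PowerSeries.coeff_mk,
    connSum_relabel x y w e (Equiv.refl _) hg]

theorem connSum_eq_fin (x y w : ℂ) (g : (κ → M → M → Prop) → ℂ) :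
    connSum x y w E g = connSum x y w (Fin (Fintype.card E)) g :=
  connSum_relabel x y w (Equiv.refl M) (Fintype.equivFin E) fun _ => rfl

theorem mapSum_eq_fin (x y w : ℂ) (g : (κ → M → M → Prop) → ℂ) :
    mapSum x y w E g = mapSum x y w (Fin (Fintype.card E)) g :=
  mapSum_relabel x y w (Equiv.refl M) (Fintype.equivFin E) fun _ => rfl

theorem mapWeight_disjUnion (x y w : ℂ) {p : M → Prop} {q : E → Prop} [DecidablePred p]
    [DecidablePred q] [Fintype {e // q e}] [Fintype {e // ¬ q e}] (c : E → κ)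
    (σ : Perm (Darts {m // p m} {e // q e}))
    (μ : Perm (Darts {m // ¬ p m} {e // ¬ q e})) :
    mapWeight x y w c (disjUnion p q σ μ) =
      mapWeight x y w (fun e => c e.1) σ * mapWeight x y w (fun e => c e.1) μ := by
  rw [mapWeight, mapWeight, mapWeight, cyc_disjUnion, excess_disjUnion,
    ← card_subtype_add_card_not (q := q)]
  ring

-- The linked-cluster decomposition for labelled edges. It works because weights are multiplicative
-- on disjoint unions and `g` is assumed to factorize there.
open scoped Classical in
theorem mapSum_eq_sum_component (x y w : ℂ) (r : M) {g : (κ → M → M → Prop) → ℂ}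
    (g₁ : ∀ S : Finset M, (κ → {m // m ∈ S} → {m // m ∈ S} → Prop) → ℂ)
    (g₂ : ∀ S : Finset M, (κ → {m // m ∉ S} → {m // m ∉ S} → Prop) → ℂ)
    (hg : ∀ S, r ∈ S → ∀ s t, g (joinRel (· ∈ S) s t) = g₁ S s * g₂ S t) :
    mapSum x y w E g = ∑ S : Finset M with r ∈ S, ∑ F : Finset E,
      connSum x y w {e // e ∈ F} (g₁ S) * mapSum x y w {e // e ∉ F} (g₂ S) := by
  simp only [mapSum, sum_perm_eq_sum_disjUnion r]
  rw [Finset.sum_comm]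
  refine Finset.sum_congr rfl fun S hS => ?_
  rw [Finset.sum_comm]
  refine Finset.sum_congr rfl fun F _ => ?_
  have hrS : r ∈ S := (Finset.mem_filter.mp hS).2
  simp only [mapWeight_disjUnion, faceRel_disjUnion, hg S hrS]
  rw [connSum, Finset.sum_mul_sum, ← Fintype.sum_prod_type']
  refine Fintype.sum_equiv (Equiv.piEquivPiSubtypeProd (· ∈ F) fun _ => κ) _ _ fun c => ?_
  rw [Finset.sum_mul_sum]
  refine Finset.sum_congr rfl fun σ _ => Finset.sum_congr rfl fun μ _ => ?_
  simp only [Equiv.piEquivPiSubtypeProd_apply]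
  ring

-- The number of sets `F` of `k` edges is a binomial coefficient, so the previous identity is a
-- product of exponential generating functions.
open scoped Classical in
theorem mapSeries_eq_sum_component (x y w : ℂ) (r : M) {g : (κ → M → M → Prop) → ℂ}
    (g₁ : ∀ S : Finset M, (κ → {m // m ∈ S} → {m // m ∈ S} → Prop) → ℂ)
    (g₂ : ∀ S : Finset M, (κ → {m // m ∉ S} → {m // m ∉ S} → Prop) → ℂ)
    (hg : ∀ S, r ∈ S → ∀ s t, g (joinRel (· ∈ S) s t) = g₁ S s * g₂ S t) :
    mapSeries x y w g = ∑ S : Finset M with r ∈ S,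
      connSeries x y w (g₁ S) * mapSeries x y w (g₂ S) := by
  ext n
  rw [mapSeries, PowerSeries.coeff_mk, mapSum_eq_sum_component x y w r g₁ g₂ hg, map_sum,
    Finset.sum_div]
  refine Finset.sum_congr rfl fun S _ => ?_
  have h1 : ∀ F : Finset (Fin n),
      connSum x y w {e // e ∈ F} (g₁ S) * mapSum x y w {e // e ∉ F} (g₂ S) =
      connSum x y w (Fin F.card) (g₁ S) * mapSum x y w (Fin (n - F.card)) (g₂ S) := by
    intro F
    rw [connSum_eq_fin, mapSum_eq_fin]
    have h2 : Fintype.card {e // e ∉ F} = n - F.card := by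
      rw [Fintype.card_subtype_compl, Fintype.card_fin, Fintype.card_coe]
    rw [Fintype.card_coe, h2]
  rw [Finset.sum_congr rfl fun F _ => h1 F, ← Finset.powerset_univ,
    Finset.sum_powerset_apply_card
      (fun k => connSum x y w (Fin k) (g₁ S) * mapSum x y w (Fin (n - k)) (g₂ S)),
    PowerSeries.coeff_mul, Finset.Nat.sum_antidiagonal_eq_sum_range_succ_mk, Finset.card_univ,
    Fintype.card_fin, Finset.sum_div]
  refine Finset.sum_congr rfl fun k hk => ?_
  have hk' : k ≤ n := Nat.lt_succ_iff.mp (Finset.mem_range.mp hk)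
  rw [connSeries, mapSeries, PowerSeries.coeff_mk, PowerSeries.coeff_mk, nsmul_eq_mul,
    Nat.cast_choose ℂ hk']
  have h3 : (k.factorial : ℂ) ≠ 0 := by exact_mod_cast k.factorial_ne_zero
  have h4 : ((n - k).factorial : ℂ) ≠ 0 := by exact_mod_cast (n - k).factorial_ne_zero
  have h5 : (n.factorial : ℂ) ≠ 0 := by exact_mod_cast n.factorial_ne_zero
  have h6 : (2 : ℂ) ^ n = 2 ^ k * 2 ^ (n - k) := by rw [← pow_add, Nat.add_sub_cancel' hk']
  rw [h6]
  field_simp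

end Series

end QuarticTensor

namespace QuarticTensor

open Equiv Equiv.Perm

/-! ### Removal of a marked corner -/

section Removal

set_option linter.unusedSectionVars false

variable {κ M M' E E' : Type} [Fintype κ] [DecidableEq κ] [Fintype M] [DecidableEq M]
  [Fintype M'] [DecidableEq M'] [Fintype E] [DecidableEq E] [Fintype E'] [DecidableEq E']

/-- The darts of a map with a distinguished marked corner. -/
def optionDarts (M E : Type) : Option (Darts M E) ≃ Darts (Option M) E where
  toFun
    | none => Sum.inl none
    | some (Sum.inl m) => Sum.inl (some m)
    | some (Sum.inr e) => Sum.inr e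
  invFun
    | Sum.inl none => none
    | Sum.inl (some m) => some (Sum.inl m)
    | Sum.inr e => some (Sum.inr e)
  left_inv := by rintro (_ | m | e) <;> rfl
  right_inv := by rintro ((_ | m) | e) <;> rfl

/-- Addition of a marked corner, either just before a given dart or at a new vertex. -/
def addMark (σ : Perm (Darts M E)) (i : Option (Darts M E)) : Perm (Darts (Option M) E) :=
  (optionDarts M E).permCongr (swap none i * optionCongr σ)

theorem addMark_none (σ : Perm (Darts M E)) :
    addMark σ none = (optionDarts M E).permCongr (optionCongr σ) := by
  rw [addMark, swap_self]
  rfl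

theorem addMark_some (σ : Perm (Darts M E)) (h : Darts M E) :
    addMark σ (some h) = (optionDarts M E).permCongr (insertBefore σ h) := rfl

/-- A permutation is determined by the image of the distinguished mark and by what remains after
bypassing this mark. -/
theorem sum_perm_option_darts {R : Type*} [AddCommMonoid R] (f : Perm (Darts (Option M) E) → R) :
    ∑ σ, f σ = ∑ σ : Perm (Darts M E), f (addMark σ none) +
      (∑ m : M, ∑ σ : Perm (Darts M E), f (addMark σ (some (Sum.inl m))) +
        ∑ e : E × Bool, ∑ σ : Perm (Darts M E), f (addMark σ (some (Sum.inr e)))) := by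
  rw [← (optionDarts M E).permCongr.sum_comp, ← Perm.decomposeOption.symm.sum_comp,
    Fintype.sum_prod_type, Fintype.sum_option, Fintype.sum_sum_type]
  rfl

theorem addMark_mul_flip (c : E → κ) (k : κ) (σ : Perm (Darts M E)) (i : Option (Darts M E)) :
    addMark σ i * flip c k = addMark (σ * flip c k) i := by
  have h : flip c k = (optionDarts M E).permCongr (optionCongr (flip c k)) := by
    ext x
    obtain ⟨x, rfl⟩ := (optionDarts M E).surjective x
    rw [Equiv.permCongr_apply, Equiv.symm_apply_apply]
    rcases x with _ | m | ⟨e, b⟩ <;> simp [optionDarts]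
  rw [h, addMark, addMark, ← permCongr_mul_perm, mul_assoc]
  congr 2
  ext x
  cases x <;> simp

theorem cyc_addMark_none (σ : Perm (Darts M E)) : cyc (addMark σ none) = cyc σ + 1 := by
  rw [addMark_none, cyc_permCongr, cyc_optionCongr]

theorem cyc_addMark_some (σ : Perm (Darts M E)) (h : Darts M E) :
    cyc (addMark σ (some h)) = cyc σ := by
  rw [addMark_some, cyc_permCongr, cyc_insertBefore]

/-- An isolated vertex adds one vertex and one face of each colour, and these cancel in the excess.
-/
theorem mapWeight_addMark_none (x y w : ℂ) (c : E → κ) (σ : Perm (Darts M E)) :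
    mapWeight x y w c (addMark σ none) = y * mapWeight x y w c σ := by
  have : excess c (addMark σ none) = excess c σ := by
    simp only [excess, addMark_mul_flip, cyc_addMark_none, Finset.sum_add_distrib, mul_add,
      Finset.sum_const, Finset.card_univ, smul_eq_mul, mul_one]
    omega
  rw [mapWeight, mapWeight, this, cyc_addMark_none]
  ring

theorem mapWeight_addMark_some (x y w : ℂ) (c : E → κ) (σ : Perm (Darts M E)) (h : Darts M E) :
    mapWeight x y w c (addMark σ (some h)) = mapWeight x y w c σ := by
  simp only [mapWeight, excess, addMark_mul_flip, cyc_addMark_some]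

/-- The dart which represents a marked corner after the removal of the distinguished one. -/
def markDart (h : Darts M E) : Option M → Darts M E
  | none => h
  | some m => Sum.inl m

theorem faceRel_addMark_some (c : E → κ) (σ : Perm (Darts M E)) (h : Darts M E) :
    faceRel c (addMark σ (some h)) =
      fun k a b => SameCycle (σ * flip c k) (markDart h a) (markDart h b) := by
  funext k a b
  rw [faceRel, addMark_mul_flip, addMark_some, sameCycle_permCongr, sameCycle_insertBefore]
  rcases a with _ | a <;> rcases b with _ | b <;> rfl

/-- The relation between the marked corners when the distinguished one is alone at its vertex. -/
def relNone (r : κ → M → M → Prop) (k : κ) : Option M → Option M → Prop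
  | none, none => True
  | some a, some b => r k a b
  | _, _ => False

/-- The relation between the marked corners when the distinguished one is next to `m`. -/
def relSome (m : M) (r : κ → M → M → Prop) (k : κ) (a b : Option M) : Prop :=
  r k (a.getD m) (b.getD m)

theorem faceRel_addMark_none (c : E → κ) (σ : Perm (Darts M E)) :
    faceRel c (addMark σ none) = relNone (faceRel c σ) := by
  funext k a b
  rw [faceRel, addMark_mul_flip, addMark_none, sameCycle_permCongr]
  refine propext ?_
  rcases a with _ | a <;> rcases b with _ | b
  · exact iff_of_true (SameCycle.refl _ _) trivial
  · exact iff_of_false (not_sameCycle_optionCongr_none _ _) id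
  · exact iff_of_false (fun h => not_sameCycle_optionCongr_none _ _ h.symm) id
  · exact sameCycle_optionCongr_some _ _ _

theorem faceRel_addMark_inl (c : E → κ) (σ : Perm (Darts M E)) (m : M) :
    faceRel c (addMark σ (some (Sum.inl m))) = relSome m (faceRel c σ) := by
  rw [faceRel_addMark_some]
  funext k a b
  rcases a with _ | a <;> rcases b with _ | b <;> rfl

/-- The corners which remain or arise when the distinguished one is removed, and the edge after it
is cut open. -/
def openMark (b : Bool) : Option M → M ⊕ Bool
  | none => Sum.inr b
  | some m => Sum.inl m

/-- The relation between the marked corners in a map, expressed in terms of the map in which the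
edge of colour `i` after the distinguished one has been cut open. -/
def relOpen (i : κ) (b : Bool) (r : κ → M ⊕ Bool → M ⊕ Bool → Prop) (k : κ)
    (a a' : Option M) : Prop :=
  r k (openMark b a) (openMark b a') ∨ (k = i ∧
    ((r k (openMark b a) (Sum.inr false) ∧ r k (Sum.inr true) (openMark b a')) ∨
      (r k (openMark b a) (Sum.inr true) ∧ r k (Sum.inr false) (openMark b a'))))

/-- When the two ends lie on different faces of the colour of the edge, closing it merges these
faces, so `gluePair` describes the new relation. -/
theorem sameCycle_openEdge (c : Option E → κ) (σ : Perm (Darts M (Option E))) (b : Bool)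
    (h : ¬ faceRel (c ∘ some) ((openEdge M E).permCongr σ) (c none) (Sum.inr false)
      (Sum.inr true)) :
    (fun k a a' => SameCycle (σ * flip c k) (markDart (Sum.inr (none, b)) a)
      (markDart (Sum.inr (none, b)) a')) =
      relOpen (c none) b (faceRel (c ∘ some) ((openEdge M E).permCongr σ)) := by
  funext k a a'
  have hd : ∀ a : Option M, openEdge M E (markDart (Sum.inr (none, b)) a) =
      Sum.inl (openMark b a) := by rintro (_ | a) <;> rfl
  have h1 : SameCycle (σ * flip c k) (markDart (Sum.inr (none, b)) a)
      (markDart (Sum.inr (none, b)) a') ↔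
      SameCycle ((openEdge M E).permCongr σ * (openEdge M E).permCongr (flip c k))
        (Sum.inl (openMark b a)) (Sum.inl (openMark b a')) := by
    rw [← permCongr_mul_perm, sameCycle_permCongr, ← hd, ← hd, Equiv.symm_apply_apply,
      Equiv.symm_apply_apply]
  refine propext (h1.trans ?_)
  by_cases hk : k = c none
  · subst hk
    have hs := setoid_mul_swap_of_not_sameCycle h
    rw [openEdge_flip_self, ← mul_assoc]
    have h2 : ∀ y z, SameCycle ((openEdge M E).permCongr σ * flip (c ∘ some) (c none) *
        swap (Sum.inl (Sum.inr false)) (Sum.inl (Sum.inr true))) y z ↔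
        gluePair (SameCycle.setoid ((openEdge M E).permCongr σ * flip (c ∘ some) (c none)))
          (Sum.inl (Sum.inr false)) (Sum.inl (Sum.inr true)) y z := by
      intro y z; rw [← hs]; rfl
    rw [h2, gluePair_iff]
    simp only [relOpen, true_and]
    rfl
  · rw [openEdge_flip_of_ne c (Ne.symm hk)]
    simp only [relOpen, hk, false_and, or_false]
    rfl

-- Closing an edge whose ends share a face of its colour raises the excess, which `w = 0` forbids.
open scoped Classical in
theorem mapWeight_openEdge (x y : ℂ) (c : Option E → κ) (σ : Perm (Darts M (Option E))) :
    mapWeight x y 0 c σ = x * (mapWeight x y 0 (c ∘ some) ((openEdge M E).permCongr σ) *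
      if faceRel (c ∘ some) ((openEdge M E).permCongr σ) (c none) (Sum.inr false) (Sum.inr true)
        then 0 else 1) := by
  rw [mapWeight, mapWeight, excess_openEdge, cyc_permCongr, Fintype.card_option]
  split_ifs
  · simp
  · ring

/-- The weighted sum over the maps in which the distinguished corner is followed by a given dart. -/
noncomputable def dartSum (x y w : ℂ) (E : Type) [Fintype E] [DecidableEq E] (d : E × Bool)
    (g : (κ → Option M → Option M → Prop) → ℂ) : ℂ :=
  ∑ c : E → κ, ∑ σ : Perm (Darts M E), mapWeight x y w c σ *
    g fun k a b => SameCycle (σ * flip c k) (markDart (Sum.inr d) a) (markDart (Sum.inr d) b)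

theorem dartSum_relabel (x y w : ℂ) (f : E ≃ E') (e : E) (b : Bool)
    (g : (κ → Option M → Option M → Prop) → ℂ) :
    dartSum x y w E (e, b) g = dartSum x y w E' (f e, b) g := by
  refine Fintype.sum_equiv (f.arrowCongr (Equiv.refl κ)) _ _ fun c => ?_
  have hc : (f.arrowCongr (Equiv.refl κ)) c = c ∘ f.symm := rfl
  rw [hc]
  refine Fintype.sum_equiv (dartsCongr (Equiv.refl M) f).permCongr _ _ fun σ => ?_
  have hd : ∀ a : Option M, (dartsCongr (Equiv.refl M) f).symm (markDart (Sum.inr (f e, b)) a) =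
      markDart (Sum.inr (e, b)) a := by
    rintro (_ | a) <;> simp [markDart, dartsCongr]
  simp only [mapWeight_relabel, permCongr_mul_flip, sameCycle_permCongr, hd]

open scoped Classical in
/-- The weight of a map with an edge of colour `i` cut open, from which the distinguished corner has
been removed. -/
noncomputable def openWeight (g : (κ → Option M → Option M → Prop) → ℂ) (i : κ) (b : Bool)
    (r : κ → M ⊕ Bool → M ⊕ Bool → Prop) : ℂ :=
  (if r i (Sum.inr false) (Sum.inr true) then 0 else 1) * g (relOpen i b r)

theorem dartSum_none (x y : ℂ) (b : Bool) (g : (κ → Option M → Option M → Prop) → ℂ) :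
    dartSum x y 0 (Option E) (none, b) g =
      x * ∑ i : κ, mapSum x y 0 E (openWeight g i b) := by
  classical
  rw [dartSum, ← (Equiv.piOptionEquivProd (β := fun _ => κ)).symm.sum_comp, Fintype.sum_prod_type,
    Finset.mul_sum]
  refine Finset.sum_congr rfl fun i _ => ?_
  rw [mapSum, Finset.mul_sum]
  refine Finset.sum_congr rfl fun c _ => ?_
  rw [Finset.mul_sum]
  refine Fintype.sum_equiv (openEdge M E).permCongr _ _ fun σ => ?_
  have hc : ((Equiv.piOptionEquivProd (β := fun _ : Option E => κ)).symm (i, c)) ∘ some = c := rfl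
  have hi : ((Equiv.piOptionEquivProd (β := fun _ : Option E => κ)).symm (i, c)) none = i := rfl
  rw [mapWeight_openEdge, hc, hi, openWeight]
  split_ifs with h
  · simp
  · have := sameCycle_openEdge ((Equiv.piOptionEquivProd (β := fun _ => κ)).symm (i, c)) σ b
      (by rw [hc, hi]; exact h)
    rw [hc, hi] at this
    rw [this]
    ring

theorem mapSum_option (x y w : ℂ) (g : (κ → Option M → Option M → Prop) → ℂ) :
    mapSum x y w E g = y * mapSum x y w E (g ∘ relNone) +
      (∑ m, mapSum x y w E (g ∘ relSome m) + ∑ d : E × Bool, dartSum x y w E d g) := by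
  simp only [mapSum, sum_perm_option_darts, Finset.sum_add_distrib, mapWeight_addMark_none,
    mapWeight_addMark_some, faceRel_addMark_none, faceRel_addMark_inl, Function.comp_apply,
    dartSum, faceRel_addMark_some _ _ (Sum.inr _)]
  congr 1
  · rw [Finset.mul_sum]
    refine Finset.sum_congr rfl fun c _ => ?_
    rw [Finset.mul_sum]
    exact Finset.sum_congr rfl fun σ _ => mul_assoc _ _ _
  · congr 1
    · exact Finset.sum_comm
    · exact Finset.sum_comm

/-- The Schwinger–Dyson equation obtained by removing the distinguished marked corner. -/
theorem mapSeries_option (x y : ℂ) (g : (κ → Option M → Option M → Prop) → ℂ)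
    (g' : κ → (κ → M ⊕ Bool → M ⊕ Bool → Prop) → ℂ)
    (hg : ∀ i b n, mapSum x y 0 (Fin n) (openWeight g i b) = mapSum x y 0 (Fin n) (g' i)) :
    mapSeries x y 0 g = PowerSeries.C y * mapSeries x y 0 (g ∘ relNone) +
      (∑ m, mapSeries x y 0 (g ∘ relSome m) +
        PowerSeries.X * (PowerSeries.C x * ∑ i, mapSeries x y 0 (g' i))) := by
  ext n
  simp only [map_add, PowerSeries.coeff_C_mul, map_sum]
  simp only [mapSeries, PowerSeries.coeff_mk]
  rw [mapSum_option, add_div, add_div, mul_div_assoc, Finset.sum_div]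
  congr 2
  rcases n with _ | n
  · simp
  · rw [PowerSeries.coeff_succ_X_mul, PowerSeries.coeff_C_mul, map_sum]
    simp only [PowerSeries.coeff_mk]
    -- By relabelling, the `2 (n + 1)` darts all contribute equally; this number is the ratio of `2
    -- ^ (n + 1) * (n + 1)!` to `2 ^ n * n!`.
    have h1 : ∀ d : Fin (n + 1) × Bool, dartSum x y 0 (Fin (n + 1)) d g =
        x * ∑ i, mapSum x y 0 (Fin n) (g' i) := by
      rintro ⟨e, b⟩
      rw [dartSum_relabel x y 0 (finSuccEquiv' e) e b g, finSuccEquiv'_at, dartSum_none]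
      simp only [hg]
    rw [Finset.sum_congr rfl fun d _ => h1 d, Finset.sum_const, Finset.card_univ,
      Fintype.card_prod, Fintype.card_fin, Fintype.card_bool, nsmul_eq_mul, ← Finset.sum_div,
      Nat.factorial_succ]
    have h3 : (n.factorial : ℂ) ≠ 0 := by exact_mod_cast n.factorial_ne_zero
    have h4 : ((n : ℂ) + 1) ≠ 0 := by exact_mod_cast n.succ_ne_zero
    push_cast
    rw [pow_succ]
    field_simp

end Removal

end QuarticTensor

namespace QuarticTensor

open Equiv Equiv.Perm

/-! ### Maps with one, two and three marked corners -/

section FewMarks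

set_option linter.unusedSectionVars false

variable {κ : Type} [Fintype κ] [DecidableEq κ]

variable (κ) in
/-- The generating function of maps without marked corners. -/
noncomputable def mapZero (x y w : ℂ) : PowerSeries ℂ :=
  mapSeries (κ := κ) (M := Empty) x y w fun _ => 1

variable (κ) in
/-- The generating function of maps with one marked corner. -/
noncomputable def mapOne (x y w : ℂ) : PowerSeries ℂ :=
  mapSeries (κ := κ) (M := Unit) x y w fun _ => 1

variable (κ) in
/-- The generating function of connected maps with one marked corner. -/
noncomputable def connOne (x y w : ℂ) : PowerSeries ℂ :=
  connSeries (κ := κ) (M := Unit) x y w fun _ => 1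

/-- The generating function of maps with two marked corners, weighted according to the colours of
the faces shared by the marked corners. -/
noncomputable def mapTwo (x y w : ℂ) (G : Set κ → ℂ) : PowerSeries ℂ :=
  mapSeries (M := Bool) x y w fun r => G {k | r k false true}

/-- The generating function of connected maps with two marked corners, weighted according to the
colours of the faces shared by the marked corners. -/
noncomputable def connTwo (x y w : ℂ) (G : Set κ → ℂ) : PowerSeries ℂ :=
  connSeries (M := Bool) x y w fun r => G {k | r k false true}

open scoped Classical in
/-- The weight of three marked corners, where the last two are the ends of an open edge of
colour `i` and the first one is compared with the corner which preceded this edge. -/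
noncomputable def threeWeight (i : κ) (G : Set κ → ℂ)
    (r : κ → Unit ⊕ Bool → Unit ⊕ Bool → Prop) : ℂ :=
  (if r i (Sum.inr false) (Sum.inr true) then 0 else 1) *
    G {k | r k (Sum.inr false) (Sum.inl ()) ∨ (k = i ∧ r k (Sum.inr true) (Sum.inl ()))}

open scoped Classical in
/-- The indicator of the sets of colours which do not contain `i`. -/
noncomputable def avoids (i : κ) (B : Set κ) : ℂ := if i ∈ B then 0 else 1

theorem connSeries_const {M : Type} [Fintype M] [DecidableEq M] (x y w a : ℂ) :
    connSeries (κ := κ) (M := M) x y w (fun _ => a) =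
      PowerSeries.C a * connSeries (κ := κ) (M := M) x y w fun _ => 1 := by
  ext n
  simp only [connSeries, PowerSeries.coeff_C_mul, PowerSeries.coeff_mk, connSum, mul_one,
    ← Finset.sum_mul]
  ring

theorem mapSeries_const {M : Type} [Fintype M] [DecidableEq M] (x y w a : ℂ) :
    mapSeries (κ := κ) (M := M) x y w (fun _ => a) =
      PowerSeries.C a * mapSeries (κ := κ) (M := M) x y w fun _ => 1 := by
  ext n
  simp only [mapSeries, PowerSeries.coeff_C_mul, PowerSeries.coeff_mk, mapSum, mul_one,
    ← Finset.sum_mul]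
  ring

theorem mapOne_eq (x y w : ℂ) : mapOne κ x y w = connOne κ x y w * mapZero κ x y w := by
  classical
  rw [mapOne, mapSeries_eq_sum_component x y w () (fun _ _ => 1) (fun _ _ => 1) (by simp)]
  have h : (Finset.univ.filter fun S : Finset Unit => () ∈ S) = {Finset.univ} := by
    ext S
    simp only [Finset.mem_filter, Finset.mem_univ, true_and, Finset.mem_singleton]
    revert S
    decide
  rw [h, Finset.sum_singleton]
  refine congrArg₂ (· * ·) ?_ ?_
  · exact connSeries_relabel x y w (Equiv.subtypeUnivEquiv fun _ => Finset.mem_univ _)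
      fun _ => rfl
  · have : IsEmpty {m : Unit // m ∉ (Finset.univ : Finset Unit)} := ⟨fun m => m.2 (by simp)⟩
    exact mapSeries_relabel x y w (Equiv.equivOfIsEmpty _ Empty) fun _ => rfl

/-- If the second mark is not in the component of the first, the marks share no face and the weight
is `G ∅`. -/
theorem mapTwo_eq (x y w : ℂ) (G : Set κ → ℂ) :
    mapTwo x y w G = connTwo x y w G * mapZero κ x y w +
      PowerSeries.C (G ∅) * connOne κ x y w * mapOne κ x y w := by
  classical
  rw [mapTwo, mapSeries_eq_sum_component x y w false
    (fun S s => G {k | ∃ h h', s k ⟨false, h⟩ ⟨true, h'⟩}) (fun _ _ => 1) ?_]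
  · have h : (Finset.univ.filter fun S : Finset Bool => false ∈ S) = {Finset.univ, {false}} := by
      ext S
      simp only [Finset.mem_filter, Finset.mem_univ, true_and, Finset.mem_insert,
        Finset.mem_singleton]
      revert S
      decide
    rw [h, Finset.sum_pair (by decide)]
    refine congrArg₂ (· + ·) ?_ ?_
    · refine congrArg₂ (· * ·) ?_ ?_
      · refine connSeries_relabel x y w (Equiv.subtypeUnivEquiv fun _ => Finset.mem_univ _)
          fun r => ?_
        simp only [Finset.mem_univ, exists_true_left]
        rfl
      · have : IsEmpty {m : Bool // m ∉ (Finset.univ : Finset Bool)} := ⟨fun m => m.2 (by simp)⟩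
        exact mapSeries_relabel x y w (Equiv.equivOfIsEmpty _ Empty) fun _ => rfl
    · refine congrArg₂ (· * ·) ?_ ?_
      · rw [connOne, ← connSeries_const]
        refine connSeries_relabel x y w
          (⟨fun _ => (), fun _ => ⟨false, by simp⟩, by decide, by decide⟩ :
            {m : Bool // m ∈ ({false} : Finset Bool)} ≃ Unit) fun r => ?_
        simp
      · exact mapSeries_relabel x y w
          (⟨fun _ => (), fun _ => ⟨true, by simp⟩, by decide, by decide⟩ :
            {m : Bool // m ∉ ({false} : Finset Bool)} ≃ Unit) fun r => rfl
  · intro S hS s t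
    rw [mul_one]
    congr 1
    ext k
    simp [joinRel, hS]

/-- The four terms are the possible components of `q`: everything, `{q, h}`, `{q, h'}` and `{q}`. In
the third case `q` is reached only across the open edge, through its colour `i`, which explains `B ∩
{i}`. In the last one the ends of the edge are only required not to share a face of colour `i`. -/
theorem mapThree_eq (x y w : ℂ) (i : κ) (G : Set κ → ℂ) :
    mapSeries x y w (threeWeight i G) =
      connSeries x y w (threeWeight i G) * mapZero κ x y w +
      (connTwo x y w G * mapOne κ x y w +
      (connTwo x y w (fun B => G (B ∩ {i})) * mapOne κ x y w +
      PowerSeries.C (G ∅) * connOne κ x y w * mapTwo x y w (avoids i))) := by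
  classical
  let q : Unit ⊕ Bool := Sum.inl ()
  let h : Unit ⊕ Bool := Sum.inr false
  let h' : Unit ⊕ Bool := Sum.inr true
  rw [mapSeries_eq_sum_component x y w q
    (fun S s => (if ∃ a b, s i ⟨h, a⟩ ⟨h', b⟩ then 0 else 1) *
      G {k | (∃ a b, s k ⟨h, a⟩ ⟨q, b⟩) ∨ (k = i ∧ ∃ a b, s k ⟨h', a⟩ ⟨q, b⟩)})
    (fun S s => if ∃ a b, s i ⟨h, a⟩ ⟨h', b⟩ then 0 else 1) ?_]
  · have hS : (Finset.univ.filter fun S : Finset (Unit ⊕ Bool) => q ∈ S) =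
        {Finset.univ, {q, h}, {q, h'}, {q}} := by
      ext S
      simp only [Finset.mem_filter, Finset.mem_univ, true_and, Finset.mem_insert,
        Finset.mem_singleton]
      revert S
      decide
    rw [hS, Finset.sum_insert (by decide), Finset.sum_insert (by decide),
      Finset.sum_insert (by decide), Finset.sum_singleton]
    refine congrArg₂ (· + ·) ?_ ?_
    · refine congrArg₂ (· * ·) ?_ ?_
      · refine connSeries_relabel x y w (Equiv.subtypeUnivEquiv fun _ => Finset.mem_univ _)
          fun r => ?_
        simp only [Finset.mem_univ, exists_true_left]
        rfl
      · have : IsEmpty {m : Unit ⊕ Bool // m ∉ (Finset.univ : Finset (Unit ⊕ Bool))} :=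
          ⟨fun m => m.2 (by simp)⟩
        refine mapSeries_relabel x y w (Equiv.equivOfIsEmpty _ Empty) fun _ => ?_
        simp
    refine congrArg₂ (· + ·) ?_ ?_
    · refine congrArg₂ (· * ·) ?_ ?_
      · refine connSeries_relabel x y w
          (⟨fun m => decide (m.1 = q), fun b => if b then ⟨q, by simp⟩ else ⟨h, by simp⟩,
            by decide, by decide⟩ :
            {m : Unit ⊕ Bool // m ∈ ({q, h} : Finset (Unit ⊕ Bool))} ≃ Bool) fun r => ?_
        simp [q, h, h']
      · refine mapSeries_relabel x y w
          (⟨fun _ => (), fun _ => ⟨h', by decide⟩, by decide, by decide⟩ :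
            {m : Unit ⊕ Bool // m ∉ ({q, h} : Finset (Unit ⊕ Bool))} ≃ Unit) fun r => ?_
        simp [q, h, h']
    refine congrArg₂ (· + ·) ?_ ?_
    · refine congrArg₂ (· * ·) ?_ ?_
      · refine connSeries_relabel x y w
          (⟨fun m => decide (m.1 = q), fun b => if b then ⟨q, by simp⟩ else ⟨h', by simp⟩,
            by decide, by decide⟩ :
            {m : Unit ⊕ Bool // m ∈ ({q, h'} : Finset (Unit ⊕ Bool))} ≃ Bool) fun r => ?_
        simp only [q, h, h', Equiv.coe_fn_symm_mk]
        simp [and_comm, Set.inter_def]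
      · refine mapSeries_relabel x y w
          (⟨fun _ => (), fun _ => ⟨h, by decide⟩, by decide, by decide⟩ :
            {m : Unit ⊕ Bool // m ∉ ({q, h'} : Finset (Unit ⊕ Bool))} ≃ Unit) fun r => ?_
        simp [q, h, h']
    · refine congrArg₂ (· * ·) ?_ ?_
      · rw [connOne, ← connSeries_const]
        refine connSeries_relabel x y w
          (⟨fun _ => (), fun _ => ⟨q, by simp⟩, by decide, by decide⟩ :
            {m : Unit ⊕ Bool // m ∈ ({q} : Finset (Unit ⊕ Bool))} ≃ Unit) fun r => ?_
        simp [q, h, h']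
      · refine mapSeries_relabel x y w
          (⟨fun m => decide (m.1 = h'), fun b => if b then ⟨h', by decide⟩ else ⟨h, by decide⟩,
            by decide, by decide⟩ :
            {m : Unit ⊕ Bool // m ∉ ({q} : Finset (Unit ⊕ Bool))} ≃ Bool) fun r => ?_
        simp [q, h, h', avoids]
  · intro S hS s t
    have h1 : ∀ k a, joinRel (· ∈ S) s t k a q ↔ ∃ u v, s k ⟨a, u⟩ ⟨q, v⟩ := by
      intro k a
      simp [joinRel, hS]
    have h2 : joinRel (· ∈ S) s t i h h' ↔
        (∃ a b, s i ⟨h, a⟩ ⟨h', b⟩) ∨ ∃ a b, t i ⟨h, a⟩ ⟨h', b⟩ := Iff.rfl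
    simp only [threeWeight, h1, h2, q, h, h']
    split_ifs <;> simp_all

/-- Weights need to agree only on relations that come from maps, which are for instance reflexive
and symmetric. -/
theorem mapSeries_congr {M : Type} [Fintype M] [DecidableEq M] (x y w : ℂ)
    {g g' : (κ → M → M → Prop) → ℂ}
    (h : ∀ n (c : Fin n → κ) (σ : Perm (Darts M (Fin n))), g (faceRel c σ) = g' (faceRel c σ)) :
    mapSeries x y w g = mapSeries x y w g' := by
  ext n
  simp only [mapSeries, mapSum, h]

theorem mapOne_schwingerDyson (x y : ℂ) :
    mapOne κ x y 0 = PowerSeries.C y * mapZero κ x y 0 +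
      PowerSeries.X * (PowerSeries.C x * ∑ i : κ, mapTwo x y 0 (avoids i)) := by
  classical
  have h0 : mapOne κ x y 0 = mapSeries (κ := κ) (M := Option Empty) x y 0 fun _ => 1 :=
    mapSeries_relabel x y 0 ⟨fun _ => none, fun _ => (), by decide, by decide⟩ fun _ => rfl
  rw [h0, mapSeries_option x y (fun _ => 1)
    (fun i r => avoids i {k | r k (Sum.inr false) (Sum.inr true)}) ?_]
  · simp only [Finset.univ_eq_empty, Finset.sum_empty, zero_add]
    congr 3
    refine Finset.sum_congr rfl fun i _ => ?_
    exact mapSeries_relabel x y 0 (Equiv.emptySum Empty Bool) fun _ => rfl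
  · intro i b n
    simp [mapSum, openWeight, avoids]

/-- The removed mark is either alone at its vertex, sharing no face, or just before the other mark,
sharing the faces of all colours, or just before an edge. -/
theorem mapTwo_schwingerDyson (x y : ℂ) (G : Set κ → ℂ) :
    mapTwo x y 0 G = PowerSeries.C (y * G ∅) * mapOne κ x y 0 +
      (PowerSeries.C (G Set.univ) * mapOne κ x y 0 +
      PowerSeries.X * (PowerSeries.C x * ∑ i : κ, mapSeries x y 0 (threeWeight i G))) := by
  classical
  have h0 : mapTwo x y 0 G = mapSeries (κ := κ) (M := Option Unit) x y 0
      fun r => G {k | r k none (some ())} :=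
    mapSeries_relabel x y 0 ⟨fun b => if b then some () else none, fun m => m.isSome,
      by decide, by decide⟩ fun _ => rfl
  have hG : mapSeries (κ := κ) x y 0 ((fun r : κ → Option Unit → Option Unit → Prop =>
      G {k | r k none (some ())}) ∘ relSome ()) = PowerSeries.C (G Set.univ) * mapOne κ x y 0 := by
    rw [mapOne, ← mapSeries_const]
    refine mapSeries_congr x y 0 fun n c σ => ?_
    exact congrArg G (Set.eq_univ_of_forall fun k => SameCycle.refl _ _)
  have hE : mapSeries (κ := κ) x y 0 ((fun r : κ → Option Unit → Option Unit → Prop =>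
      G {k | r k none (some ())}) ∘ relNone) = PowerSeries.C (G ∅) * mapOne κ x y 0 := by
    rw [mapOne, ← mapSeries_const]
    refine mapSeries_congr x y 0 fun n c σ => ?_
    simp [relNone]
  rw [h0, mapSeries_option x y _ (fun i => threeWeight i G) ?_, hE, Finset.univ_unique,
    Finset.sum_singleton, hG, map_mul, mul_assoc]
  intro i b n
  -- The removed mark is represented by the end `b` of the edge and, in colour `i`, also by the
  -- other end, since closing the edge merges their faces.
  have hb : mapSum x y 0 (Fin n) (openWeight (fun r : κ → Option Unit → Option Unit → Prop =>
      G {k | r k none (some ())}) i b) = mapSum x y 0 (Fin n)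
      (fun r : κ → Unit ⊕ Bool → Unit ⊕ Bool → Prop =>
        (if r i (Sum.inr b) (Sum.inr (!b)) then 0 else 1) *
        G {k | r k (Sum.inr b) (Sum.inl ()) ∨ (k = i ∧ r k (Sum.inr (!b)) (Sum.inl ()))}) := by
    refine Finset.sum_congr rfl fun c _ => Finset.sum_congr rfl fun σ _ => congrArg _ ?_
    have hs : faceRel c σ i (Sum.inr b) (Sum.inr (!b)) ↔
        faceRel c σ i (Sum.inr false) (Sum.inr true) := by
      rcases b with _ | _
      · exact Iff.rfl
      · exact sameCycle_comm
    rw [openWeight]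
    beta_reduce
    by_cases hr : faceRel c σ i (Sum.inr false) (Sum.inr true)
    · rw [if_pos hr, if_pos (hs.mpr hr), zero_mul, zero_mul]
    · rw [if_neg hr, if_neg (mt hs.mp hr), one_mul, one_mul]
      refine congrArg G (Set.ext fun k => ?_)
      have h1 : ∀ m, faceRel c σ k m m := fun m => SameCycle.refl _ _
      have h2 : k = i → ¬ faceRel c σ k (Sum.inr false) (Sum.inr true) := fun hk => hk ▸ hr
      have h3 : k = i → ¬ faceRel c σ k (Sum.inr true) (Sum.inr false) :=
        fun hk h => h2 hk h.symm
      rcases b with _ | _ <;> simp only [relOpen, openMark, Set.mem_ofPred_eq, Bool.not_false,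
        Bool.not_true, h1] <;> tauto
  rw [hb]
  rcases b with _ | _
  · rfl
  -- Exchanging the names of the two ends reduces `b = true` to `b = false`.
  · refine mapSum_relabel x y 0 (Equiv.sumCongr (Equiv.refl Unit) Equiv.boolNot)
      (Equiv.refl _) fun r => ?_
    simp [threeWeight]

end FewMarks

end QuarticTensor

namespace QuarticTensor

open Equiv Equiv.Perm

/-! ### Leading orders of the generating functions of connected maps -/

section LeadingOrder

set_option linter.unusedSectionVars false

variable {κ M : Type} [Fintype κ] [DecidableEq κ] [Fintype M] [DecidableEq M]

open scoped Classical in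
/-- The generating function of connected maps, as a power series whose coefficients are polynomials
in the variable which counts the independent cycles of a map. -/
noncomputable def connPoly (w : ℂ) (g : (κ → M → M → Prop) → ℂ) : PowerSeries (Polynomial ℂ) :=
  PowerSeries.mk fun n => Polynomial.C ((2 ^ n * n.factorial : ℂ)⁻¹) *
    ∑ c : Fin n → κ, ∑ σ : Perm (Darts M (Fin n)) with IsConnected σ,
      Polynomial.X ^ (n + 1 - cyc σ) * Polynomial.C (w ^ excess c σ * g (faceRel c σ))

/-- A connected map has at most `n + 1` vertices, so the truncated exponent is exact and `x * x ^ n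
* x⁻¹ ^ V` is a power of `x`. -/
theorem map_eval_connPoly {x : ℂ} (hx : x ≠ 0) (w : ℂ) (g : (κ → M → M → Prop) → ℂ) :
    PowerSeries.map (Polynomial.evalRingHom x) (connPoly w g) =
      PowerSeries.C x * connSeries x x⁻¹ w g := by
  classical
  ext n
  rw [PowerSeries.coeff_map, PowerSeries.coeff_C_mul, connPoly, connSeries, PowerSeries.coeff_mk,
    PowerSeries.coeff_mk, connSum, map_mul, Polynomial.coe_evalRingHom, Polynomial.eval_C,
    div_eq_inv_mul, mul_left_comm, Polynomial.eval_finsetSum]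
  refine congrArg _ ?_
  rw [Finset.mul_sum]
  refine Finset.sum_congr rfl fun c _ => ?_
  rw [Polynomial.eval_finsetSum, Finset.mul_sum]
  refine Finset.sum_congr rfl fun σ hσ => ?_
  have h := excess_add_cyc_le c (Finset.mem_filter.mp hσ).2
  rw [Fintype.card_fin] at h
  simp only [Polynomial.eval_mul, Polynomial.eval_pow, Polynomial.eval_X, Polynomial.eval_C,
    mapWeight, Fintype.card_fin]
  have hp : x ^ (n + 1 - cyc σ) = x ^ (n + 1) * x⁻¹ ^ cyc σ := by
    rw [pow_sub₀ _ hx (by omega), inv_pow]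
  rw [hp]
  ring

/-- The equations are derived for `x ≠ 0` with `y = x⁻¹`; this transfers them to polynomials, where
`x = 0` becomes accessible. -/
theorem powerSeries_polynomial_ext {f g : PowerSeries (Polynomial ℂ)}
    (h : ∀ x : ℂ, x ≠ 0 → PowerSeries.map (Polynomial.evalRingHom x) f =
      PowerSeries.map (Polynomial.evalRingHom x) g) : f = g := by
  ext1 n
  refine Polynomial.eq_of_infinite_eval_eq _ _ (Set.Infinite.mono (s := {0}ᶜ) ?_
    (Set.finite_singleton (0 : ℂ)).infinite_compl)
  intro x hx
  have := congrArg (PowerSeries.coeff n) (h x hx)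
  rwa [PowerSeries.coeff_map, PowerSeries.coeff_map] at this

variable (κ) in
/-- The two-point function of maps, with the cycles counted by a polynomial variable. -/
noncomputable def polyOne : PowerSeries (Polynomial ℂ) :=
  connPoly (κ := κ) (M := Unit) 0 fun _ => 1

/-- The generating function of connected maps with two marked corners, with the cycles counted by a
polynomial variable. -/
noncomputable def polyTwo (G : Set κ → ℂ) : PowerSeries (Polynomial ℂ) :=
  connPoly (M := Bool) 0 fun r => G {k | r k false true}

variable (κ) in
theorem constantCoeff_mapZero (x y w : ℂ) :
    PowerSeries.constantCoeff (mapZero κ x y w) = 1 := by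
  have hu : ∀ (c : Fin 0 → κ) (σ : Perm (Darts Empty (Fin 0))), mapWeight x y w c σ = 1 := by
    intro c σ
    have he : excess c σ = 0 := by simp [excess, cyc_of_isEmpty]
    rw [mapWeight, he, cyc_of_isEmpty]
    simp
  rw [← PowerSeries.coeff_zero_eq_constantCoeff_apply, mapZero, mapSeries, PowerSeries.coeff_mk,
    mapSum]
  simp [hu]

variable (κ) in
theorem mapZero_ne_zero (x y w : ℂ) : mapZero κ x y w ≠ 0 := by
  intro h
  have := constantCoeff_mapZero κ x y w
  rw [h, map_zero] at this
  exact zero_ne_one this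

/-- Every term of the Schwinger–Dyson equation contains the factor `mapZero`, which is nonzero and
can be cancelled. -/
theorem connOne_eq (x y : ℂ) : connOne κ x y 0 = PowerSeries.C y +
    PowerSeries.X * (PowerSeries.C x *
      ∑ i : κ, (connTwo x y 0 (avoids i) + connOne κ x y 0 ^ 2)) := by
  have h := mapOne_schwingerDyson (κ := κ) x y
  have ha : ∀ i : κ, avoids i ∅ = 1 := fun i => by simp [avoids]
  simp only [mapTwo_eq, mapOne_eq, ha, map_one] at h
  refine mul_right_cancel₀ (mapZero_ne_zero κ x y 0) (h.trans ?_)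
  have hs : ∑ i : κ, (connTwo x y 0 (avoids i) * mapZero κ x y 0 +
      1 * connOne κ x y 0 * (connOne κ x y 0 * mapZero κ x y 0)) =
      (∑ i : κ, (connTwo x y 0 (avoids i) + connOne κ x y 0 ^ 2)) * mapZero κ x y 0 := by
    rw [Finset.sum_mul]
    exact Finset.sum_congr rfl fun i _ => by ring
  rw [hs]
  ring

/-- The disconnected terms, those with `G ∅`, form a multiple of the one-mark equation and drop out.
-/
theorem connTwo_eq (x y : ℂ) (G : Set κ → ℂ) : connTwo x y 0 G =
    PowerSeries.C (G Set.univ) * connOne κ x y 0 + PowerSeries.X * (PowerSeries.C x *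
      ∑ i : κ, (connSeries x y 0 (threeWeight i G) + connTwo x y 0 G * connOne κ x y 0 +
        connTwo x y 0 (fun B => G (B ∩ {i})) * connOne κ x y 0)) := by
  have h := mapTwo_schwingerDyson (κ := κ) x y G
  have ha : ∀ i : κ, avoids i ∅ = 1 := fun i => by simp [avoids]
  simp only [mapThree_eq, mapTwo_eq, mapOne_eq, ha, map_one, one_mul, map_mul] at h
  have h1 := connOne_eq (κ := κ) x y
  refine mul_right_cancel₀ (mapZero_ne_zero κ x y 0) ?_
  have hs : ∑ i : κ, (connSeries x y 0 (threeWeight i G) * mapZero κ x y 0 +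
      (connTwo x y 0 G * (connOne κ x y 0 * mapZero κ x y 0) +
      (connTwo x y 0 (fun B => G (B ∩ {i})) * (connOne κ x y 0 * mapZero κ x y 0) +
      PowerSeries.C (G ∅) * connOne κ x y 0 * (connTwo x y 0 (avoids i) * mapZero κ x y 0 +
        connOne κ x y 0 * (connOne κ x y 0 * mapZero κ x y 0))))) =
      (∑ i : κ, (connSeries x y 0 (threeWeight i G) + connTwo x y 0 G * connOne κ x y 0 +
        connTwo x y 0 (fun B => G (B ∩ {i})) * connOne κ x y 0)) * mapZero κ x y 0 +
      PowerSeries.C (G ∅) * connOne κ x y 0 * mapZero κ x y 0 *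
        ∑ i : κ, (connTwo x y 0 (avoids i) + connOne κ x y 0 ^ 2) := by
    rw [Finset.sum_mul, Finset.mul_sum, ← Finset.sum_add_distrib]
    exact Finset.sum_congr rfl fun i _ => by ring
  rw [hs] at h
  linear_combination h - PowerSeries.C (G ∅) * connOne κ x y 0 * mapZero κ x y 0 * h1

/-- Multiplication by `x` normalizes each connected factor. The quadratic term uses up all powers of
`x`; in the other term the edge closes a cycle and one `x` is left over. -/
theorem polyOne_eq : polyOne κ = 1 + PowerSeries.X * ∑ i : κ,
    (PowerSeries.C Polynomial.X * polyTwo (avoids i) + polyOne κ ^ 2) := by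
  refine powerSeries_polynomial_ext fun x hx => ?_
  simp only [map_add, map_one, map_mul, map_sum, map_pow, PowerSeries.map_X, PowerSeries.map_C,
    polyOne, polyTwo, map_eval_connPoly hx, Polynomial.coe_evalRingHom, Polynomial.eval_X]
  have h := congrArg (PowerSeries.C x * ·) (connOne_eq (κ := κ) x x⁻¹)
  simp only [connOne, connTwo, mul_add, ← map_mul, mul_inv_cancel₀ hx, map_one] at h
  refine h.trans (congrArg _ ?_)
  simp only [Finset.mul_sum, mul_add]
  refine Finset.sum_congr rfl fun i _ => ?_
  ring

/-- The term with three marks keeps a spare `x`, so it disappears at `x = 0` and the system closes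
there. -/
theorem polyTwo_eq (G : Set κ → ℂ) : polyTwo G = PowerSeries.C (Polynomial.C (G Set.univ)) *
    polyOne κ + PowerSeries.X * ∑ i : κ,
      (PowerSeries.C Polynomial.X * connPoly 0 (threeWeight i G) +
      polyTwo G * polyOne κ + polyTwo (fun B => G (B ∩ {i})) * polyOne κ) := by
  refine powerSeries_polynomial_ext fun x hx => ?_
  simp only [map_add, map_mul, map_sum, PowerSeries.map_X, PowerSeries.map_C,
    polyOne, polyTwo, map_eval_connPoly hx, Polynomial.coe_evalRingHom, Polynomial.eval_X,
    Polynomial.eval_C]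
  have h := congrArg (PowerSeries.C x * ·) (connTwo_eq (κ := κ) x x⁻¹ G)
  simp only [connOne, connTwo] at h
  refine h.trans ((mul_add _ _ _).trans (congrArg₂ _ (by ring) ?_))
  simp only [Finset.mul_sum, mul_add]
  refine Finset.sum_congr rfl fun i _ => ?_
  ring

/-! ### Value and first derivative at `x = 0` -/

/-- The coefficientwise evaluation at zero. -/
noncomputable def atZero : PowerSeries (Polynomial ℂ) →+* PowerSeries ℂ :=
  PowerSeries.map (Polynomial.evalRingHom 0)

/-- The coefficientwise linear term. -/
noncomputable def linearTerm (f : PowerSeries (Polynomial ℂ)) : PowerSeries ℂ :=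
  PowerSeries.mk fun n => (PowerSeries.coeff n f).coeff 1

theorem linearTerm_add (f g : PowerSeries (Polynomial ℂ)) :
    linearTerm (f + g) = linearTerm f + linearTerm g := by
  ext n
  simp [linearTerm]

theorem linearTerm_sum {ι : Type*} (s : Finset ι) (f : ι → PowerSeries (Polynomial ℂ)) :
    linearTerm (∑ i ∈ s, f i) = ∑ i ∈ s, linearTerm (f i) := by
  ext n
  simp [linearTerm, map_sum, Polynomial.finsetSum_coeff]

theorem linearTerm_mul (f g : PowerSeries (Polynomial ℂ)) :
    linearTerm (f * g) = atZero f * linearTerm g + linearTerm f * atZero g := by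
  ext n
  simp only [linearTerm, atZero, PowerSeries.coeff_mk, PowerSeries.coeff_mul, map_add,
    Polynomial.finsetSum_coeff, Polynomial.mul_coeff_one, PowerSeries.coeff_map,
    Finset.sum_add_distrib, Polynomial.coe_evalRingHom, Polynomial.coeff_zero_eq_eval_zero]

theorem linearTerm_one : linearTerm 1 = 0 := by
  ext n
  simp only [linearTerm, PowerSeries.coeff_mk, PowerSeries.coeff_one]
  split_ifs <;> simp [Polynomial.coeff_one]

theorem linearTerm_X : linearTerm PowerSeries.X = 0 := by
  ext n
  simp only [linearTerm, PowerSeries.coeff_mk, PowerSeries.coeff_X]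
  split_ifs <;> simp [Polynomial.coeff_one]

theorem linearTerm_C_X : linearTerm (PowerSeries.C Polynomial.X) = 1 := by
  ext n
  simp only [linearTerm, PowerSeries.coeff_mk, PowerSeries.coeff_C, PowerSeries.coeff_one]
  split_ifs <;> simp

theorem atZero_polyOne_eq : atZero (polyOne κ) = 1 + (Fintype.card κ : PowerSeries ℂ) *
    PowerSeries.X * atZero (polyOne κ) ^ 2 := by
  have h := congrArg atZero (polyOne_eq (κ := κ))
  simp only [atZero, map_add, map_one, map_mul, map_sum, map_pow, PowerSeries.map_X,
    PowerSeries.map_C, Polynomial.coe_evalRingHom, Polynomial.eval_X, map_zero, zero_mul, zero_add,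
    Finset.sum_const, Finset.card_univ, nsmul_eq_mul] at h ⊢
  rw [mul_left_comm, ← mul_assoc] at h
  exact h

/-- A recursion on trees: the second mark is on the near side of the removed edge, or behind it, and
then only the colour `i` of the edge can still be shared. -/
theorem atZero_polyTwo_eq (G : Set κ → ℂ) : atZero (polyTwo G) =
    PowerSeries.C (G Set.univ) * atZero (polyOne κ) + PowerSeries.X * ∑ i : κ,
      (atZero (polyTwo G) + atZero (polyTwo fun B => G (B ∩ {i}))) * atZero (polyOne κ) := by
  have h := congrArg atZero (polyTwo_eq G)
  simp only [atZero, map_add, map_mul, map_sum, PowerSeries.map_X,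
    PowerSeries.map_C, Polynomial.coe_evalRingHom, Polynomial.eval_X, map_zero, zero_mul, zero_add,
    Polynomial.eval_C, add_mul] at h ⊢
  exact h

/-- In a map with one independent cycle, the root edge either belongs to the cycle or separates two
parts, one of which contains it. -/
theorem linearTerm_polyOne_eq : linearTerm (polyOne κ) = PowerSeries.X * ∑ i : κ,
    (atZero (polyTwo (avoids i)) + 2 * atZero (polyOne κ) * linearTerm (polyOne κ)) := by
  have h := congrArg linearTerm (polyOne_eq (κ := κ))
  have h0 : atZero (PowerSeries.X) = PowerSeries.X := PowerSeries.map_X _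
  have h1 : atZero (PowerSeries.C Polynomial.X) = 0 := by
    rw [atZero, PowerSeries.map_C, Polynomial.coe_evalRingHom, Polynomial.eval_X, map_zero]
  simp only [linearTerm_add, linearTerm_one, linearTerm_mul, linearTerm_X, linearTerm_C_X,
    linearTerm_sum, zero_mul, add_zero, zero_add, one_mul, h0, h1, pow_two] at h
  rw [h]
  refine congrArg _ (Finset.sum_congr rfl fun i _ => ?_)
  rw [← h]
  ring

end LeadingOrder

end QuarticTensor

namespace QuarticTensor

/-! ### The explicit generating functions -/

section ExplicitSeries

open PowerSeries

theorem constantCoeff_sqrtSeries (D : ℕ) : constantCoeff (sqrtSeries D) = 1 := by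
  rw [← coeff_zero_eq_constantCoeff_apply, sqrtSeries, coeff_rescale, binomialSeries_coeff]
  simp

theorem sqrtSeries_eq {D : ℕ} (hD : 1 ≤ D) :
    sqrtSeries D = 1 - 2 * (D : PowerSeries ℂ) * X * treeSeries D := by
  have h := two_mul_treeSeries D hD
  have hc : (C (2 * D : ℂ) : PowerSeries ℂ) = 2 * (D : PowerSeries ℂ) := by
    rw [map_mul, map_ofNat, map_natCast]
  rw [hc] at h
  rw [h]
  ring

theorem sqrtSeries_sq' (D : ℕ) : sqrtSeries D ^ 2 = 1 - 4 * (D : PowerSeries ℂ) * X := by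
  rw [sqrtSeries_sq, map_mul, map_ofNat, map_natCast]

/-- Substituting `1 - 2 D z T` for the square root in its defining quadratic relation, then
cancelling `4 D z`. -/
theorem treeSeries_eq {D : ℕ} (hD : 1 ≤ D) :
    treeSeries D = 1 + (D : PowerSeries ℂ) * X * treeSeries D ^ 2 := by
  have h1 := sqrtSeries_sq' D
  rw [sqrtSeries_eq hD] at h1
  have h4 : (4 * (D : PowerSeries ℂ) * X) ≠ 0 := by
    refine mul_ne_zero ?_ X_ne_zero
    rw [← map_natCast (C (R := ℂ)), ← map_ofNat (C (R := ℂ)) 4, ← map_mul, Ne,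
      ← map_zero (C (R := ℂ)), C_injective.eq_iff]
    exact mul_ne_zero (by norm_num) (by exact_mod_cast (by omega : D ≠ 0))
  refine mul_left_cancel₀ h4 ?_
  linear_combination (-1 : PowerSeries ℂ) * h1

theorem ne_zero_of_constantCoeff {f : PowerSeries ℂ} (h : constantCoeff f ≠ 0) : f ≠ 0 :=
  fun h0 => h (by rw [h0, map_zero])

/-- The difference of two solutions is annihilated by a series with constant term `1`. -/
theorem eq_treeSeries {D : ℕ} (hD : 1 ≤ D) {f : PowerSeries ℂ}
    (h : f = 1 + (D : PowerSeries ℂ) * X * f ^ 2) : f = treeSeries D := by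
  have h2 := treeSeries_eq hD
  have h3 : (1 - (D : PowerSeries ℂ) * X * (f + treeSeries D)) ≠ 0 :=
    ne_zero_of_constantCoeff (by simp)
  refine sub_eq_zero.mp ((mul_eq_zero.mp ?_).resolve_right h3)
  linear_combination h - h2

theorem eq_fourPointFormula {D : ℕ} {f : PowerSeries ℂ}
    (h : f * (sqrtSeries D * (1 - X * treeSeries D ^ 2)) =
      (D : PowerSeries ℂ) * ((D : PowerSeries ℂ) - 1) * X ^ 2 * treeSeries D ^ 5) :
    f = fourPointFormula D := by
  rw [fourPointFormula, PowerSeries.eq_mul_inv_iff_mul_eq (by simp [constantCoeff_sqrtSeries]), h]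
  simp

theorem eq_twoPointFormula {D : ℕ} {f : PowerSeries ℂ}
    (h : f * (sqrtSeries D ^ 2 * (1 - X * treeSeries D ^ 2)) =
      (D : PowerSeries ℂ) * ((D : PowerSeries ℂ) - 1) * X ^ 2 * treeSeries D ^ 3) :
    f = twoPointFormula D := by
  rw [twoPointFormula, ← sqrtSeries_sq,
    PowerSeries.eq_mul_inv_iff_mul_eq (by simp [constantCoeff_sqrtSeries]), h]
  simp

section Maps

variable {κ : Type} [Fintype κ] [DecidableEq κ] {D : ℕ}

theorem atZero_polyOne (hκ : Fintype.card κ = D) (hD : 1 ≤ D) :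
    atZero (polyOne κ) = treeSeries D :=
  eq_treeSeries hD (hκ ▸ atZero_polyOne_eq)

theorem atZero_polyTwo_one (hκ : Fintype.card κ = D) (hD : 1 ≤ D) :
    atZero (polyTwo fun _ : Set κ => 1) * sqrtSeries D = treeSeries D := by
  have h := atZero_polyTwo_eq (fun _ : Set κ => 1)
  rw [atZero_polyOne hκ hD, Finset.sum_const, Finset.card_univ, hκ, nsmul_eq_mul, map_one] at h
  rw [sqrtSeries_eq hD]
  linear_combination h

/-- Crossing an edge of colour `i` preserves the constraint `avoids i`; crossing one of the `D - 1`
other colours makes it automatic. -/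
theorem atZero_polyTwo_avoids (hκ : Fintype.card κ = D) (hD : 1 ≤ D) (i : κ) :
    atZero (polyTwo (avoids i)) * (sqrtSeries D * (1 - X * treeSeries D ^ 2)) =
      ((D : PowerSeries ℂ) - 1) * X * treeSeries D ^ 3 := by
  have h := atZero_polyTwo_eq (avoids i)
  have h1 := atZero_polyTwo_one hκ hD
  have hu : avoids i (Set.univ : Set κ) = 0 := by simp [avoids]
  have hi : (fun B : Set κ => avoids i (B ∩ {i})) = avoids i := by
    funext B
    by_cases hB : i ∈ B <;> simp [avoids, hB]
  have hj : ∀ j ≠ i, (fun B : Set κ => avoids i (B ∩ {j})) = fun _ => 1 := by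
    intro j hj
    funext B
    simp [avoids, hj.symm]
  rw [hu, map_zero, zero_mul, zero_add, atZero_polyOne hκ hD,
    ← Finset.add_sum_erase _ _ (Finset.mem_univ i), hi,
    Finset.sum_congr rfl fun j hjm => by rw [hj j (Finset.ne_of_mem_erase hjm)],
    Finset.sum_const, Finset.card_erase_of_mem (Finset.mem_univ i), Finset.card_univ, hκ,
    nsmul_eq_mul, Nat.cast_sub hD, Nat.cast_one] at h
  have hT := treeSeries_eq hD
  -- The recursion has the factor `1 - (D + 1) z T`, which multiplication by `T` turns into `1 - z T
  -- ^ 2`.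
  linear_combination sqrtSeries D * treeSeries D * h +
    ((D : PowerSeries ℂ) - 1) * X * treeSeries D ^ 2 * h1 -
    sqrtSeries D * atZero (polyTwo (avoids i)) * hT

theorem linearTerm_polyOne (hκ : Fintype.card κ = D) (hD : 1 ≤ D) :
    linearTerm (polyOne κ) = twoPointFormula D := by
  apply eq_twoPointFormula
  have h := linearTerm_polyOne_eq (κ := κ)
  rw [atZero_polyOne hκ hD] at h
  have h2 : linearTerm (polyOne κ) * sqrtSeries D = X * ∑ i : κ, atZero (polyTwo (avoids i)) := by
    rw [Finset.sum_add_distrib, Finset.sum_const, Finset.card_univ, hκ, nsmul_eq_mul] at h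
    rw [sqrtSeries_eq hD]
    linear_combination h
  have h3 : (∑ i : κ, atZero (polyTwo (avoids i))) *
      (sqrtSeries D * (1 - X * treeSeries D ^ 2)) =
      (D : PowerSeries ℂ) * (((D : PowerSeries ℂ) - 1) * X * treeSeries D ^ 3) := by
    rw [Finset.sum_mul, Finset.sum_congr rfl fun i _ => atZero_polyTwo_avoids hκ hD i,
      Finset.sum_const, Finset.card_univ, hκ, nsmul_eq_mul]
  linear_combination sqrtSeries D * (1 - X * treeSeries D ^ 2) * h2 + X * h3

-- Crossing an edge of colour `i` relaxes "no shared colour" to `avoids i`. As `T (1 - D z T) = 1`,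
-- the series is `z T ^ 2` times the sum over `i` of those of `avoids i`.
open scoped Classical in
theorem atZero_polyTwo_empty (hκ : Fintype.card κ = D) (hD : 1 ≤ D) :
    atZero (polyTwo fun B : Set κ => if B = ∅ then 1 else 0) = fourPointFormula D := by
  apply eq_fourPointFormula
  have hne : Nonempty κ := Fintype.card_pos_iff.mp (by omega)
  have h := atZero_polyTwo_eq (fun B : Set κ => if B = ∅ then (1 : ℂ) else 0)
  have hi : ∀ i : κ, (fun B : Set κ => if B ∩ {i} = ∅ then (1 : ℂ) else 0) = avoids i := by
    intro i
    funext B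
    by_cases hB : i ∈ B <;> simp [avoids, hB]
  have hu : (Set.univ : Set κ) ≠ ∅ := Set.univ_nonempty.ne_empty
  simp only [hi, if_neg hu, map_zero, zero_mul, zero_add, ← Finset.sum_mul] at h
  rw [atZero_polyOne hκ hD, Finset.sum_add_distrib, Finset.sum_const, Finset.card_univ, hκ,
    nsmul_eq_mul] at h
  have h3 : (∑ i : κ, atZero (polyTwo (avoids i))) *
      (sqrtSeries D * (1 - X * treeSeries D ^ 2)) =
      (D : PowerSeries ℂ) * (((D : PowerSeries ℂ) - 1) * X * treeSeries D ^ 3) := by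
    rw [Finset.sum_mul, Finset.sum_congr rfl fun i _ => atZero_polyTwo_avoids hκ hD i,
      Finset.sum_const, Finset.card_univ, hκ, nsmul_eq_mul]
  have hT := treeSeries_eq hD
  linear_combination treeSeries D * (sqrtSeries D * (1 - X * treeSeries D ^ 2)) * h +
    X * treeSeries D ^ 2 * h3 - atZero (polyTwo fun B : Set κ => if B = ∅ then (1 : ℂ) else 0) *
      (sqrtSeries D * (1 - X * treeSeries D ^ 2)) * hT

end Maps

/-! ### Enumeration of the multicoloured chains -/

theorem card_multicoloredChains_succ (D k : ℕ) :
    ((multicoloredChains D (k + 1)).card : ℂ) = (D : ℂ) ^ (k + 1) - D := by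
  classical
  have h : (multicoloredChains D (k + 1)).card + D = D ^ (k + 1) := by
    have h1 := Finset.card_filter_add_card_filter_not
      (s := (Finset.univ : Finset (Fin (k + 1) → Fin D))) fun w => ∃ i j, w i ≠ w j
    rw [Finset.card_univ, Fintype.card_fun, Fintype.card_fin, Fintype.card_fin] at h1
    rw [multicoloredChains, ← h1]
    congr 1
    -- The excluded words are the constant ones; there are exactly `D` of them because the length is
    -- positive.
    have h2 : (Finset.univ.filter fun w : Fin (k + 1) → Fin D => ¬ ∃ i j, w i ≠ w j) =
        Finset.univ.map ⟨fun c : Fin D => fun _ => c, fun a b hab => congrFun hab 0⟩ := by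
      ext w
      simp only [Finset.mem_filter, Finset.mem_univ, true_and, not_exists, not_not,
        Finset.mem_map]
      constructor
      · exact fun hw => ⟨w 0, funext fun i => hw 0 i⟩
      · rintro ⟨c, rfl⟩ i j
        rfl
    rw [h2, Finset.card_map, Finset.card_univ, Fintype.card_fin]
  rw [eq_sub_iff_add_eq]
  exact_mod_cast h

theorem card_multicoloredChains_zero (D : ℕ) : (multicoloredChains D 0).card = 0 := by
  rw [Finset.card_eq_zero, multicoloredChains, Finset.filter_eq_empty_iff]
  rintro w - ⟨i, -⟩
  exact i.elim0

/-- Coefficients of a geometric series. -/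
theorem coeff_sum_geom (q : ℂ) (T : PowerSeries ℂ) (f : PowerSeries ℂ)
    (hf : f * (1 - C q * (X * T ^ 2)) = T ^ 2) (n : ℕ) :
    ∑ k ∈ Finset.range (n + 1), q ^ k * coeff n (X ^ k * T ^ (2 * (k + 1))) = coeff n f := by
  have h1 := geom_sum_mul_neg (C q * (X * T ^ 2)) (n + 1)
  have h2 : f - ∑ k ∈ Finset.range (n + 1), C (q ^ k) * (X ^ k * T ^ (2 * (k + 1))) =
      X ^ (n + 1) * (C q ^ (n + 1) * T ^ (2 * (n + 1)) * f) := by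
    have h3 : ∑ k ∈ Finset.range (n + 1), C (q ^ k) * (X ^ k * T ^ (2 * (k + 1))) =
        T ^ 2 * ∑ k ∈ Finset.range (n + 1), (C q * (X * T ^ 2)) ^ k := by
      rw [Finset.mul_sum]
      refine Finset.sum_congr rfl fun k _ => ?_
      rw [map_pow]
      ring
    rw [h3]
    linear_combination (∑ k ∈ Finset.range (n + 1), (C q * (X * T ^ 2)) ^ k) * hf - f * h1
  have h4 := congrArg (coeff n) h2
  rw [coeff_X_pow_mul', if_neg (by omega), map_sub, map_sum, sub_eq_zero] at h4
  rw [h4]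
  exact Finset.sum_congr rfl fun k _ => (coeff_C_mul _ _ _).symm

/-- For `k ≥ 1` there are `D ^ k - D` chains, hence a difference of geometric series of ratios `D z
T ^ 2` and `z T ^ 2`. The term `(D - 1) T ^ 2` in `hsum` removes their `k = 0` terms. -/
theorem multicoloredChainSeries_eq {D : ℕ} (hD : 1 ≤ D) :
    multicoloredChainSeries D = fourPointFormula D := by
  have hT := treeSeries_eq hD
  set T := treeSeries D with hTdef
  have hgeom : ∀ q : ℂ, T ^ 2 * (1 - C q * (X * T ^ 2))⁻¹ * (1 - C q * (X * T ^ 2)) = T ^ 2 := by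
    intro q
    rw [mul_assoc, PowerSeries.inv_mul_cancel _ (by simp), mul_one]
  set A := T ^ 2 * (1 - C (D : ℂ) * (X * T ^ 2))⁻¹ with hA
  set B := T ^ 2 * (1 - C (1 : ℂ) * (X * T ^ 2))⁻¹ with hB
  have hA' : A * (1 - (D : PowerSeries ℂ) * (X * T ^ 2)) = T ^ 2 := by
    have := hgeom D
    rwa [← hA, map_natCast] at this
  have hB' : B * (1 - X * T ^ 2) = T ^ 2 := by
    have := hgeom 1
    rwa [← hB, map_one, one_mul] at this
  have hsum : multicoloredChainSeries D = A - (D : PowerSeries ℂ) * B +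
      ((D : PowerSeries ℂ) - 1) * T ^ 2 := by
    ext n
    have hDC : (D : PowerSeries ℂ) = C (D : ℂ) := (map_natCast C D).symm
    have hD1 : (D : PowerSeries ℂ) - 1 = C ((D : ℂ) - 1) := by rw [map_sub, map_one, hDC]
    rw [multicoloredChainSeries, coeff_mk, map_add, map_sub, hD1, hDC, coeff_C_mul, coeff_C_mul,
      ← coeff_sum_geom D T A (hgeom D) n, ← coeff_sum_geom 1 T B (hgeom 1) n,
      Finset.sum_range_succ', Finset.sum_range_succ', Finset.sum_range_succ']
    simp only [Finset.sum_const, nsmul_eq_mul, card_multicoloredChains_succ,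
      card_multicoloredChains_zero, one_pow, one_mul, pow_zero, sub_mul, Finset.sum_sub_distrib,
      ← Finset.mul_sum, Nat.cast_zero, zero_mul, mul_add, zero_add, mul_one, add_zero]
    ring
  apply eq_fourPointFormula
  rw [← hTdef]
  have hs := sqrtSeries_eq hD
  rw [← hTdef] at hs
  have hTne : T ≠ 0 := by
    intro h0
    rw [h0] at hT
    simp at hT
  refine mul_left_cancel₀ hTne ?_
  -- The square root enters through the denominator of the series of all chains.
  have hTs : T * sqrtSeries D = 1 - (D : PowerSeries ℂ) * (X * T ^ 2) := by
    rw [hs]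
    linear_combination hT
  have e1 : T * (multicoloredChainSeries D * (sqrtSeries D * (1 - X * T ^ 2))) =
      multicoloredChainSeries D * ((1 - (D : PowerSeries ℂ) * (X * T ^ 2)) * (1 - X * T ^ 2)) := by
    rw [← hTs]
    ring
  rw [e1, hsum]
  linear_combination (1 - X * T ^ 2) * hA' -
    (D : PowerSeries ℂ) * (1 - (D : PowerSeries ℂ) * (X * T ^ 2)) * hB'

end ExplicitSeries

end QuarticTensor

namespace QuarticTensor

open MeasureTheory

/-! ### Gaussian moments -/

section Wick

theorem integral_gaussian_mul_pow (α : ℝ) (hα : 0 < α) (j : ℕ) :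
    ∫ z : ℂ, ((Real.exp (-(α * ‖z‖ ^ 2)) : ℝ) : ℂ) * (z ^ j * starRingEnd ℂ z ^ j) =
      (Real.pi / α) * (j.factorial / (α : ℂ) ^ j) := by
  have h := Complex.integral_rpow_mul_exp_neg_mul_rpow (p := 2) (q := 2 * j) (b := α)
    (by norm_num) (by have : (0 : ℝ) ≤ j := j.cast_nonneg; linarith) hα
  have h1 : ∀ z : ℂ, ((Real.exp (-(α * ‖z‖ ^ 2)) : ℝ) : ℂ) * (z ^ j * starRingEnd ℂ z ^ j) =
      ((‖z‖ ^ (2 * j : ℝ) * Real.exp (-α * ‖z‖ ^ (2 : ℝ)) : ℝ) : ℂ) := by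
    intro z
    have h2 : ‖z‖ ^ (2 * j : ℝ) = ‖z‖ ^ (2 * j) := by
      rw [← Real.rpow_natCast]
      norm_num
    rw [h2, Real.rpow_two, ← mul_pow, Complex.mul_conj, Complex.normSq_eq_norm_sq, pow_mul,
      mul_comm]
    push_cast
    ring_nf
  have h3 : (2 * (j : ℝ) + 2) / 2 = (j : ℝ) + 1 := by ring
  have h4 : -(2 * (j : ℝ) + 2) / 2 = -((j + 1 : ℕ) : ℝ) := by push_cast; ring
  simp only [h1]
  rw [integral_complex_ofReal, h, h3, h4, Real.Gamma_nat_eq_factorial, Real.rpow_neg hα.le,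
    Real.rpow_natCast]
  have hα' : (α : ℂ) ≠ 0 := by exact_mod_cast hα.ne'
  push_cast
  field_simp
  ring

theorem integral_gaussian_mul_pow_of_ne (α : ℝ) {j k : ℕ} (hjk : j ≠ k) :
    ∫ z : ℂ, ((Real.exp (-(α * ‖z‖ ^ 2)) : ℝ) : ℂ) * (z ^ j * starRingEnd ℂ z ^ k) = 0 := by
  set I := ∫ z : ℂ, ((Real.exp (-(α * ‖z‖ ^ 2)) : ℝ) : ℂ) * (z ^ j * starRingEnd ℂ z ^ k) with hI
  -- The angle is chosen so that rotating by `u` multiplies the integrand by `-1`.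
  let u : Circle := Circle.exp (Real.pi / ((j : ℝ) - k))
  have hjk' : (j : ℂ) - k ≠ 0 := sub_ne_zero.mpr (by exact_mod_cast hjk)
  have hu : (u : ℂ) ^ j * starRingEnd ℂ (u : ℂ) ^ k = -1 := by
    rw [← Circle.coe_inv_eq_conj, Circle.coe_inv, Circle.coe_exp, inv_pow, ← Complex.exp_nat_mul,
      ← Complex.exp_nat_mul, ← Complex.exp_neg, ← Complex.exp_add, ← Complex.exp_pi_mul_I]
    congr 1
    push_cast
    field_simp
    ring
  have h1 : I = ∫ z : ℂ, ((Real.exp (-(α * ‖rotation u z‖ ^ 2)) : ℝ) : ℂ) *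
      (rotation u z ^ j * starRingEnd ℂ (rotation u z) ^ k) :=
    ((rotation u).measurePreserving.integral_comp (rotation u).toHomeomorph.measurableEmbedding
      fun z : ℂ => ((Real.exp (-(α * ‖z‖ ^ 2)) : ℝ) : ℂ) * (z ^ j * starRingEnd ℂ z ^ k)).symm
  have h2 : ∀ z : ℂ, ((Real.exp (-(α * ‖rotation u z‖ ^ 2)) : ℝ) : ℂ) *
      (rotation u z ^ j * starRingEnd ℂ (rotation u z) ^ k) =
      -(((Real.exp (-(α * ‖z‖ ^ 2)) : ℝ) : ℂ) * (z ^ j * starRingEnd ℂ z ^ k)) := by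
    intro z
    rw [LinearIsometryEquiv.norm_map, rotation_apply, map_mul, mul_pow, mul_pow,
      mul_mul_mul_comm, hu]
    ring
  simp only [h2, integral_neg] at h1
  rw [← hI] at h1
  exact self_eq_neg.mp h1

/-- The integral of the norm is known to be nonzero, so it is not the default value given to
nonintegrable functions. -/
theorem integrable_gaussian_mul_pow (α : ℝ) (hα : 0 < α) (j k : ℕ) :
    Integrable fun z : ℂ =>
      ((Real.exp (-(α * ‖z‖ ^ 2)) : ℝ) : ℂ) * (z ^ j * starRingEnd ℂ z ^ k) := by
  have hq : (-2 : ℝ) < (j + k : ℕ) := lt_of_lt_of_le (by norm_num) (Nat.cast_nonneg _)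
  have h := Complex.integral_rpow_mul_exp_neg_mul_rpow (p := 2) (q := (j + k : ℕ)) (b := α)
    (by norm_num) hq hα
  have hne : ∫ z : ℂ, ‖z‖ ^ ((j + k : ℕ) : ℝ) * Real.exp (-α * ‖z‖ ^ (2 : ℝ)) ≠ 0 := by
    rw [h]
    have h1 : 0 < Real.Gamma (((j + k : ℕ) + 2) / 2) := Real.Gamma_pos_of_pos (by linarith)
    positivity
  have hint := not_imp_comm.mp integral_undef hne
  refine hint.mono' (Continuous.aestronglyMeasurable (by fun_prop)) (Filter.Eventually.of_forall
    fun z => le_of_eq ?_)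
  rw [norm_mul, norm_mul, norm_pow, norm_pow, RCLike.norm_conj, Complex.norm_real,
    Real.norm_of_nonneg (Real.exp_pos _).le, ← pow_add, Real.rpow_natCast, Real.rpow_two, mul_comm,
    neg_mul]

/-! ### Wick's theorem for the components of a tensor -/

variable {D N : ℕ}

/-- A monomial in the components of a tensor and of its complex conjugate. -/
def monomial {H : Type} [Fintype H] (A B : H → Index D N) (T : Tensor D N) : ℂ :=
  (∏ i, T (A i)) * ∏ i, starRingEnd ℂ (T (B i))

theorem prod_eq_prod_pow {J H : Type} [Fintype H] [Fintype J] [DecidableEq J]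
    (A : H → J) (f : J → ℂ) :
    ∏ i, f (A i) = ∏ a, f a ^ Fintype.card {i // A i = a} := by
  rw [← Fintype.prod_fiberwise A]
  refine Finset.prod_congr rfl fun a _ => ?_
  rw [Finset.prod_congr rfl fun i _ => congrArg f i.2, Finset.prod_const, Finset.card_univ]

/-- If the fibres of `A` and `B` have matching sizes, the solutions form a coset of the stabilizer
of `A`; otherwise there are none. The factorials are those of the Gaussian moments in one variable.
-/
theorem card_perm_comp_eq {J H : Type} [Fintype H] [DecidableEq H] [Fintype J] [DecidableEq J]
    (A B : H → J) :
    Fintype.card {σ : Equiv.Perm H // A ∘ σ = B} =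
      ∏ a, if Fintype.card {i // A i = a} = Fintype.card {i // B i = a} then
        (Fintype.card {i // A i = a}).factorial else 0 := by
  by_cases h : ∀ a, Fintype.card {i // A i = a} = Fintype.card {i // B i = a}
  · simp only [h, if_true]
    let σ₀ : Equiv.Perm H := (Equiv.sigmaFiberEquiv B).symm.trans
      ((Equiv.sigmaCongrRight fun a => Fintype.equivOfCardEq (h a).symm).trans
        (Equiv.sigmaFiberEquiv A))
    have hσ₀ : A ∘ σ₀ = B := by
      funext i
      exact ((Fintype.equivOfCardEq (h (B i)).symm) ⟨i, rfl⟩).2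
    rw [Finset.prod_congr rfl fun a _ => by rw [← h a], ← DomMulAct.stabilizer_card A]
    refine Fintype.card_congr (Equiv.subtypeEquiv (Equiv.mulRight σ₀⁻¹) fun σ => ?_)
    rw [Equiv.coe_mulRight, Equiv.Perm.coe_mul, ← Function.comp_assoc, ← hσ₀]
    constructor
    · intro h
      rw [h, Function.comp_assoc, ← Equiv.Perm.coe_mul, mul_inv_cancel, Equiv.Perm.coe_one,
        Function.comp_id]
    · intro h
      conv_rhs => rw [← h]
      rw [Function.comp_assoc, ← Equiv.Perm.coe_mul, inv_mul_cancel, Equiv.Perm.coe_one,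
        Function.comp_id]
  · obtain ⟨a, ha⟩ := not_forall.mp h
    rw [Finset.prod_eq_zero (Finset.mem_univ a) (if_neg ha), Fintype.card_eq_zero_iff]
    refine ⟨fun ⟨σ, hσ⟩ => ha ?_⟩
    exact Fintype.card_congr ((Equiv.subtypeEquiv σ fun i => by
      rw [← hσ, Function.comp_apply]).symm)

theorem gaussianWeight_mul_monomial {H : Type} [Fintype H] (A B : H → Index D N)
    (T : Tensor D N) :
    (gaussianWeight T : ℂ) * monomial A B T = ∏ a,
      (((Real.exp (-((N : ℝ) ^ (D - 1) * ‖T a‖ ^ 2)) : ℝ) : ℂ) *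
        (T a ^ Fintype.card {i // A i = a} *
          starRingEnd ℂ (T a) ^ Fintype.card {i // B i = a})) := by
  rw [monomial, prod_eq_prod_pow A T, prod_eq_prod_pow B fun a => starRingEnd ℂ (T a),
    Finset.prod_mul_distrib, Finset.prod_mul_distrib, gaussianWeight, Finset.mul_sum,
    ← Finset.sum_neg_distrib, Real.exp_sum, Complex.ofReal_prod]

theorem integrable_gaussianWeight_mul_monomial {H : Type} [Fintype H] (hN : 1 ≤ N)
    (A B : H → Index D N) :
    Integrable fun T : Tensor D N => (gaussianWeight T : ℂ) * monomial A B T := by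
  simp only [gaussianWeight_mul_monomial]
  exact Integrable.fintype_prod (𝕜 := ℂ)
    fun a => integrable_gaussian_mul_pow _ (by positivity) _ _

/-- Wick's theorem. -/
theorem gaussianExpectation_monomial {H : Type} [Fintype H] [DecidableEq H] (hN : 1 ≤ N)
    (A B : H → Index D N) :
    gaussianExpectation (monomial A B) =
      Fintype.card {σ : Equiv.Perm H // A ∘ σ = B} /
        ((N : ℂ) ^ (D - 1)) ^ Fintype.card H := by
  have hα : (0 : ℝ) < (N : ℝ) ^ (D - 1) := by positivity
  have hα' : ((N : ℂ) ^ (D - 1)) ≠ 0 := by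
    have : (N : ℂ) ≠ 0 := by exact_mod_cast (by omega : N ≠ 0)
    exact pow_ne_zero _ this
  have h0 : ∫ T : Tensor D N, (gaussianWeight T : ℂ) =
      ∏ _a : Index D N, ((Real.pi : ℂ) / (N : ℂ) ^ (D - 1)) := by
    have h1 : ∀ T : Tensor D N, (gaussianWeight T : ℂ) =
        ∏ a, (((Real.exp (-((N : ℝ) ^ (D - 1) * ‖T a‖ ^ 2)) : ℝ) : ℂ) *
          (T a ^ 0 * starRingEnd ℂ (T a) ^ 0)) := by
      intro T
      simp only [pow_zero, mul_one]
      rw [gaussianWeight, Finset.mul_sum, ← Finset.sum_neg_distrib, Real.exp_sum,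
        Complex.ofReal_prod]
    simp only [h1]
    rw [integral_fintype_prod_volume_eq_prod fun _ (z : ℂ) =>
      ((Real.exp (-((N : ℝ) ^ (D - 1) * ‖z‖ ^ 2)) : ℝ) : ℂ) * (z ^ 0 * starRingEnd ℂ z ^ 0)]
    refine Finset.prod_congr rfl fun a _ => ?_
    rw [integral_gaussian_mul_pow _ hα]
    simp
  rw [gaussianExpectation, h0]
  simp only [gaussianWeight_mul_monomial]
  rw [integral_fintype_prod_volume_eq_prod fun a (z : ℂ) =>
      ((Real.exp (-((N : ℝ) ^ (D - 1) * ‖z‖ ^ 2)) : ℝ) : ℂ) *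
        (z ^ Fintype.card {i // A i = a} * starRingEnd ℂ z ^ Fintype.card {i // B i = a}),
    ← Finset.prod_div_distrib, card_perm_comp_eq]
  have hH : Fintype.card H = ∑ a, Fintype.card {i // A i = a} := by
    rw [← Fintype.card_sigma]
    exact Fintype.card_congr (Equiv.sigmaFiberEquiv A).symm
  rw [hH, ← Finset.prod_pow_eq_pow_sum, Nat.cast_prod, ← Finset.prod_div_distrib]
  refine Finset.prod_congr rfl fun a _ => ?_
  have hpi : (Real.pi : ℂ) ≠ 0 := by exact_mod_cast Real.pi_ne_zero
  split_ifs with h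
  · rw [← h, integral_gaussian_mul_pow _ hα]
    push_cast
    field_simp
  · rw [integral_gaussian_mul_pow_of_ne _ h]
    simp

theorem gaussianExpectation_sum {ι H : Type} [Fintype H] (s : Finset ι) (hN : 1 ≤ N) (x : ℂ)
    (A B : ι → H → Index D N) :
    gaussianExpectation (fun T : Tensor D N => x * ∑ i ∈ s, monomial (A i) (B i) T) =
      x * ∑ i ∈ s, gaussianExpectation (monomial (A i) (B i)) := by
  have h : ∀ T : Tensor D N, (gaussianWeight T : ℂ) * (x * ∑ i ∈ s, monomial (A i) (B i) T) =
      x * ∑ i ∈ s, (gaussianWeight T : ℂ) * monomial (A i) (B i) T := by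
    intro T
    rw [mul_left_comm, Finset.mul_sum]
  simp only [gaussianExpectation, h]
  rw [integral_const_mul, integral_finsetSum _ fun i _ =>
    integrable_gaussianWeight_mul_monomial hN _ _, mul_div_assoc, Finset.sum_div]

end Wick

end QuarticTensor

namespace QuarticTensor

open Equiv Equiv.Perm

/-! ### Labellings of the faces of a map -/

section Labellings

variable {M : Type} {N : ℕ}

/-- The number of labellings of `K` by indices such that each element of `M ⊕ K` carries, as a
source, the label which its image carries as a target; an element `m` of `M` has the prescribed
label `b m` as a source and `a m` as a target. -/
noncomputable def labelCount {K : Type} (ρ : Perm (M ⊕ K)) (a b : M → Fin N) : ℕ :=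
  Nat.card {f : K → Fin N // ∀ h, Sum.elim a f (ρ h) = Sum.elim b f h}

theorem labelCount_relabel {K K' : Type} (e : K ≃ K') (ρ : Perm (M ⊕ K)) (a b : M → Fin N) :
    labelCount ((Equiv.sumCongr (Equiv.refl M) e).permCongr ρ) a b = labelCount ρ a b := by
  refine Nat.card_congr (Equiv.subtypeEquiv (e.symm.arrowCongr (Equiv.refl _)) fun f => ?_)
  have h1 : ∀ (a : M → Fin N) h, Sum.elim a f (Equiv.sumCongr (Equiv.refl M) e h) =
      Sum.elim a (f ∘ e) h := by
    rintro a (m | k) <;> rfl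
  have h2 : (e.symm.arrowCongr (Equiv.refl (Fin N))) f = f ∘ e := rfl
  rw [h2, ← (Equiv.sumCongr (Equiv.refl M) e).forall_congr_right]
  simp only [Equiv.permCongr_apply, Equiv.symm_apply_apply, h1]

/-- Singling out the extra element of the second summand. -/
def sumOptionEquiv (M K : Type) : M ⊕ Option K ≃ Option (M ⊕ K) where
  toFun
    | Sum.inl m => some (Sum.inl m)
    | Sum.inr none => none
    | Sum.inr (some k) => some (Sum.inr k)
  invFun
    | none => Sum.inr none
    | some (Sum.inl m) => Sum.inl m
    | some (Sum.inr k) => Sum.inr (some k)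
  left_inv := by rintro (m | _ | k) <;> rfl
  right_inv := by rintro (_ | m | k) <;> rfl

/-- Labellings of `Option K` as pairs. -/
theorem labelCount_sumOption {K : Type} (ρ : Perm (M ⊕ Option K)) (a b : M → Fin N) :
    labelCount ρ a b = Nat.card {p : Fin N × (K → Fin N) // ∀ h : Option (M ⊕ K),
      Option.elim ((sumOptionEquiv M K).permCongr ρ h) p.1 (Sum.elim a p.2) =
        Option.elim h p.1 (Sum.elim b p.2)} := by
  refine Nat.card_congr (Equiv.subtypeEquiv (Equiv.piOptionEquivProd (β := fun _ => Fin N))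
    fun f => ?_)
  have h1 : ∀ (a : M → Fin N) h, Sum.elim a f h =
      Option.elim (sumOptionEquiv M K h) (f none) (Sum.elim a (f ∘ some)) := by
    rintro a (m | _ | k) <;> rfl
  have h2 : Equiv.piOptionEquivProd f = (f none, f ∘ some) := rfl
  rw [h2, ← (sumOptionEquiv M K).forall_congr_right]
  simp only [Equiv.permCongr_apply, Equiv.symm_apply_apply, h1]

/-- The extra point is either fixed or can be bypassed in its cycle. -/
theorem exists_eq_optionCongr_or_insertBefore {H : Type} [DecidableEq H] (q : Perm (Option H)) :
    (∃ μ : Perm H, q = optionCongr μ) ∨ ∃ (μ : Perm H) (x : H), q = insertBefore μ x := by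
  have h := Equiv.Perm.decomposeOption.symm_apply_apply q
  rw [Equiv.Perm.decomposeOption_symm_apply] at h
  rcases hx : (Equiv.Perm.decomposeOption q).1 with _ | x
  · refine Or.inl ⟨(Equiv.Perm.decomposeOption q).2, h.symm.trans ?_⟩
    rw [hx, swap_self]
    rfl
  · refine Or.inr ⟨(Equiv.Perm.decomposeOption q).2, x, h.symm.trans ?_⟩
    rw [hx]
    rfl

/-- A fixed point constrains nothing, so its label is free. -/
theorem labelCount_optionCongr {K : Type} {ρ : Perm (M ⊕ Option K)} {μ : Perm (M ⊕ K)}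
    (h : (sumOptionEquiv M K).permCongr ρ = optionCongr μ) (a b : M → Fin N) :
    labelCount ρ a b = N * labelCount μ a b := by
  have hN : N * labelCount μ a b = Nat.card (Fin N) * labelCount μ a b := by
    rw [Nat.card_eq_fintype_card, Fintype.card_fin]
  rw [labelCount_sumOption, h, hN, labelCount, ← Nat.card_prod]
  refine Nat.card_congr ⟨fun p => (p.1.1, ⟨p.1.2, fun h => p.2 (some h)⟩),
    fun p => ⟨(p.1, p.2.1), ?_⟩, fun p => rfl, fun p => rfl⟩
  rintro (_ | h)
  · rfl
  · exact p.2.2 h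

/-- The label of an inserted point is forced to be the one that `x` carries as a target. -/
theorem labelCount_insertBefore {K : Type} [DecidableEq M] [DecidableEq K]
    {ρ : Perm (M ⊕ Option K)} {μ : Perm (M ⊕ K)} {x : M ⊕ K}
    (h : (sumOptionEquiv M K).permCongr ρ = insertBefore μ x) (a b : M → Fin N) :
    labelCount ρ a b = labelCount μ a b := by
  have h0 : insertBefore μ x none = some x := by simp [insertBefore]
  have h1 : ∀ y, insertBefore μ x (some y) = if μ y = x then none else some (μ y) := by
    intro y
    simp only [insertBefore, Perm.mul_apply, optionCongr_apply, Option.map_some]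
    split_ifs with hy
    · rw [hy, swap_apply_right]
    · exact swap_apply_of_ne_of_ne (by simp) (by simpa using hy)
  rw [labelCount_sumOption, h, labelCount]
  refine Nat.card_congr ⟨fun p => ⟨p.1.2, fun y => ?_⟩, fun p => ⟨(Sum.elim a p.1 x, p.1), ?_⟩,
    fun p => ?_, fun p => rfl⟩
  · have hn := p.2 none
    have hy := p.2 (some y)
    rw [h0] at hn
    rw [h1] at hy
    split_ifs at hy with hxy
    · rw [hxy]
      exact hn.trans hy
    · exact hy
  · rintro (_ | y)
    · rw [h0]
      rfl
    · rw [h1]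
      have := p.2 y
      split_ifs with hxy
      · rw [hxy] at this
        exact this
      · exact this
  · have hn := p.2 none
    rw [h0] at hn
    exact Subtype.ext (Prod.ext hn rfl)

open scoped Classical in
/-- Each cycle which does not meet `M` has a free label, and the labels on the other ones have to
match along the permutation of `M` which they induce. -/
theorem exists_labelCount_eq [Finite M] {K : Type} [Finite K] (ρ : Perm (M ⊕ K)) :
    ∃ (j : ℕ) (π : Perm M), cyc ρ = j + cyc π ∧
      (∀ m m', SameCycle ρ (Sum.inl m) (Sum.inl m') ↔ SameCycle π m m') ∧
      ∀ (N : ℕ) (a b : M → Fin N), labelCount ρ a b = if a ∘ π = b then N ^ j else 0 := by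
  let P : ∀ (K : Type) [Fintype K], Prop := fun K _ => ∀ ρ : Perm (M ⊕ K),
    ∃ (j : ℕ) (π : Perm M), cyc ρ = j + cyc π ∧
      (∀ m m', SameCycle ρ (Sum.inl m) (Sum.inl m') ↔ SameCycle π m m') ∧
      ∀ (N : ℕ) (a b : M → Fin N), labelCount ρ a b = if a ∘ π = b then N ^ j else 0
  have := Fintype.ofFinite K
  suffices h : P K from h ρ
  apply Fintype.induction_empty_option (P := P)
  · intro α β _ f ih ρ
    let d := Equiv.sumCongr (Equiv.refl M) f
    obtain ⟨j, π, h1, h2, h3⟩ := ih (d.symm.permCongr ρ)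
    have hρ : d.permCongr (d.symm.permCongr ρ) = ρ := by ext x; simp [Equiv.permCongr_apply]
    refine ⟨j, π, ?_, fun m m' => ?_, fun N a b => ?_⟩
    · rw [← h1, cyc_permCongr]
    · rw [← h2, sameCycle_permCongr]
      rfl
    · rw [← h3, ← labelCount_relabel f, hρ]
  · intro ρ
    -- When no unmarked element is left, `ρ` itself is the induced permutation of the marks.
    refine ⟨0, (Equiv.sumEmpty M PEmpty.{1}).permCongr ρ, ?_, fun m m' => ?_, fun N a b => ?_⟩
    · rw [cyc_permCongr, zero_add]
    · rw [sameCycle_permCongr]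
      rfl
    · have h1 : ∀ f : PEmpty → Fin N, (∀ h, Sum.elim a f (ρ h) = Sum.elim b f h) ↔
          a ∘ (Equiv.sumEmpty M PEmpty.{1}).permCongr ρ = b := by
        intro f
        have h2 : ∀ (a : M → Fin N) x, Sum.elim a f x = a (Equiv.sumEmpty M PEmpty.{1} x) := by
          rintro a (m | k)
          · rfl
          · exact k.elim
        simp only [h2, funext_iff]
        rw [← (Equiv.sumEmpty M PEmpty.{1}).forall_congr_right]
        simp [Equiv.permCongr_apply]
      simp only [labelCount, h1]
      split_ifs with h
      · simp [h]
      · simp [h]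
  · intro K _ ih ρ
    rcases exists_eq_optionCongr_or_insertBefore ((sumOptionEquiv M K).permCongr ρ) with
      ⟨μ, h⟩ | ⟨μ, x, h⟩
    · obtain ⟨j, π, h1, h2, h3⟩ := ih μ
      refine ⟨j + 1, π, ?_, fun m m' => ?_, fun N a b => ?_⟩
      · rw [← cyc_permCongr (sumOptionEquiv M K), h, cyc_optionCongr, h1]
        ring
      · rw [← h2, ← sameCycle_optionCongr_some μ, ← h, sameCycle_permCongr]
        rfl
      · rw [labelCount_optionCongr h, h3]
        split_ifs <;> ring
    · obtain ⟨j, π, h1, h2, h3⟩ := ih μ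
      refine ⟨j, π, ?_, fun m m' => ?_, fun N a b => ?_⟩
      · rw [← cyc_permCongr (sumOptionEquiv M K), h, cyc_insertBefore, h1]
      · rw [← h2]
        have := sameCycle_insertBefore μ x (some (Sum.inl m)) (some (Sum.inl m'))
        rw [← h, sameCycle_permCongr] at this
        exact this
      · rw [labelCount_insertBefore h, h3]

end Labellings

end QuarticTensor

namespace QuarticTensor

open Equiv Equiv.Perm

/-! ### The perturbative expansion as a sum over maps -/

section Expansion

variable {D N : ℕ}

theorem delta_eq {p : ℕ} (B : Bubble D p) (a b : Fin p → Index D N) :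
    delta B a b = if (fun v c => a ((B c).symm v) c) = b then 1 else 0 := by
  rw [delta]
  split_ifs with h
  · refine Finset.prod_eq_one fun c _ => Finset.prod_eq_one fun v _ => if_pos ?_
    rw [← h]
    exact congrArg (fun v => a v c) ((B c).symm_apply_apply v).symm
  · obtain ⟨v, hv⟩ := Function.ne_iff.mp h
    obtain ⟨c, hc⟩ := Function.ne_iff.mp hv
    refine Finset.prod_eq_zero (Finset.mem_univ c)
      (Finset.prod_eq_zero (Finset.mem_univ ((B c).symm v)) (if_neg ?_))
    rwa [Equiv.apply_symm_apply]

theorem traceInvariant_eq {p : ℕ} (B : Bubble D p) (T : Tensor D N) :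
    traceInvariant B T =
      ∑ a : Fin p → Index D N, monomial a (fun v c => a ((B c).symm v) c) T := by
  refine Finset.sum_congr rfl fun a _ => ?_
  simp only [delta_eq, ite_mul, one_mul, zero_mul, Finset.sum_ite_eq, Finset.mem_univ, if_true]
  rfl

theorem monomial_comp {H H' : Type} [Fintype H] [Fintype H'] (e : H ≃ H') (a b : H' → Index D N)
    (T : Tensor D N) : monomial (a ∘ e) (b ∘ e) T = monomial a b T := by
  simp only [monomial, Function.comp_apply]
  rw [e.prod_comp (fun i => T (a i)), e.prod_comp (fun i => starRingEnd ℂ (T (b i)))]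

theorem monomial_sum {H H' : Type} [Fintype H] [Fintype H'] (a b : H ⊕ H' → Index D N)
    (T : Tensor D N) : monomial a b T =
      monomial (a ∘ Sum.inl) (b ∘ Sum.inl) T * monomial (a ∘ Sum.inr) (b ∘ Sum.inr) T := by
  simp only [monomial, Fintype.prod_sum_type, Function.comp_apply]
  ring

theorem traceInvariant_quartic (c : Fin D) (T : Tensor D N) :
    traceInvariant (bubbleFour {c}) T = ∑ α : Bool → Index D N,
      monomial α (fun b k => α (if c = k then !b else b) k) T := by
  rw [traceInvariant_eq]
  refine Fintype.sum_equiv (finTwoEquiv.arrowCongr (Equiv.refl _)) _ _ fun a => ?_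
  rw [← monomial_comp finTwoEquiv]
  have h1 : (finTwoEquiv.arrowCongr (Equiv.refl (Index D N))) a ∘ finTwoEquiv = a := by
    funext v
    simp
  rw [h1]
  congr 1
  funext v k
  simp only [bubbleFour, Finset.mem_singleton, Function.comp_apply, Equiv.arrowCongr_apply,
    Equiv.coe_refl, id_eq]
  by_cases h : c = k
  · rw [if_pos h.symm, if_pos h]
    fin_cases v <;> rfl
  · rw [if_neg (Ne.symm h), if_neg h, Equiv.symm_apply_apply]
    rfl

/-- The indices of the complex conjugate tensors, when the quartic bubbles of colours `c` are
glued to the tensors with indices `α`. -/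
def glued {M E : Type} (c : E → Fin D) (b : M → Index D N) (α : E × Bool → Index D N)
    (h : Darts M E) : Index D N :=
  fun k => Sum.elim b α (flip c k h) k

theorem interaction_pow (n : ℕ) (T : Tensor D N) :
    interaction T ^ n = ((N : ℂ) ^ (D - 1) / 2) ^ n *
      ∑ c : Fin n → Fin D, ∑ α : Fin n × Bool → Index D N,
        ∏ i, monomial (fun b => α (i, b)) (fun b k => α (i, if c i = k then !b else b) k) T := by
  have h1 : interaction T = (N : ℂ) ^ (D - 1) / 2 *
      ∑ p : Fin D × (Bool → Index D N),
        monomial p.2 (fun b k => p.2 (if p.1 = k then !b else b) k) T := by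
    rw [interaction, ← Finset.mul_sum, Fintype.sum_prod_type]
    simp only [traceInvariant_quartic]
    ring
  rw [h1, mul_pow, Fintype.sum_pow, ← Fintype.sum_prod_type']
  refine congrArg _ (Fintype.sum_equiv ((Equiv.arrowProdEquivProdArrow (Fin n) (fun _ => Fin D)
    fun _ => Bool → Index D N).trans
      (Equiv.prodCongr (Equiv.refl _) (Equiv.curry _ _ _).symm)) _ _ fun p => ?_)
  rfl

theorem monomial_mul_interaction_pow {M : Type} [Fintype M] (a b : M → Index D N) (n : ℕ)
    (T : Tensor D N) :
    monomial a b T * interaction T ^ n = ((N : ℂ) ^ (D - 1) / 2) ^ n *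
      ∑ p : (Fin n → Fin D) × (Fin n × Bool → Index D N),
        monomial (Sum.elim a p.2) (glued p.1 b p.2) T := by
  rw [interaction_pow, mul_left_comm, Fintype.sum_prod_type, Finset.mul_sum]
  refine congrArg _ (Finset.sum_congr rfl fun c _ => ?_)
  rw [Finset.mul_sum]
  refine Finset.sum_congr rfl fun α _ => ?_
  rw [monomial_sum]
  refine congrArg₂ _ rfl ?_
  simp only [monomial, Fintype.prod_prod_type, ← Finset.prod_mul_distrib]
  refine Finset.prod_congr rfl fun i _ => ?_
  have h : ∀ x, (glued c b α ∘ Sum.inr) (i, x) =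
      fun k => α (i, if c i = k then !x else x) k := by
    intro x
    funext k
    simp [glued]
  simp only [h]
  rfl

/-- As `flip` is an involution it can be moved to the other side, and the constraint decouples into
one for each colour. -/
theorem comp_eq_glued_iff {M E : Type} (c : E → Fin D) (a b : M → Index D N)
    (α : E × Bool → Index D N) (σ : Perm (Darts M E)) :
    Sum.elim a α ∘ σ = glued c b α ↔ ∀ k, ∀ h : Darts M E,
      Sum.elim (fun m => a m k) (fun e => α e k) ((σ * flip c k : Perm (Darts M E)) h) =
        Sum.elim (fun m => b m k) (fun e => α e k) h := by
  have h1 : ∀ (a : M → Index D N) k h,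
      Sum.elim (fun m => a m k) (fun e => α e k) h = Sum.elim a α h k := by
    rintro a k (m | e) <;> rfl
  simp only [h1, funext_iff, Function.comp_apply, glued, Perm.mul_apply]
  constructor
  · intro h k x
    rw [h, flip_mul_self]
  · intro h x k
    rw [← h, flip_mul_self]

theorem card_comp_eq_glued {M E : Type} [Fintype M] [Fintype E] (c : E → Fin D)
    (a b : M → Index D N) (σ : Perm (Darts M E)) :
    Nat.card {α : E × Bool → Index D N // Sum.elim a α ∘ σ = glued c b α} =
      ∏ k, labelCount (σ * flip c k) (fun m => a m k) fun m => b m k := by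
  simp only [labelCount]
  rw [← Nat.card_pi]
  refine Nat.card_congr (Equiv.trans (Equiv.subtypeEquiv (Equiv.piComm fun _ _ => Fin N)
    fun α => ?_) (Equiv.subtypePiEquivPi (β := fun _ => E × Bool → Fin N)
      (p := fun k f => ∀ h, Sum.elim (fun m => a m k) f ((σ * flip c k : Perm (Darts M E)) h) =
        Sum.elim (fun m => b m k) f h)))
  exact comp_eq_glued_iff c a b α σ

/-- The Feynman expansion of moments. -/
theorem coeff_perturbative_monomial {M : Type} [Fintype M] [DecidableEq M] (hN : 1 ≤ N)
    (a b : M → Index D N) (n : ℕ) :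
    PowerSeries.coeff n (perturbative (monomial a b)) =
      ((N : ℂ) ^ (D - 1))⁻¹ ^ Fintype.card M * (∑ c : Fin n → Fin D, ∑ σ : Perm (Darts M (Fin n)),
        ((N : ℂ) ^ (D - 1))⁻¹ ^ n *
          ∏ k, (labelCount (σ * flip c k) (fun m => a m k) (fun m => b m k) : ℂ)) /
        (2 ^ n * n.factorial) := by
  classical
  have hs : ((N : ℂ) ^ (D - 1)) ≠ 0 := by
    have : (N : ℂ) ≠ 0 := by exact_mod_cast (by omega : N ≠ 0)
    exact pow_ne_zero _ this
  rw [perturbative, PowerSeries.coeff_mk]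
  simp only [monomial_mul_interaction_pow]
  rw [gaussianExpectation_sum _ hN]
  simp only [gaussianExpectation_monomial hN]
  have h1 : ∑ p : (Fin n → Fin D) × (Fin n × Bool → Index D N),
      (Fintype.card {σ : Perm (Darts M (Fin n)) // Sum.elim a p.2 ∘ σ = glued p.1 b p.2} : ℂ) =
      ∑ c : Fin n → Fin D, ∑ σ : Perm (Darts M (Fin n)),
        ∏ k, (labelCount (σ * flip c k) (fun m => a m k) (fun m => b m k) : ℂ) := by
    rw [Fintype.sum_prod_type]
    refine Finset.sum_congr rfl fun c _ => ?_
    have h2 : ∀ σ : Perm (Darts M (Fin n)),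
        ∏ k, (labelCount (σ * flip c k) (fun m => a m k) (fun m => b m k) : ℂ) =
          ∑ α : Fin n × Bool → Index D N, if Sum.elim a α ∘ σ = glued c b α then 1 else 0 := by
      intro σ
      rw [← Nat.cast_prod, ← card_comp_eq_glued, Nat.card_eq_fintype_card, Fintype.card_subtype,
        Finset.card_filter]
      push_cast
      rfl
    simp only [h2]
    rw [Finset.sum_comm]
    refine Finset.sum_congr rfl fun α _ => ?_
    rw [Fintype.card_subtype, Finset.card_filter]
    push_cast
    rfl
  rw [← Finset.sum_div, h1]
  -- Wick's theorem gives two propagators per edge, one of which cancels the factor `N ^ (D - 1)` of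
  -- the bubble.
  have h3 : Fintype.card (Darts M (Fin n)) = Fintype.card M + n * 2 := by
    simp [Darts]
  rw [h3]
  simp only [← Finset.mul_sum]
  set S := ∑ c : Fin n → Fin D, ∑ σ : Perm (Darts M (Fin n)),
        ∏ k, (labelCount (σ * flip c k) (fun m => a m k) (fun m => b m k) : ℂ)
  rw [pow_add, pow_mul, div_pow, inv_pow, inv_pow]
  have hf : (n.factorial : ℂ) ≠ 0 := by exact_mod_cast n.factorial_ne_zero
  field_simp

end Expansion

end QuarticTensor

namespace QuarticTensor

open Equiv Equiv.Perm

/-! ### The correlation functions as generating functions of maps -/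

section Correlations

variable {D N : ℕ}

theorem cyc_one {α : Type} : cyc (1 : Perm α) = Nat.card α := by
  refine (Nat.card_congr (Equiv.ofBijective (fun x : α => (⟦x⟧ : Quotient (SameCycle.setoid 1)))
    ⟨fun x y h => ?_, Quotient.mk_surjective⟩)).symm
  have : SameCycle (1 : Perm α) x y := Quotient.exact h
  simpa using this

/-- With at most one mark on each cycle, the induced permutation is trivial. The cycles through
marks have no free label, and `N ^ Nat.card M` compensates for them. -/
theorem labelCount_mul_pow {M K : Type} [Finite M] [Finite K] {ρ : Perm (M ⊕ K)}
    (h : ∀ m m', SameCycle ρ (Sum.inl m) (Sum.inl m') → m = m') (a b : M → Fin N)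
    [Decidable (a = b)] : labelCount ρ a b * N ^ Nat.card M = if a = b then N ^ cyc ρ else 0 := by
  classical
  obtain ⟨j, π, h1, h2, h3⟩ := exists_labelCount_eq ρ
  have hπ : π = 1 := by
    ext m
    exact (h _ _ ((h2 _ _).mpr (sameCycle_apply π m))).symm
  rw [h3, h1, hπ, cyc_one, Perm.coe_one, Function.comp_id]
  split_ifs
  · rw [pow_add]
  · rw [zero_mul]

/-- A shared face would force the two distinct labels to be equal. -/
theorem labelCount_eq_zero {K : Type} [Finite K] {ρ : Perm (Bool ⊕ K)}
    (h : SameCycle ρ (Sum.inl false) (Sum.inl true)) {a : Bool → Fin N} (ha : a false ≠ a true) :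
    labelCount ρ a a = 0 := by
  classical
  obtain ⟨j, π, h1, h2, h3⟩ := exists_labelCount_eq ρ
  rw [h3, if_neg]
  intro hπ
  have h4 : π false = true := by
    by_contra h5
    have h6 : π false = false := by simpa using h5
    exact Bool.false_ne_true (((h2 _ _).mp h).eq_of_left h6)
  have := congrFun hπ false
  rw [Function.comp_apply, h4] at this
  exact ha this.symm

/-- By `excess_spec`, the powers of `N` become a weight for edges, vertices and excess, with `x = N
^ (-D)`, `y = N ^ D`, `w = N ^ 2`. -/
theorem pow_sum_cyc (hD : 1 ≤ D) (hN : 1 ≤ N) {M : Type} [Finite M] {n : ℕ} (c : Fin n → Fin D)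
    (σ : Perm (Darts M (Fin n))) :
    ((N : ℂ) ^ (D - 1))⁻¹ ^ n * ∏ k, (N : ℂ) ^ cyc (σ * flip c k) =
      mapWeight ((N : ℂ) ^ D)⁻¹ ((N : ℂ) ^ D)⁻¹⁻¹ ((N : ℂ) ^ 2) c σ := by
  have hN' : (N : ℂ) ≠ 0 := by exact_mod_cast (by omega : N ≠ 0)
  have h := excess_spec c σ
  rw [Fintype.card_fin, Fintype.card_fin] at h
  have h1 : ((N : ℂ) ^ D) ^ cyc σ * ((N : ℂ) ^ 2) ^ excess c σ =
      (N : ℂ) ^ n * ∏ k, (N : ℂ) ^ cyc (σ * flip c k) := by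
    rw [← pow_mul, ← pow_mul, ← pow_add, ← h, pow_add, Finset.prod_pow_eq_pow_sum]
  have h2 : (N : ℂ) ^ D = (N : ℂ) ^ (D - 1) * N := by
    rw [← pow_succ, Nat.sub_add_cancel hD]
  rw [mapWeight, Fintype.card_fin, inv_inv, mul_assoc, h1, h2, inv_pow, inv_pow, mul_pow]
  field_simp

theorem perturbative_monomial_of_subsingleton (hD : 1 ≤ D) (hN : 1 ≤ N) {M : Type} [Fintype M]
    [DecidableEq M] [Subsingleton M] (a b : M → Index D N) :
    perturbative (monomial a b) =
      PowerSeries.C (if a = b then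
        ((N : ℂ) ^ (D - 1) * (N : ℂ) ^ D)⁻¹ ^ Fintype.card M else 0) *
      mapSeries (κ := Fin D) (M := M) ((N : ℂ) ^ D)⁻¹ ((N : ℂ) ^ D)⁻¹⁻¹ ((N : ℂ) ^ 2)
        fun _ => 1 := by
  have hN' : (N : ℂ) ≠ 0 := by exact_mod_cast (by omega : N ≠ 0)
  ext n
  rw [coeff_perturbative_monomial hN, PowerSeries.coeff_C_mul, mapSeries, PowerSeries.coeff_mk,
    mapSum, mul_div_assoc']
  congr 1
  rw [Finset.mul_sum, Finset.mul_sum]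
  refine Finset.sum_congr rfl fun c _ => ?_
  rw [Finset.mul_sum, Finset.mul_sum]
  refine Finset.sum_congr rfl fun σ _ => ?_
  have h1 : ∀ k, (labelCount (σ * flip c k) (fun m => a m k) (fun m => b m k) : ℂ) =
      (if (fun m => a m k) = (fun m => b m k) then (N : ℂ) ^ cyc (σ * flip c k) else 0) *
        ((N : ℂ) ^ Fintype.card M)⁻¹ := by
    intro k
    have := labelCount_mul_pow (N := N) (ρ := σ * flip c k)
      (fun m m' _ => Subsingleton.elim m m') (fun m => a m k) (fun m => b m k)
    rw [Nat.card_eq_fintype_card] at this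
    rw [eq_mul_inv_iff_mul_eq₀ (pow_ne_zero _ hN')]
    exact_mod_cast this
  rw [Finset.prod_congr rfl fun k _ => h1 k, Finset.prod_mul_distrib, Finset.prod_const,
    Finset.card_univ, Fintype.card_fin, mul_one, ← pow_sum_cyc hD hN]
  by_cases hab : a = b
  · subst hab
    simp only [if_true]
    have h2 : ((N : ℂ) ^ Fintype.card M)⁻¹ ^ D = ((N : ℂ) ^ D)⁻¹ ^ Fintype.card M := by
      rw [inv_pow, inv_pow, ← pow_mul, ← pow_mul, mul_comm]
    rw [h2, mul_inv, mul_pow]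
    ring
  · rw [if_neg hab]
    obtain ⟨m, hm⟩ := Function.ne_iff.mp hab
    obtain ⟨k, hk⟩ := Function.ne_iff.mp hm
    rw [Finset.prod_eq_zero (Finset.mem_univ k) (if_neg fun h => hk (congrFun h m))]
    ring

-- The indices of the two marks differ in every colour, so only maps whose marks share no face
-- survive.
open scoped Classical in
theorem perturbative_monomial_bool (hD : 1 ≤ D) (hN : 1 ≤ N) {a : Bool → Index D N}
    (ha : ∀ k, a false k ≠ a true k) :
    perturbative (monomial a a) = PowerSeries.C (((N : ℂ) ^ (D - 1) * (N : ℂ) ^ D)⁻¹ ^ 2) *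
      mapTwo (κ := Fin D) ((N : ℂ) ^ D)⁻¹ ((N : ℂ) ^ D)⁻¹⁻¹ ((N : ℂ) ^ 2)
        (fun B => if B = ∅ then 1 else 0) := by
  have hN' : (N : ℂ) ≠ 0 := by exact_mod_cast (by omega : N ≠ 0)
  ext n
  rw [coeff_perturbative_monomial hN, PowerSeries.coeff_C_mul, mapTwo, mapSeries,
    PowerSeries.coeff_mk, mapSum, mul_div_assoc']
  congr 1
  rw [Finset.mul_sum, Finset.mul_sum]
  refine Finset.sum_congr rfl fun c _ => ?_
  rw [Finset.mul_sum, Finset.mul_sum]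
  refine Finset.sum_congr rfl fun σ _ => ?_
  by_cases h : {k | faceRel c σ k false true} = ∅
  · have hk : ∀ k, ¬ faceRel c σ k false true := fun k hk =>
      Set.notMem_empty k (h ▸ hk)
    have h1 : ∀ k, (labelCount (σ * flip c k) (fun m => a m k) (fun m => a m k) : ℂ) =
        (N : ℂ) ^ cyc (σ * flip c k) * ((N : ℂ) ^ 2)⁻¹ := by
      intro k
      have h2 : ∀ m m', SameCycle (σ * flip c k) (Sum.inl m) (Sum.inl m') → m = m' := by
        rintro (_ | _) (_ | _) h2
        · rfl
        · exact absurd h2 (hk k)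
        · exact absurd (SameCycle.symm h2) (hk k)
        · rfl
      have := labelCount_mul_pow (N := N) h2 (fun m => a m k) (fun m => a m k)
      rw [Nat.card_eq_fintype_card, Fintype.card_bool, if_pos rfl] at this
      rw [eq_mul_inv_iff_mul_eq₀ (pow_ne_zero _ hN')]
      exact_mod_cast this
    rw [Finset.prod_congr rfl fun k _ => h1 k, Finset.prod_mul_distrib, Finset.prod_const,
      Finset.card_univ, Fintype.card_fin, if_pos h, mul_one, ← pow_sum_cyc hD hN,
      Fintype.card_bool, mul_inv, mul_pow, inv_pow ((N : ℂ) ^ D), inv_pow ((N : ℂ) ^ 2), ← pow_mul,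
      ← pow_mul, mul_comm 2 D]
    ring
  · obtain ⟨k, hk⟩ := Set.nonempty_iff_ne_empty.mpr h
    rw [if_neg h, Finset.prod_eq_zero (Finset.mem_univ k)
      (by exact_mod_cast labelCount_eq_zero hk (ha k))]
    ring

theorem perturbative_one (hD : 1 ≤ D) (hN : 1 ≤ N) :
    perturbative (fun _ : Tensor D N => (1 : ℂ)) =
      mapZero (Fin D) ((N : ℂ) ^ D)⁻¹ ((N : ℂ) ^ D)⁻¹⁻¹ ((N : ℂ) ^ 2) := by
  have h := perturbative_monomial_of_subsingleton hD hN (M := Empty) (N := N)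
    (fun m => m.elim) (fun m => m.elim)
  rw [if_pos rfl, Fintype.card_empty, pow_zero, map_one, one_mul] at h
  refine Eq.trans (congrArg perturbative ?_) h
  funext T
  simp [monomial]

theorem perturbative_pair (hD : 1 ≤ D) (hN : 1 ≤ N) (a b : Index D N) :
    perturbative (fun T : Tensor D N => T a * starRingEnd ℂ (T b)) =
      PowerSeries.C (if a = b then ((N : ℂ) ^ (D - 1) * (N : ℂ) ^ D)⁻¹ else 0) *
        mapOne (Fin D) ((N : ℂ) ^ D)⁻¹ ((N : ℂ) ^ D)⁻¹⁻¹ ((N : ℂ) ^ 2) := by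
  have h := perturbative_monomial_of_subsingleton hD hN (M := Unit) (fun _ => a) (fun _ => b)
  rw [Fintype.card_unit, pow_one] at h
  have hab : ((fun _ : Unit => a) = fun _ => b) ↔ a = b :=
    ⟨fun h => congrFun h (), fun h => h ▸ rfl⟩
  simp only [hab] at h
  refine Eq.trans (congrArg perturbative ?_) h
  funext T
  simp [monomial]

theorem perturbative_sum {ι M : Type} [Fintype ι] [Fintype M] [DecidableEq M] (hN : 1 ≤ N)
    (A B : ι → M → Index D N) :
    perturbative (fun T : Tensor D N => ∑ i, monomial (A i) (B i) T) =
      ∑ i, perturbative (monomial (A i) (B i)) := by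
  ext n
  rw [map_sum]
  simp only [perturbative, PowerSeries.coeff_mk, Finset.sum_mul, monomial_mul_interaction_pow]
  simp only [← Finset.mul_sum]
  have h : ∀ T : Tensor D N, ∑ i, ∑ p : (Fin n → Fin D) × (Fin n × Bool → Index D N),
      monomial (Sum.elim (A i) p.2) (glued p.1 (B i) p.2) T =
      ∑ q : ι × (Fin n → Fin D) × (Fin n × Bool → Index D N),
        monomial (Sum.elim (A q.1) q.2.2) (glued q.2.1 (B q.1) q.2.2) T := by
    intro T
    rw [Fintype.sum_prod_type]
  simp only [h]
  rw [gaussianExpectation_sum _ hN, ← Finset.sum_div]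
  simp only [gaussianExpectation_sum _ hN]
  rw [← Finset.mul_sum, Fintype.sum_prod_type]

theorem mul_mapZero_mul_inv {x y w : ℂ} (f : PowerSeries ℂ) :
    f * mapZero (Fin D) x y w * (mapZero (Fin D) x y w)⁻¹ = f := by
  rw [mul_assoc, PowerSeries.mul_inv_cancel _ (by rw [constantCoeff_mapZero]; exact one_ne_zero),
    mul_one]

theorem cumulantTwo_eq (hD : 1 ≤ D) (hN : 1 ≤ N) (a b : Index D N) :
    cumulantTwo a b =
      PowerSeries.C (if a = b then ((N : ℂ) ^ (D - 1) * (N : ℂ) ^ D)⁻¹ else 0) *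
        connOne (Fin D) ((N : ℂ) ^ D)⁻¹ ((N : ℂ) ^ D)⁻¹⁻¹ ((N : ℂ) ^ 2) := by
  rw [cumulantTwo, expectation, perturbative_pair hD hN, perturbative_one hD hN, mapOne_eq,
    ← mul_assoc, mul_mapZero_mul_inv]

/-- The `N ^ D` diagonal terms, the factor `1 / N` and the weight `N ^ (-(2 D - 1))` of a mark
combine to `x = N ^ (-D)`. -/
theorem twoPoint_eq (hD : 1 ≤ D) (hN : 1 ≤ N) :
    twoPoint D N = PowerSeries.map (Polynomial.evalRingHom ((N : ℂ) ^ D)⁻¹)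
      (connPoly (κ := Fin D) (M := Unit) ((N : ℂ) ^ 2) fun _ => 1) := by
  have hN' : (N : ℂ) ≠ 0 := by exact_mod_cast (by omega : N ≠ 0)
  have h1 : (fun T : Tensor D N => traceInvariant (bubbleTwo D) T) =
      fun T => ∑ a : Fin 1 → Index D N, monomial a a T := by
    funext T
    rw [traceInvariant_eq]
    rfl
  have h2 : ∀ a : Fin 1 → Index D N, perturbative (monomial a a) =
      PowerSeries.C ((N : ℂ) ^ (D - 1) * (N : ℂ) ^ D)⁻¹ *
        mapOne (Fin D) ((N : ℂ) ^ D)⁻¹ ((N : ℂ) ^ D)⁻¹⁻¹ ((N : ℂ) ^ 2) := by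
    intro a
    have := perturbative_pair hD hN (a 0) (a 0)
    rw [if_pos rfl] at this
    refine Eq.trans (congrArg perturbative ?_) this
    funext T
    simp [monomial]
  rw [map_eval_connPoly (inv_ne_zero (pow_ne_zero _ hN')), twoPoint, expectation, h1,
    perturbative_sum hN, Finset.sum_congr rfl fun a _ => h2 a, perturbative_one hD hN,
    Finset.sum_const, Finset.card_univ, nsmul_eq_mul, mapOne_eq, ← mul_assoc, ← mul_assoc,
    ← mul_assoc, ← mul_assoc, mul_mapZero_mul_inv]
  change _ = _ * connOne _ _ _ _
  rw [← map_natCast (PowerSeries.C (R := ℂ)), ← map_mul, ← map_mul]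
  congr 2
  have h3 : (N : ℂ) ^ D = (N : ℂ) ^ (D - 1) * N := by
    rw [← pow_succ, Nat.sub_add_cancel hD]
  rw [Fintype.card_fun, Fintype.card_fun, Fintype.card_fin, Fintype.card_fin, Fintype.card_fin]
  push_cast
  rw [pow_one, h3]
  field_simp

-- The direct product of two-point functions is exactly the disconnected part; the crossed product
-- vanishes because the two index tuples differ.
open scoped Classical in
theorem cumulantFour_const (hD : 1 ≤ D) (hN : 1 ≤ N) {i j : Fin N} (hij : i ≠ j) :
    cumulantFour (fun v (_ : Fin D) => if v = 0 then i else j)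
        (fun v (_ : Fin D) => if v = 0 then i else j) =
      PowerSeries.C (((N : ℂ) ^ (D - 1) * (N : ℂ) ^ D)⁻¹ ^ 2) *
        connTwo (κ := Fin D) ((N : ℂ) ^ D)⁻¹ ((N : ℂ) ^ D)⁻¹⁻¹ ((N : ℂ) ^ 2)
          (fun B => if B = ∅ then 1 else 0) := by
  let a : Bool → Index D N := fun v _ => if v = false then i else j
  have h1 : (fun T : Tensor D N => T (a false) * T (a true) *
      (starRingEnd ℂ (T (a false)) * starRingEnd ℂ (T (a true)))) = monomial a a := by
    funext T
    simp only [monomial, Fintype.prod_bool]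
    ring
  have h2 : a false ≠ a true := fun h => hij (congrFun h ⟨0, hD⟩)
  change expectation (fun T : Tensor D N => T (a false) * T (a true) *
    (starRingEnd ℂ (T (a false)) * starRingEnd ℂ (T (a true)))) -
    cumulantTwo (a false) (a false) * cumulantTwo (a true) (a true) -
    cumulantTwo (a false) (a true) * cumulantTwo (a true) (a false) = _
  rw [h1, expectation, perturbative_monomial_bool hD hN fun k => hij, mapTwo_eq, if_pos rfl,
    mapOne_eq, perturbative_one hD hN]
  simp only [cumulantTwo_eq hD hN, if_true, if_neg h2, map_zero, map_pow, map_one, one_mul]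
  rw [← mul_assoc (connOne _ _ _ _), ← add_mul, ← mul_assoc, mul_mapZero_mul_inv]
  ring

-- The chosen indices annihilate every operator of the expansion except that of `∅`. The powers `N ^
-- (3 D - 2)` and `N ^ (-2 (2 D - 1))` combine to `x = N ^ (-D)`.
open scoped Classical in
theorem rescaledFourEmpty_eq (hD : 1 ≤ D) (hN : 2 ≤ N) {W : Finset (Fin D) → PowerSeries ℂ}
    (hW : IsInvariantExpansion D N W) :
    rescaledFourEmpty D N W = PowerSeries.map (Polynomial.evalRingHom ((N : ℂ) ^ D)⁻¹)
      (connPoly (κ := Fin D) (M := Bool) ((N : ℂ) ^ 2)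
        fun r => if {k | r k false true} = ∅ then 1 else 0) := by
  have hN' : (N : ℂ) ≠ 0 := by exact_mod_cast (by omega : N ≠ 0)
  have hij : (⟨0, by omega⟩ : Fin N) ≠ ⟨1, hN⟩ := by simp
  set i : Fin N := ⟨0, by omega⟩
  set j : Fin N := ⟨1, hN⟩
  let a : Fin 2 → Index D N := fun v _ => if v = 0 then i else j
  have h0 : ∀ C : Finset (Fin D), 2 * C.card ≤ D → symDelta C a a = if C = ∅ then 1 else 0 := by
    intro C hC
    have h1 : delta (bubbleFour C) (fun v => a (Equiv.swap 0 1 v)) a = 0 := by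
      rw [delta_eq, if_neg]
      intro h
      -- Since `2 |C| ≤ D` and `D ≥ 1`, some colour lies outside `C`, and it detects the exchange.
      obtain ⟨c, hc⟩ : ∃ c, c ∉ C := by
        by_contra! h
        have : C = Finset.univ := Finset.eq_univ_of_forall h
        rw [this, Finset.card_univ, Fintype.card_fin] at hC
        omega
      have := congrFun (congrFun h 0) c
      simp only [bubbleFour, if_neg hc] at this
      exact hij this.symm
    rw [symDelta, h1, add_zero, delta_eq]
    by_cases hC0 : C = ∅
    · subst hC0
      rw [if_pos rfl, if_pos]
      rfl
    · rw [if_neg hC0, if_neg]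
      intro h
      obtain ⟨c, hc⟩ := Finset.nonempty_iff_ne_empty.mpr hC0
      have := congrFun (congrFun h 0) c
      simp only [bubbleFour, if_pos hc] at this
      exact hij this.symm
  have h1 := hW a a
  rw [cumulantFour_const hD (by omega) hij, Finset.sum_eq_single ∅, h0 _ (by simp), if_pos rfl,
    map_one, one_mul] at h1
  · rw [rescaledFourEmpty, ← h1, ← mul_assoc, ← map_mul,
      map_eval_connPoly (inv_ne_zero (pow_ne_zero _ hN'))]
    change _ = _ * connTwo _ _ _ fun B => if B = ∅ then 1 else 0
    congr 2
    have h3 : (N : ℂ) ^ (-scaling D 2 2) * (N : ℂ) ^ 2 = ((N : ℂ) ^ D) ^ 3 := by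
      rw [scaling, ← pow_mul, ← zpow_natCast, ← zpow_natCast, ← zpow_add₀ hN']
      congr 1
      push_cast
      ring
    have h4 : (N : ℂ) ^ D = (N : ℂ) ^ (D - 1) * N := by
      rw [← pow_succ, Nat.sub_add_cancel hD]
    rw [h4] at h3 ⊢
    have h5 : (N : ℂ) ^ (-scaling D 2 2) = ((N : ℂ) ^ (D - 1)) ^ 3 * N := by
      have : ((N : ℂ) ^ 2) ≠ 0 := pow_ne_zero _ hN'
      apply mul_right_cancel₀ this
      rw [h3]
      ring
    rw [h5]
    field_simp
  · intro C hC hC0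
    rw [h0 _ (Finset.mem_filter.mp hC).2, if_neg hC0, map_zero, zero_mul]
  · intro h
    simp at h

end Correlations

end QuarticTensor

namespace QuarticTensor

open Equiv Equiv.Perm

/-! ### The expansion of the four-point cumulant onto trace invariants -/

section InvariantExpansion

variable {D N : ℕ}

theorem eq_bubbleFour (π : Fin D → Perm (Fin 2)) :
    π = bubbleFour (Finset.univ.filter fun k => π k ≠ 1) := by
  funext k
  have h : ∀ p : Perm (Fin 2), p ≠ 1 → p = Equiv.swap 0 1 := by decide
  by_cases hk : π k = 1
  · simp [bubbleFour, hk]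
  · simp [bubbleFour, h _ hk]

/-- In each colour the faces induce the identity or the exchange on the two marks; `C` collects the
colours of the second kind. -/
theorem exists_prod_labelCount_eq {E : Type} [Finite E] (c : E → Fin D)
    (σ : Perm (Darts (Fin 2) E)) :
    ∃ (j : ℕ) (C : Finset (Fin D)), ∀ (N : ℕ) (a b : Fin 2 → Index D N),
      (∏ k, (labelCount (σ * flip c k) (fun m => a m k) (fun m => b m k) : ℂ)) =
        delta (bubbleFour C) a b * (N : ℂ) ^ j := by
  classical
  choose j π h1 h2 h3 using fun k => exists_labelCount_eq (σ * flip c k)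
  refine ⟨∑ k, j k, Finset.univ.filter fun k => (π k)⁻¹ ≠ 1, fun N a b => ?_⟩
  rw [← eq_bubbleFour fun k => (π k)⁻¹, delta_eq]
  simp only [h3]
  split_ifs with h
  · rw [one_mul, ← Finset.prod_pow_eq_pow_sum]
    refine Finset.prod_congr rfl fun k _ => ?_
    rw [if_pos, Nat.cast_pow]
    rw [← h]
    rfl
  · rw [zero_mul]
    obtain ⟨v, hv⟩ := Function.ne_iff.mp h
    obtain ⟨k, hk⟩ := Function.ne_iff.mp hv
    refine Finset.prod_eq_zero (Finset.mem_univ k) ?_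
    rw [if_neg, Nat.cast_zero]
    exact fun h => hk (congrFun h v)

theorem exists_perturbative_eq (hN : 1 ≤ N) :
    ∃ w : Finset (Fin D) → PowerSeries ℂ, ∀ a b : Fin 2 → Index D N,
      perturbative (monomial a b) =
        ∑ C, PowerSeries.C (delta (bubbleFour C) a b) * w C := by
  classical
  choose j S h using fun (n : ℕ) (c : Fin n → Fin D) (σ : Perm (Darts (Fin 2) (Fin n))) =>
    exists_prod_labelCount_eq c σ
  refine ⟨fun C => PowerSeries.mk fun n => ((N : ℂ) ^ (D - 1))⁻¹ ^ Fintype.card (Fin 2) *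
    (∑ c : Fin n → Fin D, ∑ σ : Perm (Darts (Fin 2) (Fin n)),
      ((N : ℂ) ^ (D - 1))⁻¹ ^ n * if S n c σ = C then (N : ℂ) ^ j n c σ else 0) /
        (2 ^ n * n.factorial), fun a b => ?_⟩
  ext n
  rw [coeff_perturbative_monomial hN, map_sum]
  simp only [PowerSeries.coeff_C_mul, PowerSeries.coeff_mk, h, ← mul_div_assoc]
  rw [← Finset.sum_div]
  congr 1
  simp only [Finset.mul_sum]
  symm
  rw [Finset.sum_comm]
  refine Finset.sum_congr rfl fun c _ => ?_
  rw [Finset.sum_comm]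
  refine Finset.sum_congr rfl fun σ _ => ?_
  rw [Finset.sum_eq_single (S n c σ)]
  · rw [if_pos rfl]
    ring
  · intro C _ hC
    rw [if_neg hC.symm]
    ring
  · intro h
    exact absurd (Finset.mem_univ _) h

theorem delta_swap (C : Finset (Fin D)) (a b : Fin 2 → Index D N) :
    delta (bubbleFour C) (fun v => a (Equiv.swap 0 1 v)) b = delta (bubbleFour Cᶜ) a b := by
  rw [delta_eq, delta_eq]
  have h : (fun v c => a (Equiv.swap 0 1 ((bubbleFour C c).symm v)) c) =
      fun v c => a ((bubbleFour Cᶜ c).symm v) c := by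
    funext v c
    by_cases hc : c ∈ C
    · simp [bubbleFour, hc]
      rfl
    · simp [bubbleFour, hc]
      rfl
  rw [h]

theorem symDelta_eq (C : Finset (Fin D)) (a b : Fin 2 → Index D N) :
    symDelta C a b = delta (bubbleFour C) a b + delta (bubbleFour Cᶜ) a b := by
  rw [symDelta, delta_swap]

theorem symDelta_compl (C : Finset (Fin D)) (a b : Fin 2 → Index D N) :
    symDelta Cᶜ a b = symDelta C a b := by
  rw [symDelta_eq, symDelta_eq, compl_compl, add_comm]

/-- A sum over subsets folded by complementation. -/
theorem sum_eq_sum_card_le (f v : Finset (Fin D) → PowerSeries ℂ) (hf : ∀ C, f Cᶜ = f C) :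
    ∑ C, f C * v C = ∑ C ∈ Finset.univ.filter (fun C : Finset (Fin D) => 2 * C.card ≤ D),
      f C * (v C + if 2 * C.card < D then v Cᶜ else 0) := by
  have hcard : ∀ C : Finset (Fin D), Cᶜ.card + C.card = D := fun C => by
    rw [Finset.card_compl_add_card, Fintype.card_fin]
  rw [← Finset.sum_filter_add_sum_filter_not Finset.univ
    (fun C : Finset (Fin D) => 2 * C.card ≤ D)]
  simp only [mul_add, Finset.sum_add_distrib]
  congr 1
  simp only [mul_ite, mul_zero]
  rw [← Finset.sum_filter, Finset.filter_filter]
  -- Sets with more than half of the colours are the complements of those with fewer than half. At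
  -- exactly half, both a set and its complement are already in the sum, whence the strict
  -- inequality.
  refine Finset.sum_nbij' compl compl ?_ ?_ ?_ ?_ ?_
  · intro C hC
    have := hcard C
    simp only [Finset.mem_filter, Finset.mem_univ, true_and] at hC ⊢
    omega
  · intro C hC
    have := hcard C
    simp only [Finset.mem_filter, Finset.mem_univ, true_and] at hC ⊢
    omega
  · intro C _
    exact compl_compl C
  · intro C _
    exact compl_compl C
  · intro C _
    rw [hf, compl_compl]

/-- The moment is invariant under exchange of the two white tensors, so it equals its average, hence
the factor `1 / 2`; folding by complementation leaves the sets with `2 |C| ≤ D`. The subtracted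
products affect only `C = ∅`. -/
theorem exists_isInvariantExpansion (hD : 1 ≤ D) (hN : 1 ≤ N) :
    ∃ W : Finset (Fin D) → PowerSeries ℂ, IsInvariantExpansion D N W := by
  obtain ⟨w, hw⟩ := exists_perturbative_eq (D := D) hN
  let v : Finset (Fin D) → PowerSeries ℂ := fun C =>
    PowerSeries.C (1 / 2 : ℂ) * (w C * (perturbative fun _ : Tensor D N => (1 : ℂ))⁻¹)
  let G : PowerSeries ℂ := PowerSeries.C ((N : ℂ) ^ (D - 1) * (N : ℂ) ^ D)⁻¹ *
    connOne (Fin D) ((N : ℂ) ^ D)⁻¹ ((N : ℂ) ^ D)⁻¹⁻¹ ((N : ℂ) ^ 2)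
  refine ⟨fun C => (v C + if 2 * C.card < D then v Cᶜ else 0) - if C = ∅ then G ^ 2 else 0,
    fun a b => ?_⟩
  have h1 : (fun T : Tensor D N => T (a 0) * T (a 1) *
      (starRingEnd ℂ (T (b 0)) * starRingEnd ℂ (T (b 1)))) = monomial a b := by
    funext T
    simp [monomial, Fin.prod_univ_two]
  have h2 : monomial (N := N) (fun v => a (Equiv.swap 0 1 v)) b = monomial a b := by
    funext T
    simp [monomial, Fin.prod_univ_two, mul_comm]
  have h3 : expectation (monomial a b) = ∑ C, PowerSeries.C (symDelta C a b) * v C := by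
    have h4 := hw (fun v => a (Equiv.swap 0 1 v)) b
    rw [h2] at h4
    have h5 : perturbative (monomial a b) = PowerSeries.C (1 / 2 : ℂ) *
        (perturbative (monomial a b) + perturbative (monomial a b)) := by
      rw [← two_mul, ← mul_assoc, ← map_ofNat (PowerSeries.C (R := ℂ)), ← map_mul]
      norm_num
    rw [expectation, h5]
    nth_rewrite 1 [hw a b]
    rw [h4, ← Finset.sum_add_distrib, Finset.mul_sum, Finset.sum_mul]
    refine Finset.sum_congr rfl fun C _ => ?_
    rw [symDelta, map_add]
    ring
  have h4 : ∀ a b : Index D N, cumulantTwo a b = PowerSeries.C (if a = b then 1 else 0) * G := by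
    intro a b
    rw [cumulantTwo_eq hD hN]
    split_ifs
    · rw [map_one, one_mul]
    · rw [map_zero, zero_mul, zero_mul]
  have h5 : ∀ a b : Fin 2 → Index D N, cumulantTwo (a 0) (b 0) * cumulantTwo (a 1) (b 1) =
      PowerSeries.C (delta (bubbleFour ∅) a b) * G ^ 2 := by
    intro a b
    rw [h4, h4, delta_eq]
    have h6 : (fun v c => a ((bubbleFour ∅ c).symm v) c) = a := rfl
    have h7 : a = b ↔ a 0 = b 0 ∧ a 1 = b 1 := by
      rw [funext_iff, Fin.forall_fin_two]
    rw [h6]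
    by_cases h8 : a 0 = b 0
    · by_cases h9 : a 1 = b 1
      · rw [if_pos h8, if_pos h9, if_pos (h7.mpr ⟨h8, h9⟩), map_one]
        ring
      · rw [if_neg h9, if_neg fun h => h9 (h7.mp h).2, map_zero]
        ring
    · rw [if_neg h8, if_neg fun h => h8 (h7.mp h).1, map_zero]
      ring
  have h6 : cumulantTwo (a 0) (b 1) * cumulantTwo (a 1) (b 0) =
      PowerSeries.C (delta (bubbleFour ∅) (fun v => a (Equiv.swap 0 1 v)) b) * G ^ 2 := by
    rw [← h5, mul_comm]
    rfl
  rw [cumulantFour, h1, h3, h5, h6, sub_sub, ← add_mul, ← map_add]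
  change _ - PowerSeries.C (symDelta ∅ a b) * G ^ 2 = _
  rw [sum_eq_sum_card_le _ _ fun C => by rw [symDelta_compl]]
  simp only [mul_sub, Finset.sum_sub_distrib]
  congr 1
  rw [Finset.sum_eq_single ∅]
  · rw [if_pos rfl]
  · intro C _ hC
    rw [if_neg hC, mul_zero]
  · intro h
    simp at h

end InvariantExpansion

end QuarticTensor

namespace QuarticTensor

open Equiv Equiv.Perm

/-! ### Large `N` limits and expansions -/

section LargeN

theorem excess_le {κ M E : Type} [Fintype κ] [DecidableEq κ] [Fintype M] [Fintype E] (c : E → κ)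
    {σ : Perm (Darts M E)} (hσ : IsConnected σ) :
    excess c σ ≤ Fintype.card E + 1 - cyc σ := by
  have := excess_add_cyc_le c hσ
  omega

/-- As `e ≤ l`, the weight is `(x w) ^ e * x ^ (l - e)`, where `x = N ^ (-D)` and `x w = N ^ (-(D -
2))` both tend to zero. -/
theorem tendsto_coeff_connPoly {D : ℕ} (hD : 3 ≤ D) {M : Type} [Fintype M] [DecidableEq M]
    (g : (Fin D → M → M → Prop) → ℂ) (n : ℕ) :
    Filter.Tendsto (fun N : ℕ => PowerSeries.coeff n
        (PowerSeries.map (Polynomial.evalRingHom ((N : ℂ) ^ D)⁻¹) (connPoly ((N : ℂ) ^ 2) g)))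
      Filter.atTop (nhds (PowerSeries.coeff n (atZero (connPoly 0 g)))) := by
  classical
  have hx : Filter.Tendsto (fun N : ℕ => ((N : ℂ) ^ D)⁻¹) Filter.atTop (nhds 0) := by
    have := (tendsto_inv_atTop_nhds_zero_nat (𝕜 := ℂ)).pow D
    rw [zero_pow (by omega)] at this
    simpa only [inv_pow] using this
  have hxw : Filter.Tendsto (fun N : ℕ => ((N : ℂ) ^ D)⁻¹ * (N : ℂ) ^ 2) Filter.atTop
      (nhds 0) := by
    have := (tendsto_inv_atTop_nhds_zero_nat (𝕜 := ℂ)).pow (D - 2)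
    rw [zero_pow (by omega)] at this
    refine this.congr' ?_
    filter_upwards [Filter.eventually_ge_atTop 1] with N hN
    have hN' : (N : ℂ) ≠ 0 := by exact_mod_cast (by omega : N ≠ 0)
    have h : (N : ℂ) ^ D = (N : ℂ) ^ (D - 2) * (N : ℂ) ^ 2 := by
      rw [← pow_add, Nat.sub_add_cancel (by omega)]
    rw [h, inv_pow]
    field_simp
  simp only [atZero, connPoly, PowerSeries.coeff_map, PowerSeries.coeff_mk, map_mul, map_sum,
    map_pow, Polynomial.coe_evalRingHom, Polynomial.eval_C, Polynomial.eval_X]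
  refine Filter.Tendsto.const_mul _ (tendsto_finsetSum _ fun c _ => tendsto_finsetSum _
    fun σ hσ => ?_)
  have hle := excess_le c (Finset.mem_filter.mp hσ).2
  rw [Fintype.card_fin] at hle
  set l := n + 1 - cyc σ
  have h1 : ∀ x w : ℂ, x ^ l * (w ^ excess c σ * g (faceRel c σ)) =
      (x * w) ^ excess c σ * x ^ (l - excess c σ) * g (faceRel c σ) := by
    intro x w
    rw [mul_pow, mul_right_comm (x ^ _), ← pow_add, Nat.add_sub_cancel' hle, mul_assoc]
  have h2 := ((hxw.pow (excess c σ)).mul (hx.pow (l - excess c σ))).mul_const (g (faceRel c σ))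
  simp only [h1, mul_zero]
  exact h2

/-! ### Expansions uniform in the rank -/

variable {n : ℕ}

/-- A colour carried by no edge has one face per vertex and so adds nothing to the excess. Hence the
excess does not depend on the rank in which a colouring is viewed. -/
theorem excess_comp {κ κ' M E : Type} [Fintype κ] [DecidableEq κ] [Fintype κ'] [DecidableEq κ']
    [Finite M] [Fintype E] {f : κ → κ'} (hf : Function.Injective f) (c : E → κ)
    (σ : Perm (Darts M E)) : excess (f ∘ c) σ = excess c σ := by
  have h1 : ∀ k, flip (M := M) (f ∘ c) (f k) = flip c k := by
    intro k
    ext x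
    rcases x with m | ⟨e, b⟩
    · rfl
    · simp [hf.eq_iff]
  have h2 : ∀ k ∉ Set.range f, flip (M := M) (f ∘ c) k = 1 := by
    intro k hk
    ext x
    rcases x with m | ⟨e, b⟩
    · rfl
    · have : f (c e) ≠ k := fun h => hk ⟨_, h⟩
      simp [this]
  have h3 : ∑ k, ((cyc (σ * flip c k) : ℤ) - cyc σ) =
      ∑ k, ((cyc (σ * flip (f ∘ c) k) : ℤ) - cyc σ) := by
    refine Fintype.sum_of_injective f hf _ _ (fun k hk => ?_) fun k => ?_
    · rw [h2 k hk, mul_one, sub_self]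
    · rw [h1]
  have h4 := excess_spec c σ
  have h5 := excess_spec (f ∘ c) σ
  rw [Finset.sum_sub_distrib, Finset.sum_sub_distrib, Finset.sum_const, Finset.sum_const,
    Finset.card_univ, Finset.card_univ, nsmul_eq_mul, nsmul_eq_mul] at h3
  zify at h4 h5
  linarith

/-- A sum over colourings, invariant under injections of the set of colours, sorted by the number
of colours which occur. -/
theorem sum_colorings_eq (F : ∀ j : ℕ, (Fin n → Fin j) → ℂ)
    (hF : ∀ (j D : ℕ) (f : Fin j → Fin D), Function.Injective f → ∀ c, F D (f ∘ c) = F j c)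
    (D : ℕ) :
    ∑ c, F D c = ∑ j ∈ Finset.range (n + 1), (D.choose j : ℂ) *
      ∑ c : Fin n → Fin j with Function.Surjective c, F j c := by
  classical
  -- After numbering its elements, a colouring with image `S` is a surjection onto `Fin S.card`.
  have h1 : ∀ S : Finset (Fin D), ∑ c : Fin n → Fin D with Finset.univ.image c = S, F D c =
      ∑ c : Fin n → Fin S.card with Function.Surjective c, F S.card c := by
    intro S
    let e : Fin S.card ≃ {x // x ∈ S} := S.equivFin.symm
    let f : Fin S.card → Fin D := fun i => e i
    have hf : Function.Injective f := Subtype.val_injective.comp e.injective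
    symm
    refine Finset.sum_bij (fun c _ => f ∘ c) (fun c hc => ?_) (fun c _ c' _ h => ?_)
      (fun c hc => ?_) fun c _ => (hF _ _ f hf c).symm
    · rw [Finset.mem_filter] at hc ⊢
      refine ⟨Finset.mem_univ _, ?_⟩
      ext k
      simp only [Finset.mem_image, Finset.mem_univ, true_and, Function.comp_apply]
      constructor
      · rintro ⟨i, rfl⟩
        exact (e (c i)).2
      · intro hk
        obtain ⟨i, hi⟩ := hc.2 (e.symm ⟨k, hk⟩)
        exact ⟨i, by simp [f, hi]⟩
    · exact hf.comp_left h
    · have hc' := (Finset.mem_filter.mp hc).2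
      have hmem : ∀ i, c i ∈ S := fun i => hc' ▸ Finset.mem_image_of_mem c (Finset.mem_univ i)
      refine ⟨fun i => e.symm ⟨c i, hmem i⟩, ?_, ?_⟩
      · rw [Finset.mem_filter]
        refine ⟨Finset.mem_univ _, fun k => ?_⟩
        have hk : (e k : Fin D) ∈ Finset.univ.image c := hc'.symm ▸ (e k).2
        obtain ⟨i, _, hi⟩ := Finset.mem_image.mp hk
        refine ⟨i, ?_⟩
        rw [Equiv.symm_apply_eq]
        exact Subtype.ext hi
      · funext i
        simp [f]
  have h2 : ∀ j, n < j → ∑ c : Fin n → Fin j with Function.Surjective c, F j c = 0 := by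
    intro j hj
    refine Finset.sum_eq_zero fun c hc => ?_
    have := Fintype.card_le_of_surjective c (Finset.mem_filter.mp hc).2
    simp only [Fintype.card_fin] at this
    omega
  rw [← Finset.sum_fiberwise_of_maps_to (t := Finset.univ.powerset)
    (g := fun c : Fin n → Fin D => Finset.univ.image c)
    (fun c _ => by simp), Finset.sum_congr rfl fun S _ => h1 S,
    Finset.sum_powerset_apply_card
      (fun j => ∑ c : Fin n → Fin j with Function.Surjective c, F j c)]
  rw [Finset.card_univ, Fintype.card_fin]
  simp only [nsmul_eq_mul]
  rcases le_total D n with h | h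
  · refine Finset.sum_subset (Finset.range_subset_range.mpr (by omega)) fun j _ hj => ?_
    rw [Nat.choose_eq_zero_of_lt (by simpa using hj)]
    simp
  · refine (Finset.sum_subset (Finset.range_subset_range.mpr (by omega)) fun j _ hj => ?_).symm
    rw [h2 j (by simpa using hj), mul_zero]

open scoped Classical in
theorem coeff_twoPoint {D N : ℕ} (hD : 1 ≤ D) (hN : 1 ≤ N) :
    PowerSeries.coeff n (twoPoint D N) = (2 ^ n * n.factorial : ℂ)⁻¹ *
      ∑ c : Fin n → Fin D, ∑ σ : Perm (Darts Unit (Fin n)) with IsConnected σ,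
        (N : ℂ) ^ (-(((n + 1 - cyc σ : ℕ) : ℤ) * D - (2 * excess c σ : ℕ))) := by
  have hN' : (N : ℂ) ≠ 0 := by exact_mod_cast (by omega : N ≠ 0)
  rw [twoPoint_eq hD hN]
  simp only [connPoly, PowerSeries.coeff_map, PowerSeries.coeff_mk, map_mul, map_sum,
    map_pow, Polynomial.coe_evalRingHom, Polynomial.eval_C, Polynomial.eval_X]
  refine congrArg _ (Finset.sum_congr rfl fun c _ => Finset.sum_congr rfl fun σ _ => ?_)
  rw [neg_sub, zpow_sub₀ hN', zpow_natCast, mul_comm ((_ : ℕ) : ℤ) (D : ℤ), zpow_mul, zpow_natCast,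
    zpow_natCast, inv_pow, mul_one, pow_mul, div_eq_mul_inv, mul_comm]

-- The linear term in `x` selects one independent cycle, and `w = 0` selects excess zero.
open scoped Classical in
theorem coeff_twoPointFormula {D : ℕ} (hD : 1 ≤ D) :
    PowerSeries.coeff n (twoPointFormula D) = (2 ^ n * n.factorial : ℂ)⁻¹ *
      ∑ c : Fin n → Fin D, ∑ σ : Perm (Darts Unit (Fin n)) with IsConnected σ,
        if n + 1 - cyc σ = 1 ∧ excess c σ = 0 then 1 else 0 := by
  rw [← linearTerm_polyOne (Fintype.card_fin D) hD]
  simp only [linearTerm, polyOne, connPoly, PowerSeries.coeff_mk, Polynomial.coeff_C_mul,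
    Polynomial.finsetSum_coeff, Polynomial.coeff_mul_C, Polynomial.coeff_X_pow, mul_one]
  refine congrArg _ (Finset.sum_congr rfl fun c _ => Finset.sum_congr rfl fun σ _ => ?_)
  by_cases h : n + 1 - cyc σ = 1
  · by_cases h' : excess c σ = 0
    · simp [h, h']
    · simp [h']
  · simp [h, Ne.symm h]

/-- The polynomial whose value at `D` is the binomial coefficient of `D` and `j`. -/
noncomputable def choosePoly (j : ℕ) : Polynomial ℂ :=
  Polynomial.C ((j.factorial : ℂ)⁻¹) * descPochhammer ℂ j

theorem eval_choosePoly (j D : ℕ) : (choosePoly j).eval (D : ℂ) = D.choose j := by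
  have h : (j.factorial : ℂ) ≠ 0 := by exact_mod_cast j.factorial_ne_zero
  rw [choosePoly, Polynomial.eval_mul, Polynomial.eval_C, descPochhammer_eval_eq_descFactorial,
    Nat.descFactorial_eq_factorial_mul_choose, Nat.cast_mul, inv_mul_cancel_left₀ h]

open scoped Classical in
/-- The coefficients of the expansion of the two-point function, uniformly in the rank. -/
noncomputable def uniformCoeff (n : ℕ) : ℕ × ℕ →₀ Polynomial ℂ :=
  ∑ j ∈ Finset.range (n + 1), ∑ c : Fin n → Fin j with Function.Surjective c,
    ∑ σ : Perm (Darts Unit (Fin n)) with IsConnected σ,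
      Finsupp.single (n + 1 - cyc σ, 2 * excess c σ)
        (Polynomial.C (2 ^ n * n.factorial : ℂ)⁻¹ * choosePoly j)

open scoped Classical in
/-- Additive functions of the uniform coefficients are computed by sums over maps. -/
theorem map_uniformCoeff (D : ℕ) (φ : ℕ × ℕ → ℂ) (Φ : (ℕ × ℕ →₀ Polynomial ℂ) →+ ℂ)
    (hΦ : ∀ lm P, Φ (Finsupp.single lm P) = P.eval (D : ℂ) * φ lm) :
    Φ (uniformCoeff n) = (2 ^ n * n.factorial : ℂ)⁻¹ *
      ∑ c : Fin n → Fin D, ∑ σ : Perm (Darts Unit (Fin n)) with IsConnected σ,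
        φ (n + 1 - cyc σ, 2 * excess c σ) := by
  rw [sum_colorings_eq (fun j c => ∑ σ : Perm (Darts Unit (Fin n)) with IsConnected σ,
    φ (n + 1 - cyc σ, 2 * excess c σ)) (fun j D f hf c => by simp only [excess_comp hf]) D,
    uniformCoeff]
  simp only [map_sum, hΦ, Polynomial.eval_mul, Polynomial.eval_C, eval_choosePoly, Finset.mul_sum]
  refine Finset.sum_congr rfl fun j _ => Finset.sum_congr rfl fun c _ =>
    Finset.sum_congr rfl fun σ _ => ?_
  ring

theorem isUniformExpansion_uniformCoeff : IsUniformExpansion uniformCoeff := by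
  intro D N n hD hN
  rw [coeff_twoPoint (by omega) hN]
  exact (map_uniformCoeff D (fun lm => (N : ℂ) ^ (-((lm.1 : ℤ) * D - lm.2)))
    (Finsupp.liftAddHom fun lm => (AddMonoidHom.mulRight
      ((N : ℂ) ^ (-((lm.1 : ℤ) * D - lm.2)))).comp
        (Polynomial.evalRingHom (D : ℂ)).toAddMonoidHom)
    fun lm P => by rw [Finsupp.liftAddHom_apply_single]; rfl).symm

theorem eval_uniformCoeff {D : ℕ} (hD : 1 ≤ D) :
    (uniformCoeff n (1, 0)).eval (D : ℂ) = PowerSeries.coeff n (twoPointFormula D) := by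
  classical
  rw [coeff_twoPointFormula hD]
  have h := map_uniformCoeff (n := n) D (fun lm => if lm = (1, 0) then 1 else 0)
    ((Polynomial.evalRingHom (D : ℂ)).toAddMonoidHom.comp (Finsupp.applyAddHom (1, 0)))
    fun lm P => by
      simp only [AddMonoidHom.comp_apply, Finsupp.applyAddHom_apply, Finsupp.single_apply]
      split_ifs <;> simp
  refine Eq.trans h (congrArg _ (Finset.sum_congr rfl fun c _ => Finset.sum_congr rfl
    fun σ _ => ?_))
  simp only [Prod.mk.injEq, mul_eq_zero, OfNat.ofNat_ne_zero, false_or]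

/-- Laurent polynomials which agree at all positive integers have the same coefficients. -/
theorem laurent_ext {e e' : ℤ →₀ ℂ} (h : ∀ N : ℕ, 1 ≤ N →
    (e.sum fun k x => x * (N : ℂ) ^ (-k)) = e'.sum fun k x => x * (N : ℂ) ^ (-k)) : e = e' := by
  classical
  rw [← sub_eq_zero]
  set f := e - e' with hf
  have hf0 : ∀ N : ℕ, 1 ≤ N → (f.sum fun k x => x * (N : ℂ) ^ (-k)) = 0 := by
    intro N hN
    rw [hf, Finsupp.sum_sub_index fun k x y => sub_mul x y _, h N hN, sub_self]
  -- Multiplying by `N ^ K` clears the negative powers and leaves a polynomial with infinitely many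
  -- roots.
  obtain ⟨K, hK⟩ := f.support.exists_le
  let p : Polynomial ℂ := ∑ k ∈ f.support, Polynomial.C (f k) * Polynomial.X ^ (K - k).toNat
  have hp : p = 0 := by
    refine Polynomial.eq_zero_of_infinite_isRoot _ (Set.Infinite.mono
      (s := Set.range fun N : ℕ => ((N + 1 : ℕ) : ℂ)) ?_
      (Set.infinite_range_of_injective fun a b hab => by simpa using hab))
    rintro _ ⟨N, rfl⟩
    have hN : ((N + 1 : ℕ) : ℂ) ≠ 0 := by exact_mod_cast N.succ_ne_zero
    have h1 := hf0 (N + 1) (by omega)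
    have h2 : p.eval ((N + 1 : ℕ) : ℂ) = ((N + 1 : ℕ) : ℂ) ^ K *
        f.sum fun k x => x * ((N + 1 : ℕ) : ℂ) ^ (-k) := by
      rw [Finsupp.sum, Finset.mul_sum, Polynomial.eval_finsetSum]
      refine Finset.sum_congr rfl fun k hk => ?_
      rw [Polynomial.eval_mul, Polynomial.eval_C, Polynomial.eval_pow, Polynomial.eval_X,
        mul_left_comm, ← zpow_add₀ hN, ← sub_eq_add_neg, ← zpow_natCast,
        Int.toNat_of_nonneg (sub_nonneg.mpr (hK k hk))]
    change p.eval _ = 0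
    rw [h2, h1, mul_zero]
  ext k
  by_contra hk
  have hk' : k ∈ f.support := Finsupp.mem_support_iff.mpr hk
  have h1 : p.coeff (K - k).toNat = f k := by
    rw [Polynomial.finsetSum_coeff, Finset.sum_eq_single k]
    · rw [Polynomial.coeff_C_mul, Polynomial.coeff_X_pow, if_pos rfl, mul_one]
    · intro i hi hik
      rw [Polynomial.coeff_C_mul, Polynomial.coeff_X_pow, if_neg, mul_zero]
      have := hK k hk'
      have := hK i hi
      omega
    · exact fun h => absurd hk' h
  rw [hp, Polynomial.coeff_zero] at h1
  exact hk h1.symm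

-- For `D ≥ 5` and `l ≥ 2`, `e ≤ l` gives `l D - 2 e ≥ l (D - 2) > D`, so the exponent `D` comes
-- only from `l = 1`, `e = 0`.
open scoped Classical in
theorem exists_isLargeNExpansion {D : ℕ} (hD : 5 ≤ D) (n : ℕ) :
    ∃ e : ℤ →₀ ℂ, IsLargeNExpansion D n e ∧
      e (D : ℤ) = PowerSeries.coeff n (twoPointFormula D) := by
  refine ⟨∑ c : Fin n → Fin D, ∑ σ : Perm (Darts Unit (Fin n)) with IsConnected σ,
    Finsupp.single (((n + 1 - cyc σ : ℕ) : ℤ) * D - (2 * excess c σ : ℕ))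
      (2 ^ n * n.factorial : ℂ)⁻¹, fun N hN => ?_, ?_⟩
  · rw [coeff_twoPoint (by omega) hN]
    let Φ : (ℤ →₀ ℂ) →+ ℂ := Finsupp.liftAddHom fun k => AddMonoidHom.mulRight ((N : ℂ) ^ (-k))
    have hΦ : ∀ k x, Φ (Finsupp.single k x) = x * (N : ℂ) ^ (-k) := fun k x =>
      Finsupp.liftAddHom_apply_single _ _ _
    change _ = Φ _
    simp only [map_sum, hΦ, Finset.mul_sum]
  · rw [coeff_twoPointFormula (by omega), Finsupp.finsetSum_apply, Finset.mul_sum]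
    refine Finset.sum_congr rfl fun c _ => ?_
    rw [Finsupp.finsetSum_apply, Finset.mul_sum]
    refine Finset.sum_congr rfl fun σ hσ => ?_
    have hle := excess_le c (Finset.mem_filter.mp hσ).2
    rw [Fintype.card_fin] at hle
    rw [Finsupp.single_apply, mul_ite, mul_one, mul_zero]
    refine if_congr ⟨fun h => ?_, fun h => ?_⟩ rfl rfl
    · generalize n + 1 - cyc σ = l at h hle ⊢
      push_cast at h
      have hl : l ≤ 1 := by
        by_contra hl
        have h1 : (2 : ℤ) ≤ l := by exact_mod_cast (by omega : 2 ≤ l)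
        have h2 : (excess c σ : ℤ) ≤ l := by exact_mod_cast hle
        have h3 : (5 : ℤ) ≤ D := by exact_mod_cast hD
        nlinarith
      interval_cases l
      · omega
      · omega
    · rw [h.1, h.2]
      simp

theorem isLargeNExpansion_apply {D : ℕ} (hD : 5 ≤ D) {n : ℕ} {e : ℤ →₀ ℂ}
    (he : IsLargeNExpansion D n e) : e (D : ℤ) = PowerSeries.coeff n (twoPointFormula D) := by
  obtain ⟨e', he', h⟩ := exists_isLargeNExpansion hD n
  have : e = e' := laurent_ext fun N hN => (he N hN).symm.trans (he' N hN)
  rw [this, h]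

/-- When every `m` is below `D`, the equation `l D - m = D` forces `(l, m) = (1, 0)`, so the
coefficient of `N ^ (-D)` is a single evaluation. -/
theorem eval_eq_coeff_twoPointFormula {A : ℕ → (ℕ × ℕ →₀ Polynomial ℂ)}
    (hA : IsUniformExpansion A) {D : ℕ} (hD : 5 ≤ D) (hn : ∀ lm ∈ (A n).support, lm.2 < D) :
    (A n (1, 0)).eval (D : ℂ) = PowerSeries.coeff n (twoPointFormula D) := by
  classical
  let e : ℤ →₀ ℂ := (A n).sum fun lm P =>
    Finsupp.single ((lm.1 : ℤ) * D - lm.2) (P.eval (D : ℂ))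
  have he : IsLargeNExpansion D n e := by
    intro N hN
    rw [hA D N n (by omega) hN]
    let Φ : (ℤ →₀ ℂ) →+ ℂ := Finsupp.liftAddHom fun k => AddMonoidHom.mulRight ((N : ℂ) ^ (-k))
    have hΦ : ∀ k x, Φ (Finsupp.single k x) = x * (N : ℂ) ^ (-k) := fun k x =>
      Finsupp.liftAddHom_apply_single _ _ _
    change _ = Φ e
    simp only [e, Finsupp.sum, map_sum, hΦ]
  rw [← isLargeNExpansion_apply hD he, Finsupp.sum_apply, Finsupp.sum,
    Finset.sum_eq_single (1, 0)]
  · simp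
  · intro lm hlm hne
    rw [Finsupp.single_apply, if_neg]
    intro h
    have h1 := hn lm hlm
    obtain ⟨l, m⟩ := lm
    simp only at h h1
    have h2 : l = 1 := by
      rcases lt_trichotomy l 1 with hl | hl | hl
      · have : l = 0 := by omega
        subst this
        omega
      · exact hl
      · have h3 : (2 : ℤ) ≤ l := by exact_mod_cast hl
        have h4 : (m : ℤ) < D := by exact_mod_cast h1
        nlinarith
    subst h2
    exact hne (by rw [show m = 0 by omega])
  · intro h
    rw [Finsupp.notMem_support_iff.mp h]
    simp

theorem orderD_eq {A : ℕ → (ℕ × ℕ →₀ Polynomial ℂ)} (hA : IsUniformExpansion A) {D : ℕ}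
    (hD : 1 ≤ D) : orderD A D = twoPointFormula D := by
  ext n
  rw [orderD, PowerSeries.coeff_mk, ← eval_uniformCoeff hD]
  congr 1
  obtain ⟨K, hK⟩ := ((A n).support.image Prod.snd).exists_le
  -- Ranks above `K` separate the exponents and `5` makes the plain expansion applicable; agreement
  -- at these infinitely many ranks gives equality of polynomials, valid at every `D`.
  refine Polynomial.eq_of_infinite_eval_eq _ _ (Set.Infinite.mono
    (s := Set.range fun N : ℕ => ((N + K + 5 : ℕ) : ℂ)) ?_
    (Set.infinite_range_of_injective fun a b hab => by simpa using hab))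
  rintro _ ⟨N, rfl⟩
  change Polynomial.eval _ _ = Polynomial.eval _ _
  rw [eval_uniformCoeff (by omega), eval_eq_coeff_twoPointFormula hA (by omega)]
  intro lm hlm
  have := hK lm.2 (Finset.mem_image_of_mem _ hlm)
  omega

end LargeN

end QuarticTensor

theorem mainTheorem5 :
    -- the leading order of the two-point function is `T(z) = (1 - √(1 - 4 D z)) / (2 D z)`
    (∀ D : ℕ, 3 ≤ D → ∀ n : ℕ,
      Filter.Tendsto (fun N : ℕ => PowerSeries.coeff n (QuarticTensor.twoPoint D N))
        Filter.atTop (nhds (PowerSeries.coeff n (QuarticTensor.treeSeries D)))) ∧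
    -- the order `1/N^D` of the two-point function, for all `D ≥ 3`
    (∃ A : ℕ → (ℕ × ℕ →₀ Polynomial ℂ), QuarticTensor.IsUniformExpansion A) ∧
    (∀ A : ℕ → (ℕ × ℕ →₀ Polynomial ℂ), QuarticTensor.IsUniformExpansion A →
      ∀ D : ℕ, 3 ≤ D → QuarticTensor.orderD A D = QuarticTensor.twoPointFormula D) ∧
    -- for `D ≥ 5` it is the plain coefficient of `N^{-D}` of the `1/N` expansion
    (∀ D : ℕ, 5 ≤ D → ∀ n : ℕ,
      (∃ e : ℤ →₀ ℂ, QuarticTensor.IsLargeNExpansion D n e) ∧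
      ∀ e : ℤ →₀ ℂ, QuarticTensor.IsLargeNExpansion D n e →
        e (D : ℤ) = PowerSeries.coeff n (QuarticTensor.twoPointFormula D)) ∧
    -- the leading order of `K(B_{4,∅}; N, z)`
    (∀ D : ℕ, 3 ≤ D →
      (∀ N : ℕ, 1 ≤ N → ∃ W : Finset (Fin D) → PowerSeries ℂ,
        QuarticTensor.IsInvariantExpansion D N W) ∧
      ∃ K : PowerSeries ℂ,
        (∀ W : ℕ → Finset (Fin D) → PowerSeries ℂ,
          (∀ N : ℕ, 2 ≤ N → QuarticTensor.IsInvariantExpansion D N (W N)) →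
          ∀ n : ℕ, Filter.Tendsto
            (fun N : ℕ => PowerSeries.coeff n (QuarticTensor.rescaledFourEmpty D N (W N)))
            Filter.atTop (nhds (PowerSeries.coeff n K))) ∧
        K = QuarticTensor.fourPointFormula D ∧
        K = QuarticTensor.multicoloredChainSeries D) := by
  classical
  refine ⟨fun D hD n => ?_, ⟨_, QuarticTensor.isUniformExpansion_uniformCoeff⟩,
    fun A hA D hD => QuarticTensor.orderD_eq hA (by omega), fun D hD n => ⟨?_, fun e he =>
      QuarticTensor.isLargeNExpansion_apply hD he⟩, fun D hD => ⟨fun N hN =>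
        QuarticTensor.exists_isInvariantExpansion (by omega) hN, QuarticTensor.fourPointFormula D,
        fun W hW n => ?_, rfl, (QuarticTensor.multicoloredChainSeries_eq (by omega)).symm⟩⟩
  · have h := QuarticTensor.tendsto_coeff_connPoly hD (M := Unit) (fun _ => 1) n
    change Filter.Tendsto _ _ (nhds (PowerSeries.coeff n
      (QuarticTensor.atZero (QuarticTensor.polyOne (Fin D))))) at h
    rw [QuarticTensor.atZero_polyOne (Fintype.card_fin D) (by omega)] at h
    refine h.congr' ?_
    filter_upwards [Filter.eventually_ge_atTop 1] with N hN
    rw [QuarticTensor.twoPoint_eq (by omega) hN]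
  · obtain ⟨e, he, -⟩ := QuarticTensor.exists_isLargeNExpansion hD n
    exact ⟨e, he⟩
  · have h := QuarticTensor.tendsto_coeff_connPoly hD (M := Bool)
      (fun r => if {k | r k false true} = ∅ then 1 else 0) n
    change Filter.Tendsto _ _ (nhds (PowerSeries.coeff n (QuarticTensor.atZero
      (QuarticTensor.polyTwo fun B : Set (Fin D) => if B = ∅ then 1 else 0)))) at h
    rw [QuarticTensor.atZero_polyTwo_empty (Fintype.card_fin D) (by omega)] at h
    refine h.congr' ?_
    -- Two distinct index values are needed, hence `N ≥ 2`.
    filter_upwards [Filter.eventually_ge_atTop 2] with N hN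
    rw [QuarticTensor.rescaledFourEmpty_eq (by omega) hN (hW N hN)]
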